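/- Let $n\ge 1$ and let $\mathbf T=(T_1,\dots,T_k)$ be a system of bounded operators on a complex Hilbert space $H$ that is \emph{$n$-homogeneous}, i.e. every nonzero irreducible representation of the (not necessarily unital) $C^*$-algebra $C^*(\mathbf T)\subset B(H)$ generated by $T_1,\dots,T_k$ is $n$-dimensional. (Representations are $*$-homomorphisms, not assumed to preserve units.) Let $$X=\sigma_n(\mathbf T)=\{(\pi(T_1),\dots,\pi(T_k)) : \pi\colon C^*(\mathbf T)\to M_n \text{ a nonzero } *\text{-homomorphism}\}\subset (M_n)^k$$ be the $n$-spectrum of $\mathbf T$, with the topology of $(M_n)^k$ and the action $U.(A_1,\dots,A_k)=(UA_1U^{-1},\dots,UA_kU^{-1})$ of the unitary $n\times n$ matrices $U$. Let $\mathfrak B C^*(X,.)$ be the set of bounded Borel functions $f\colon X\to M_n$ with $f(U.x)=Uf(x)U^{-1}$ for all unitary $U$ and all $x\in X$. A \emph{spectral $n$-measure} on $X$ is a matrix $E=[E_{jk}]_{j,k=1}^n$ of functions from the Borel sets of $X$ to $B(H)$ such that (i) $A\mapsto\langle E_{jk}(A)h,w\rangle$ is a regular complex measure for all $j,k$ and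 all $h,w\in H$; (ii) $E(U.A)=UE(A)U^{-1}$ for all unitary $U\in M_n$ and all Borel sets $A$; (iii) $\left(\int f\,dE\right)^*=\int f^*\,dE$ and $\int fg\,dE=\int f\,dE\cdot\int g\,dE$ for all $f,g\in\mathfrak B C^*(X,.)$. Here $\int f\,dE=\sum_{j,k}\int_X f_{jk}\,dE_{kj}\in B(H)$, where $\int_X\varphi\,dE_{kj}$ is the operator with $\left\langle\left(\int_X \varphi\,dE_{kj}\right)h,w\right\rangle=\int_X \varphi\,d\langle E_{kj}(\cdot)h,w\rangle$ for all $h,w\in H$. There is a unique spectral $n$-measure $E_{\mathbf T}$ on $X$ with $\int p_j\,dE_{\mathbf T}=T_j$ for $j=1,\dots,k$, where $p_j(A_1,\dots,A_k)=A_j$. Put $f(\mathbf T):=\int f\,dE_{\mathbf T}$ for $f\in\mathfrak B C^*(X,.)$. If $M$ is a von Neumann algebra on $H$ with $T_1,\dots,T_k\in M$, then: (a) $f(\mathbf T)\in M$ for every $f\in\mathfrak B C^*(X,.)$; (b) if $f^{(1)},f^{(2)},\ldots\in\mathfrak B C^*(X,.)$ converge pointwise to a function $f\colon X\to M_n$ and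 $\|f^{(m)}(x)\|\le C$ for some constant $C$ and all $m\ge1$, $x\in X$, then $f\in\mathfrak B C^*(X,.)$ and $\lim_{m\to\infty}f^{(m)}(\mathbf T)h=f(\mathbf T)h$ for every $h\in H$. -/

import Mathlib

open MeasureTheory Filter Topology
open scoped InnerProductSpace

universe u

/-! ### `n`-homogeneous `C*`-algebras and systems -/

/-- A representation `π : A → B(K)` (a `*`-homomorphism, not assumed to preserve units) is
irreducible if the only closed subspaces of `K` invariant under `π(A)` are `{0}` and `K`. -/
def IsIrreducibleRep {A : Type*} [NonUnitalRing A] [Module ℂ A] [Star A]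
    {K : Type*} [NormedAddCommGroup K] [InnerProductSpace ℂ K] [CompleteSpace K]
    (π : A →⋆ₙₐ[ℂ] (K →L[ℂ] K)) : Prop :=
  ∀ W : Submodule ℂ K, IsClosed (W : Set K) → (∀ a : A, ∀ v ∈ W, π a v ∈ W) → W = ⊥ ∨ W = ⊤

/-- A `C*`-algebra `A` is `n`-homogeneous (`n ≥ 1`) if each of its nonzero irreducible
representations is `n`-dimensional. (A nonzero irreducible representation is cyclic, hence it is
unitarily equivalent to one on a Hilbert space in the universe of `A`; so no representation is
lost by the choice of the universe of `K`.) -/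
def IsNHomogeneous (n : ℕ) (A : Type u) [NonUnitalRing A] [Module ℂ A] [Star A] : Prop :=
  ∀ (K : Type u) [NormedAddCommGroup K] [InnerProductSpace ℂ K] [CompleteSpace K]
    (π : A →⋆ₙₐ[ℂ] (K →L[ℂ] K)),
    (∃ a, π a ≠ 0) → IsIrreducibleRep π → Module.finrank ℂ K = n

section System

variable {H : Type u} [NormedAddCommGroup H] [InnerProductSpace ℂ H] [CompleteSpace H]

/-- `C*(T₁, …, T_k)`: the (not necessarily unital) `C*`-subalgebra of `B(H)` generated by
`T₁, …, T_k`. -/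
noncomputable def generatedCStar {k : ℕ} (T : Fin k → H →L[ℂ] H) :
    NonUnitalStarSubalgebra ℂ (H →L[ℂ] H) :=
  (NonUnitalStarAlgebra.adjoin ℂ (Set.range T)).topologicalClosure

theorem mem_generatedCStar {k : ℕ} (T : Fin k → H →L[ℂ] H) (j : Fin k) :
    T j ∈ generatedCStar T :=
  NonUnitalStarSubalgebra.le_topologicalClosure _
    (NonUnitalStarAlgebra.subset_adjoin ℂ _ (Set.mem_range_self j))

/-- The system `(T₁, …, T_k)` is `n`-homogeneous if `C*(T₁, …, T_k)` is. -/
def IsNHomogeneousSystem (n : ℕ) {k : ℕ} (T : Fin k → H →L[ℂ] H) : Prop :=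
  IsNHomogeneous n (generatedCStar T)

/-- The `n`-spectrum `σ_n(T)`: all systems `(π(T₁), …, π(T_k))` of `n × n` matrices, where `π`
runs over the nonzero representations `π : C*(T₁, …, T_k) → M_n`. -/
def nSpectrum (n : ℕ) {k : ℕ} (T : Fin k → H →L[ℂ] H) :
    Set (Fin k → Matrix (Fin n) (Fin n) ℂ) :=
  {A | ∃ π : generatedCStar T →⋆ₙₐ[ℂ] Matrix (Fin n) (Fin n) ℂ,
    (∃ a, π a ≠ 0) ∧ ∀ j, A j = π ⟨T j, mem_generatedCStar T j⟩}

/-- The conjugation action `U.(A₁, …, A_k) = (U A₁ U⁻¹, …, U A_k U⁻¹)` on `σ_n(T)`. Scalar unitaries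
act trivially, so this is the same as the action of the quotient of the unitary group by its
centre. -/
noncomputable instance nSpectrum.instMulAction (n : ℕ) {k : ℕ} (T : Fin k → H →L[ℂ] H) :
    MulAction (Matrix.unitaryGroup (Fin n) ℂ) (nSpectrum n T) where
  smul U A := ⟨fun j => (U : Matrix (Fin n) (Fin n) ℂ) * A.1 j *
      star (U : Matrix (Fin n) (Fin n) ℂ), by
    obtain ⟨A, π, ⟨a, ha⟩, hA⟩ := A
    refine ⟨((Unitary.conjStarAlgAut ℂ (Matrix (Fin n) (Fin n) ℂ) U :
      Matrix (Fin n) (Fin n) ℂ ≃⋆ₐ[ℂ] Matrix (Fin n) (Fin n) ℂ) :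
      Matrix (Fin n) (Fin n) ℂ →⋆ₙₐ[ℂ] Matrix (Fin n) (Fin n) ℂ).comp π,
      ⟨a, fun h => ha ?_⟩, fun j => ?_⟩
    · exact (map_eq_zero_iff (Unitary.conjStarAlgAut ℂ (Matrix (Fin n) (Fin n) ℂ) U)
        (EquivLike.injective _)).1 h
    · simp only [hA j]
      rfl⟩
  one_smul A := Subtype.ext <| funext fun j => by
    change ((1 : Matrix.unitaryGroup (Fin n) ℂ) : Matrix (Fin n) (Fin n) ℂ) * A.1 j *
      star ((1 : Matrix.unitaryGroup (Fin n) ℂ) : Matrix (Fin n) (Fin n) ℂ) = A.1 j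
    simp
  mul_smul U V A := Subtype.ext <| funext fun j => by
    change ((U * V : Matrix.unitaryGroup (Fin n) ℂ) : Matrix (Fin n) (Fin n) ℂ) * A.1 j *
      star ((U * V : Matrix.unitaryGroup (Fin n) ℂ) : Matrix (Fin n) (Fin n) ℂ) =
      (U : Matrix (Fin n) (Fin n) ℂ) * ((V : Matrix (Fin n) (Fin n) ℂ) * A.1 j *
        star (V : Matrix (Fin n) (Fin n) ℂ)) * star (U : Matrix (Fin n) (Fin n) ℂ)
    simp [mul_assoc]

/-- `σ_n(T)` carries its Borel `σ`-algebra. -/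
noncomputable instance nSpectrum.instMeasurableSpace (n : ℕ) {k : ℕ} (T : Fin k → H →L[ℂ] H) :
    MeasurableSpace (nSpectrum n T) := borel _

instance nSpectrum.instBorelSpace (n : ℕ) {k : ℕ} (T : Fin k → H →L[ℂ] H) :
    BorelSpace (nSpectrum n T) := ⟨rfl⟩

end System

/-! ### Bounded equivariant Borel functions -/

/-- The `C*`-norm on `M_n`: the operator norm on the Euclidean space `ℂⁿ`. -/
noncomputable def matNorm {n : ℕ} (A : Matrix (Fin n) (Fin n) ℂ) : ℝ :=
  ‖Matrix.toEuclideanCLM (n := Fin n) (𝕜 := ℂ) A‖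

/-- `𝔅C*(X,.)`: the bounded Borel functions `f : X → M_n` with `f(U.x) = U f(x) U⁻¹` for every
unitary `U`. -/
def BorelCStar (n : ℕ) (X : Type*) [MeasurableSpace X]
    [MulAction (Matrix.unitaryGroup (Fin n) ℂ) X] : Set (X → Matrix (Fin n) (Fin n) ℂ) :=
  {f | Measurable[_, borel (Matrix (Fin n) (Fin n) ℂ)] f ∧
    (∃ C : ℝ, ∀ x, matNorm (f x) ≤ C) ∧
    ∀ (U : Matrix.unitaryGroup (Fin n) ℂ) (x : X),
      f (U • x) = (U : Matrix (Fin n) (Fin n) ℂ) * f x * star (U : Matrix (Fin n) (Fin n) ℂ)}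

/-! ### Operator-valued measures and their integrals -/

/-- An operator-valued measure on `X`: a function `μ` from the Borel sets to `B(H)` such that each
`A ↦ ⟨μ(A) h, w⟩` is a complex measure. As usual in Mathlib, `μ` is extended by zero to the
nonmeasurable sets. -/
structure OperatorMeasure (X : Type*) [MeasurableSpace X]
    (H : Type*) [NormedAddCommGroup H] [InnerProductSpace ℂ H] where
  toFun : Set X → H →L[ℂ] H
  not_measurable' : ∀ A : Set X, ¬ MeasurableSet A → toFun A = 0
  empty' : toFun ∅ = 0
  hasSum_iUnion' : ∀ A : ℕ → Set X, (∀ i, MeasurableSet (A i)) →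
    Pairwise (Function.onFun Disjoint A) → ∀ h w : H,
      HasSum (fun i => ⟪w, toFun (A i) h⟫_ℂ) ⟪w, toFun (⋃ i, A i) h⟫_ℂ

namespace OperatorMeasure

variable {X : Type*} [MeasurableSpace X]
  {H : Type*} [NormedAddCommGroup H] [InnerProductSpace ℂ H]

/-- The complex measure `μ^{(h,w)}(A) = ⟨μ(A) h, w⟩`, the inner product being linear in the first
place (Mathlib's is linear in the second one). -/
noncomputable def scalar (μ : OperatorMeasure X H) (h w : H) : ComplexMeasure X where
  measureOf' A := ⟪w, μ.toFun A h⟫_ℂ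
  empty' := by simp [μ.empty']
  not_measurable' A hA := by simp [μ.not_measurable' A hA]
  m_iUnion' A hA hd := μ.hasSum_iUnion' A hA hd h w

end OperatorMeasure

/-- The integral of a complex function against a complex measure. -/
noncomputable def cintegral {X : Type*} [MeasurableSpace X] (f : X → ℂ) (ν : ComplexMeasure X) : ℂ :=
  ν.integral f (ContinuousLinearMap.mul ℝ ℂ)

namespace OperatorMeasure

variable {X : Type*} [MeasurableSpace X]
  {H : Type*} [NormedAddCommGroup H] [InnerProductSpace ℂ H]

theorem isFiniteMeasure_variation (ν : ComplexMeasure X) : IsFiniteMeasure ν.variation := by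
  have key : ν.variation ≤ (ComplexMeasure.re ν).variation + (ComplexMeasure.im ν).variation := by
    refine VectorMeasure.variation_le_of_forall_enorm_le fun E _ => ?_
    have h1 := VectorMeasure.enorm_measure_le_variation (ComplexMeasure.re ν) E
    have h2 := VectorMeasure.enorm_measure_le_variation (ComplexMeasure.im ν) E
    refine le_trans ?_ (add_le_add h1 h2)
    simp only [ComplexMeasure.re_apply, ComplexMeasure.im_apply]
    have h3 : ‖ν E‖ ≤ ‖(ν E).re‖ + ‖(ν E).im‖ := Complex.norm_le_abs_re_add_abs_im _
    rw [← ofReal_norm, ← ofReal_norm, ← ofReal_norm, ← ENNReal.ofReal_add (norm_nonneg _)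
      (norm_nonneg _)]
    exact ENNReal.ofReal_le_ofReal h3
  rw [← SignedMeasure.totalVariation_eq_variation, ← SignedMeasure.totalVariation_eq_variation]
    at key
  exact isFiniteMeasure_of_le _ key

theorem exists_integral_simpleFunc (μ : OperatorMeasure X H) (F : SimpleFunc X ℂ) :
    ∃ S : H →L[ℂ] H, ∀ h w : H, ⟪w, S h⟫_ℂ = cintegral F (μ.scalar h w) := by
  classical
  induction F using SimpleFunc.induction with
  | const c hs =>
    rename_i s
    refine ⟨c • μ.toFun s, fun h w => ?_⟩
    have := isFiniteMeasure_variation (μ.scalar h w)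
    rw [cintegral, SimpleFunc.coe_piecewise, SimpleFunc.coe_const, SimpleFunc.coe_const,
      Function.const_zero, Set.piecewise_eq_indicator]
    refine Eq.trans ?_ (VectorMeasure.integral_indicator_const (μ := μ.scalar h w)
      (B := ContinuousLinearMap.mul ℝ ℂ) c hs).symm
    simp only [_root_.smul_apply, inner_smul_right, ContinuousLinearMap.mul_apply']
    rfl
  | add hd hf hg =>
    rename_i f g
    obtain ⟨S, hS⟩ := hf
    obtain ⟨R, hR⟩ := hg
    refine ⟨S + R, fun h w => ?_⟩
    have := isFiniteMeasure_variation (μ.scalar h w)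
    simp only [add_apply, inner_add_right, hS, hR, cintegral]
    rw [SimpleFunc.coe_add, VectorMeasure.integral_add (SimpleFunc.integrable_of_isFiniteMeasure _)
      (SimpleFunc.integrable_of_isFiniteMeasure _)]

/-- Existence of the integral of a bounded Borel function. -/
theorem exists_integral [CompleteSpace H] (μ : OperatorMeasure X H) {f : X → ℂ} (hf : Measurable f)
    {C : ℝ} (hC : ∀ x, ‖f x‖ ≤ C) :
    ∃ S : H →L[ℂ] H, ∀ h w : H, ⟪w, S h⟫_ℂ = cintegral f (μ.scalar h w) := by
  have hsm := hf.stronglyMeasurable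
  choose S hS using fun m => μ.exists_integral_simpleFunc (hsm.approxBounded (max C 0) m)
  have hlim : ∀ h w, Tendsto (fun m => ⟪w, S m h⟫_ℂ) atTop (𝓝 (cintegral f (μ.scalar h w))) := by
    intro h w
    have := isFiniteMeasure_variation (μ.scalar h w)
    simp only [hS]
    refine VectorMeasure.tendsto_integral_filter_of_norm_le_const
      (Eventually.of_forall fun m => (SimpleFunc.aestronglyMeasurable _))
      ⟨max C 0, Eventually.of_forall fun m => Eventually.of_forall fun x =>
        hsm.norm_approxBounded_le (le_max_right _ _) m x⟩
      (Eventually.of_forall fun x =>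
        hsm.tendsto_approxBounded_of_norm_le ((hC x).trans (le_max_left _ _)))
  have hbd : ∃ M, ∀ m, ‖S m‖ ≤ M := by
    refine banach_steinhaus fun h => ?_
    have : ∃ M, ∀ m, ‖innerSL ℂ (S m h)‖ ≤ M := by
      refine banach_steinhaus fun w => ?_
      obtain ⟨M, hM⟩ := (hlim h w).norm.bddAbove_range
      refine ⟨M, fun m => ?_⟩
      rw [innerSL_apply_apply, norm_inner_symm]
      exact hM ⟨m, rfl⟩
    simpa only [innerSL_apply_norm] using this
  obtain ⟨M, hM⟩ := hbd
  let B : H →L⋆[ℂ] H →L[ℂ] ℂ := LinearMap.mkContinuous₂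
    (LinearMap.mk₂'ₛₗ (starRingEnd ℂ) (RingHom.id ℂ) (fun w h => cintegral f (μ.scalar h w))
      (fun w₁ w₂ h => tendsto_nhds_unique (hlim h (w₁ + w₂))
        (by simpa only [inner_add_left] using (hlim h w₁).add (hlim h w₂)))
      (fun c w h => tendsto_nhds_unique (hlim h (c • w))
        (by simpa only [inner_smul_left, smul_eq_mul] using (hlim h w).const_mul _))
      (fun w h₁ h₂ => tendsto_nhds_unique (hlim (h₁ + h₂) w)
        (by simpa only [map_add, inner_add_right] using (hlim h₁ w).add (hlim h₂ w)))
      (fun c w h => tendsto_nhds_unique (hlim (c • h) w)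
        (by simpa only [map_smul, inner_smul_right, smul_eq_mul, RingHom.id_apply]
          using (hlim h w).const_mul _)))
    M (fun w h => by
      refine le_of_tendsto (hlim h w).norm (Eventually.of_forall fun m => ?_)
      calc ‖⟪w, S m h⟫_ℂ‖ ≤ ‖w‖ * ‖S m h‖ := norm_inner_le_norm _ _
        _ ≤ ‖w‖ * (M * ‖h‖) := by
          gcongr
          exact ((S m).le_opNorm h).trans (by gcongr; exact hM m)
        _ = M * ‖w‖ * ‖h‖ := by ring)
  refine ⟨(InnerProductSpace.continuousLinearMapOfBilin B).adjoint, fun h w => ?_⟩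
  rw [ContinuousLinearMap.adjoint_inner_right, InnerProductSpace.continuousLinearMapOfBilin_apply]
  rfl

open Classical in
/-- The integral `∫ f dμ ∈ B(H)` against an operator-valued measure: the bounded operator determined
by `⟨(∫ f dμ) h, w⟩ = ∫ f dμ^{(h,w)}` for all `h, w ∈ H`. It exists for every bounded Borel
function `f`, by `exists_integral`. -/
noncomputable def integral (f : X → ℂ) (μ : OperatorMeasure X H) : H →L[ℂ] H :=
  if h : ∃ S : H →L[ℂ] H, ∀ h w : H, ⟪w, S h⟫_ℂ = cintegral f (μ.scalar h w) then h.choose else 0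

theorem inner_integral [CompleteSpace H] (μ : OperatorMeasure X H) {f : X → ℂ} (hf : Measurable f)
    {C : ℝ} (hC : ∀ x, ‖f x‖ ≤ C) (h w : H) :
    ⟪w, integral f μ h⟫_ℂ = cintegral f (μ.scalar h w) := by
  have hex := μ.exists_integral hf hC
  rw [integral, dif_pos hex]
  exact hex.choose_spec h w

end OperatorMeasure

/-! ### Spectral `n`-measures -/

section NMeasure

variable {n : ℕ} {X : Type*} [MeasurableSpace X]
  {H : Type*} [NormedAddCommGroup H] [InnerProductSpace ℂ H]

/-- An operator-valued `n`-measure: an `n × n` matrix `E` of operator-valued measures with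
`E(U.A) = U E(A) U⁻¹` for every unitary `U` and every Borel set `A`. -/
def IsNMeasure [MulAction (Matrix.unitaryGroup (Fin n) ℂ) X]
    (E : Matrix (Fin n) (Fin n) (OperatorMeasure X H)) : Prop :=
  ∀ (U : Matrix.unitaryGroup (Fin n) ℂ) (A : Set X), MeasurableSet A → ∀ p q : Fin n,
    (E p q).toFun ((fun x => U • x) '' A) =
      ∑ j, ∑ k, ((U : Matrix (Fin n) (Fin n) ℂ) p j *
        star ((U : Matrix (Fin n) (Fin n) ℂ) q k)) • (E j k).toFun A

/-- `E` is regular if all the complex measures `E_{jk}^{(h,w)}` are, that is, if their total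
variations are regular. -/
def IsRegularNMeasure [TopologicalSpace X]
    (E : Matrix (Fin n) (Fin n) (OperatorMeasure X H)) : Prop :=
  ∀ (j k : Fin n) (h w : H), ((E j k).scalar h w).variation.Regular

/-- `∫ f dE = ∑_{j,k} ∫ f_{jk} dE_{kj}`. -/
noncomputable def nIntegral (f : X → Matrix (Fin n) (Fin n) ℂ)
    (E : Matrix (Fin n) (Fin n) (OperatorMeasure X H)) : H →L[ℂ] H :=
  ∑ j, ∑ k, (E k j).integral (fun x => f x j k)

/-- A spectral `n`-measure: a regular operator-valued `n`-measure for which `f ↦ ∫ f dE` is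
a representation of `𝔅C*(X,.)`. -/
structure IsSpectralNMeasure [TopologicalSpace X] [MulAction (Matrix.unitaryGroup (Fin n) ℂ) X]
    [CompleteSpace H] (E : Matrix (Fin n) (Fin n) (OperatorMeasure X H)) : Prop where
  isNMeasure : IsNMeasure E
  isRegular : IsRegularNMeasure E
  integral_adjoint : ∀ f ∈ BorelCStar n X,
    (nIntegral f E).adjoint = nIntegral (fun x => (f x).conjTranspose) E
  integral_mul : ∀ f ∈ BorelCStar n X, ∀ g ∈ BorelCStar n X,
    nIntegral (fun x => f x * g x) E = nIntegral f E * nIntegral g E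

end NMeasure

/-- `E` is a spectral `n`-measure of the system `T`: a spectral `n`-measure on `σ_n(T)` with
`∫ p_j dE = T_j` for the coordinate functions `p_j(A₁, …, A_k) = A_j`. -/
def IsSpectralNMeasureOf {H : Type u} [NormedAddCommGroup H] [InnerProductSpace ℂ H]
    [CompleteSpace H] {n k : ℕ} (T : Fin k → H →L[ℂ] H)
    (E : Matrix (Fin n) (Fin n) (OperatorMeasure (nSpectrum n T) H)) : Prop :=
  IsSpectralNMeasure E ∧ ∀ j, nIntegral (fun A => A.1 j) E = T j

/-! Write A = C*(T) and X = σ_n(T). The points of X are the nonzero representations of A on ℂⁿ. The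
core of the proof is that a ↦ (x ↦ `rep x a`) identifies A isometrically with the continuous
equivariant functions X → M_n vanishing at infinity; the spectral n-measure comes from the inverse
of this identification by Riesz representation.

Isometry: a state minimizing Re φ(a) can be chosen pure, so irreducible representations detect
positivity (`re_inner_nonneg_of_irreducible`). By homogeneity the nonzero ones are n-dimensional, so
the points of X detect the norm (`IsNHomogeneousSystem.norm_le`). Surjectivity: by Burnside's
theorem every point of X maps A onto M_n, and inequivalent points are separated by an element of A.
Averaging over finitely many unitaries puts the normalized trace of each element back into A
(`exists_scalarTrace`). The resulting central elements serve as bump functions in a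
Stone–Weierstrass argument (`exists_rep_eq`).

A compactly supported continuous F : X → M_n, equivariant or not, has a Haar average over the
unitary group that is equivariant, hence comes from an element `averageLift F` of A. The map φ ↦
`averageLift (φ • B*B)` is positive; Riesz representation and polarization give E with ∫ F dE =
`averageLift F` (`exists_matrixMeasure`).

Identities are then extended from C_c to bounded Borel functions: F ↦ ⟨(∫ F dE) h, w⟩ is continuous
along bounded pointwise convergent sequences, and such functionals are determined on C_c
(`IsNormalMatFunctional.ext_compactSupport`). This gives the adjoint and product rules and
commutation with M', so (a) follows from the double commutant theorem. For uniqueness, any spectral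
n-measure of T integrates `rep · a` to a, and equivariance makes it integrate F and its average
alike. For (b), the square of ‖(∫ g dE) h‖ equals ⟨(∫ g*g dE) h, h⟩, which turns weak convergence
into strong convergence. -/

set_option linter.unusedSectionVars false

/-! ### Irreducible representations detect positivity -/

section IrreducibleReps

open scoped ComplexOrder

/-- The states of a unital `C*`-algebra, as a set of functions. -/
def stateSet (B : Type*) [CStarAlgebra B] : Set (B → ℂ) :=
  {φ | (∀ a b, φ (a + b) = φ a + φ b) ∧ (∀ (c : ℂ) a, φ (c • a) = c * φ a) ∧ φ 1 = 1 ∧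
    (∀ b, 0 ≤ φ (star b * b)) ∧ ∀ b, ‖φ b‖ ≤ ‖b‖}

/-- Banach–Alaoglu by hand: the bound ‖φ b‖ ≤ ‖b‖ built into `stateSet` places the states in a
product of discs, and the remaining conditions are closed pointwise. -/
theorem isCompact_stateSet (B : Type*) [CStarAlgebra B] : IsCompact (stateSet B) := by
  have h1 : IsCompact (Set.pi Set.univ fun b : B => Metric.closedBall (0 : ℂ) ‖b‖) :=
    isCompact_univ_pi fun b => isCompact_closedBall _ _
  refine h1.of_isClosed_subset ?_ fun φ hφ b _ => by simpa using hφ.2.2.2.2 b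
  simp only [stateSet, Set.ofPred_and, Set.ofPred_forall]
  refine IsClosed.inter ?_ (IsClosed.inter ?_ (IsClosed.inter ?_ (IsClosed.inter ?_ ?_)))
  · exact isClosed_iInter fun a => isClosed_iInter fun b => isClosed_eq (by fun_prop) (by fun_prop)
  · exact isClosed_iInter fun a => isClosed_iInter fun b => isClosed_eq (by fun_prop) (by fun_prop)
  · exact isClosed_eq (by fun_prop) (by fun_prop)
  · exact isClosed_iInter fun a => isClosed_le (by fun_prop) (by fun_prop)
  · exact isClosed_iInter fun a => isClosed_le (by fun_prop) (by fun_prop)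

variable {B : Type*} [CStarAlgebra B]

section Vector

variable {K : Type*} [NormedAddCommGroup K] [InnerProductSpace ℂ K] [CompleteSpace K]

theorem inner_map_star_left (π : B →⋆ₐ[ℂ] (K →L[ℂ] K)) (b : B) (v w : K) :
    ⟪π (star b) v, w⟫_ℂ = ⟪v, π b w⟫_ℂ := by
  rw [map_star, ContinuousLinearMap.star_eq_adjoint, ContinuousLinearMap.adjoint_inner_left]

theorem vectorState_mem_stateSet (π : B →⋆ₐ[ℂ] (K →L[ℂ] K)) {ξ : K} (hξ : ‖ξ‖ = 1) :
    (fun b => ⟪ξ, π b ξ⟫_ℂ) ∈ stateSet B := by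
  refine ⟨fun a b => ?_, fun c a => ?_, ?_, fun b => ?_, fun b => ?_⟩
  · simp
  · simp
  · simp [hξ]
  · simp only [map_mul, mul_apply_eq_comp]
    rw [← inner_map_star_left, star_star, inner_self_eq_norm_sq_to_K]
    exact (Complex.zero_le_real.2 (sq_nonneg ‖π b ξ‖)).trans_eq (by simp)
  · calc ‖⟪ξ, π b ξ⟫_ℂ‖ ≤ ‖ξ‖ * ‖π b ξ‖ := norm_inner_le_norm _ _
      _ ≤ ‖ξ‖ * (‖π b‖ * ‖ξ‖) := by gcongr; exact (π b).le_opNorm ξ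
      _ ≤ ‖b‖ := by simpa [hξ] using NonUnitalStarAlgHom.norm_apply_le π b

/-- An invariant W splits ξ as p + (ξ - p) with p ∈ W, and the vector state of ξ becomes the convex
combination, with weights ‖p‖² and ‖ξ - p‖², of the states of the normalized pieces. Extremality is
incompatible with both pieces being nonzero, and cyclicity then makes W trivial. -/
theorem isIrreducibleRep_of_extreme (π : B →⋆ₐ[ℂ] (K →L[ℂ] K)) {ξ : K} (hξ : ‖ξ‖ = 1)
    (hcyc : DenseRange fun b => π b ξ)
    (hext : (fun b => ⟪ξ, π b ξ⟫_ℂ) ∈ Set.extremePoints ℝ (stateSet B)) :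
    IsIrreducibleRep (π : B →⋆ₙₐ[ℂ] (K →L[ℂ] K)) := by
  intro W hW hinv
  have hinv' : ∀ b, ∀ v ∈ W, π b v ∈ W := hinv
  have : CompleteSpace W := hW.completeSpace_coe
  set p := W.starProjection ξ with hp
  have hpW : p ∈ W := W.starProjection_apply_mem ξ
  have hq : ∀ w ∈ W, ⟪w, ξ - p⟫_ℂ = 0 := fun w hw =>
    (W.mem_orthogonal _).1 (W.sub_starProjection_mem_orthogonal ξ) w hw
  have hq' : ∀ w ∈ W, ⟪ξ - p, w⟫_ℂ = 0 := fun w hw => inner_eq_zero_symm.1 (hq w hw)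
  have hzero : ∀ v : K, (∀ b, ⟪v, π b ξ⟫_ℂ = 0) → v = 0 := fun v hv => by
    refine hcyc.induction_on (p := fun w => ⟪v, w⟫_ℂ = 0) v
      (isClosed_eq (by fun_prop) (by fun_prop)) hv |> inner_self_eq_zero.1
  by_cases hp0 : p = 0
  · left
    rw [Submodule.eq_bot_iff]
    intro w hw
    refine hzero w fun b => ?_
    have h2 := hq (π (star b) w) (hinv' _ _ hw)
    rwa [hp0, sub_zero, inner_map_star_left] at h2
  by_cases hpξ : ξ - p = 0
  · right
    rw [Submodule.eq_top_iff']
    refine fun v => hcyc.induction_on (p := fun w => w ∈ W) v hW fun b => hinv' b ξ ?_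
    rwa [sub_eq_zero.1 hpξ]
  exfalso
  have hpyth : ‖p‖ ^ 2 + ‖ξ - p‖ ^ 2 = 1 := by
    have := norm_add_sq_eq_norm_sq_add_norm_sq_of_inner_eq_zero p (ξ - p) (hq p hpW)
    rw [add_sub_cancel, hξ] at this
    nlinarith
  have hpn : 0 < ‖p‖ := norm_pos_iff.2 hp0
  have hqn : 0 < ‖ξ - p‖ := norm_pos_iff.2 hpξ
  have hscal : ∀ v : K, 0 < ‖v‖ → ‖((‖v‖⁻¹ : ℝ) : ℂ) • v‖ = 1 := fun v hv => by
    rw [norm_smul, Complex.norm_real, norm_inv, norm_norm, inv_mul_cancel₀ hv.ne']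
  have hform : ∀ v : K, 0 < ‖v‖ → ∀ b, ‖v‖ ^ 2 * ⟪((‖v‖⁻¹ : ℝ) : ℂ) • v,
      π b (((‖v‖⁻¹ : ℝ) : ℂ) • v)⟫_ℂ = ⟪v, π b v⟫_ℂ := fun v hv b => by
    have : (‖v‖ : ℂ) ≠ 0 := by exact_mod_cast hv.ne'
    simp only [map_smul, inner_smul_left, inner_smul_right, Complex.conj_ofReal]
    push_cast
    field_simp
  have hcross : ∀ b, ⟪p, π b (ξ - p)⟫_ℂ = 0 := fun b => by
    rw [← inner_map_star_left]
    exact hq _ (hinv' _ _ hpW)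
  have hsum : ∀ b, ⟪p, π b p⟫_ℂ + ⟪ξ - p, π b (ξ - p)⟫_ℂ = ⟪ξ, π b ξ⟫_ℂ := fun b => by
    have h3 : ⟪ξ - p, π b p⟫_ℂ = 0 := hq' _ (hinv' _ _ hpW)
    have h4 := hcross b
    conv_rhs => rw [← add_sub_cancel p ξ]
    simp only [map_add, inner_add_left, inner_add_right, h3, h4]
    ring
  obtain ⟨-, h5⟩ := mem_extremePoints.1 hext
  have h6 := (h5 _ (vectorState_mem_stateSet π (hscal p hpn)) _
    (vectorState_mem_stateSet π (hscal _ hqn))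
    ⟨‖p‖ ^ 2, ‖ξ - p‖ ^ 2, by positivity, by positivity, hpyth, by
      funext b
      simp only [Pi.add_apply, Pi.smul_apply, Complex.real_smul]
      rw [Complex.ofReal_pow, Complex.ofReal_pow, hform p hpn b, hform _ hqn b, hsum]⟩).1
  -- By extremality the normalized p gives the same state as ξ, so this vector is orthogonal to the
  -- cyclic orbit. It forces ξ ∈ W, contradicting ξ ≠ p.
  have h7 : p - ((‖p‖ ^ 2 : ℝ) : ℂ) • ξ = 0 := by
    refine hzero _ fun b => ?_
    have h8 := hform p hpn b
    rw [congrFun h6 b] at h8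
    have h9 := hcross b
    rw [map_sub, inner_sub_right, sub_eq_zero] at h9
    rw [inner_sub_left, inner_smul_left, Complex.conj_ofReal, h9, ← h8]
    push_cast
    ring
  have h8 : ξ ∈ W := by
    have h9 : ((‖p‖ ^ 2 : ℝ) : ℂ) ≠ 0 := by exact_mod_cast (by positivity : ‖p‖ ^ 2 ≠ 0)
    rw [← inv_smul_smul₀ h9 ξ, ← sub_eq_zero.1 h7]
    exact W.smul_mem _ hpW
  refine hpξ ((inner_self_eq_zero (𝕜 := ℂ)).1 ?_)
  rw [inner_sub_right, hq' ξ h8, hq' p hpW, sub_zero]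

end Vector

/-- If `⟨π(a) ξ, ξ⟩ ≥ 0` for all irreducible representations `π`, the same is true of all
representations. -/
theorem re_inner_nonneg_of_irreducible {B : Type u} [CStarAlgebra B] (a : B)
    (ha : ∀ (K : Type u) [NormedAddCommGroup K] [InnerProductSpace ℂ K] [CompleteSpace K]
      (π : B →⋆ₐ[ℂ] (K →L[ℂ] K)), IsIrreducibleRep (π : B →⋆ₙₐ[ℂ] (K →L[ℂ] K)) →
      ∀ ξ : K, 0 ≤ (⟪ξ, π a ξ⟫_ℂ).re)
    {H : Type*} [NormedAddCommGroup H] [InnerProductSpace ℂ H] [CompleteSpace H]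
    (ρ : B →⋆ₐ[ℂ] (H →L[ℂ] H)) (h : H) : 0 ≤ (⟪h, ρ a h⟫_ℂ).re := by
  -- Normalizing h turns the claim into one about a vector state of ρ.
  suffices hS : ∀ φ ∈ stateSet B, 0 ≤ (φ a).re by
    by_cases hh : h = 0
    · simp [hh]
    have hn : 0 < ‖h‖ := norm_pos_iff.2 hh
    have h1 := hS _ (vectorState_mem_stateSet ρ (ξ := ((‖h‖⁻¹ : ℝ) : ℂ) • h) (by
      rw [norm_smul, Complex.norm_real, norm_inv, norm_norm, inv_mul_cancel₀ hn.ne']))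
    simp only [map_smul, inner_smul_left, inner_smul_right, Complex.conj_ofReal,
      Complex.re_ofReal_mul] at h1
    have h2 : 0 < ‖h‖⁻¹ := by positivity
    exact (mul_nonneg_iff_of_pos_left h2).1 ((mul_nonneg_iff_of_pos_left h2).1 h1)
  by_contra! hneg
  obtain ⟨φ₀, hφ₀, hφ₀a⟩ := hneg
  have hcont : Continuous fun φ : B → ℂ => (φ a).re := by fun_prop
  -- The minimizers of Re φ(a) form a nonempty compact face. Krein–Milman gives an extreme point of
  -- this face, which is a pure state still attaining the negative minimum.
  let F : Set (B → ℂ) := {φ | φ ∈ stateSet B ∧ ∀ ψ ∈ stateSet B, (φ a).re ≤ (ψ a).re}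
  have hFne : F.Nonempty := by
    obtain ⟨φ, hφ, hmin⟩ := (isCompact_stateSet B).exists_isMinOn ⟨φ₀, hφ₀⟩ hcont.continuousOn
    exact ⟨φ, hφ, fun ψ hψ => hmin hψ⟩
  have hFc : IsCompact F := by
    refine (isCompact_stateSet B).of_isClosed_subset ?_ fun φ hφ => hφ.1
    have : F = stateSet B ∩ ⋂ ψ ∈ stateSet B, {φ | (φ a).re ≤ (ψ a).re} := by
      ext φ; simp [F]
    rw [this]
    exact (isCompact_stateSet B).isClosed.inter <| isClosed_biInter fun ψ _ =>
      isClosed_le hcont continuous_const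
  have hFext : IsExtreme ℝ (stateSet B) F := by
    refine ⟨fun φ hφ => hφ.1, ?_⟩
    rintro x hx y hy z hz ⟨s, t, hs, ht, hst, rfl⟩
    refine ⟨hx, fun ψ hψ => ?_⟩
    have h1 := hz.2 y hy
    have h2 := hz.2 ψ hψ
    simp only [Pi.add_apply, Pi.smul_apply, Complex.add_re, Complex.real_smul,
      Complex.re_ofReal_mul] at h1 h2
    obtain rfl : t = 1 - s := by linarith
    have h3 : (x a).re ≤ (y a).re := by
      by_contra! h4
      nlinarith
    have h5 : (1 - s) * (x a).re ≤ (1 - s) * (y a).re := by gcongr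
    linarith
  obtain ⟨φ, hφ⟩ := hFc.extremePoints_nonempty hFne
  have hφF : φ ∈ F := hφ.1
  have hφext := hFext.extremePoints_subset_extremePoints hφ
  let _ : PartialOrder B := CStarAlgebra.spectralOrder B
  have : StarOrderedRing B := CStarAlgebra.spectralOrderedRing B
  obtain ⟨hadd, hsmul, hone, hpos, -⟩ := hφF.1
  let f : B →ₚ[ℂ] ℂ := PositiveLinearMap.mk₀
    { toFun := φ, map_add' := hadd, map_smul' := hsmul } fun b hb => by
      obtain ⟨c, rfl⟩ := CStarAlgebra.nonneg_iff_eq_star_mul_self.1 hb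
      exact hpos c
  have hf : ∀ b, f b = φ b := fun _ => rfl
  -- The class of 1 is the cyclic unit vector of the GNS representation; its vector state is φ.
  let ξ : f.GNS := ((f.toPreGNS 1 : f.PreGNS) : f.GNS)
  have hπ : ∀ b, f.gnsStarAlgHom b ξ = ((f.toPreGNS b : f.PreGNS) : f.GNS) := fun b => by
    simp [ξ, PositiveLinearMap.gnsNonUnitalStarAlgHom_apply]
  have hin : (fun b => ⟪ξ, f.gnsStarAlgHom b ξ⟫_ℂ) = φ := by
    funext b
    rw [hπ, UniformSpace.Completion.inner_coe, PositiveLinearMap.preGNS_inner_def]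
    simp [hf]
  have hξ : ‖ξ‖ = 1 := by
    have h1 := congrFun hin 1
    simp only [map_one, one_apply_eq_self, hone, inner_self_eq_norm_sq_to_K,
      Complex.coe_algebraMap] at h1
    have h2 : ‖ξ‖ ^ 2 = 1 := by exact_mod_cast h1
    nlinarith [norm_nonneg ξ]
  have hcyc : DenseRange fun b => f.gnsStarAlgHom b ξ := by
    simp only [hπ]
    exact UniformSpace.Completion.denseRange_coe.comp f.toPreGNS.surjective.denseRange
      (UniformSpace.Completion.continuous_coe _)
  have h1 := ha f.GNS f.gnsStarAlgHom
    (isIrreducibleRep_of_extreme _ hξ hcyc (hin.symm ▸ hφext)) ξ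
  rw [congrFun hin a] at h1
  linarith [hφF.2 φ₀ hφ₀]

end IrreducibleReps

/-! ### Representations of `n`-homogeneous algebras -/

section Burnside

/-- **Burnside's theorem**: an irreducible algebra of operators on a nonzero finite-dimensional
complex vector space consists of all operators. -/
theorem Subalgebra.eq_top_of_irreducible {K : Type*} [AddCommGroup K] [Module ℂ K]
    [FiniteDimensional ℂ K] [Nontrivial K] (D : Subalgebra ℂ (Module.End ℂ K))
    (hD : ∀ W : Submodule ℂ K, (∀ d ∈ D, ∀ v ∈ W, d v ∈ W) → W = ⊥ ∨ W = ⊤) : D = ⊤ := by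
  classical
  have hsub : ∀ W : Submodule D K, W = ⊥ ∨ W = ⊤ := fun W => by
    rcases hD (W.restrictScalars ℂ) fun d hd v hv => W.smul_mem ⟨d, hd⟩ hv with h | h
    · exact Or.inl ((Submodule.restrictScalars_eq_bot_iff ℂ D K).1 h)
    · exact Or.inr ((Submodule.restrictScalars_eq_top_iff ℂ D K).1 h)
  have : IsSimpleModule D K := { eq_bot_or_eq_top := hsub }
  -- Schur's lemma: an eigenspace of c is invariant under D and nonzero, hence everything.
  have schur : ∀ c : Module.End D K, ∃ μ : ℂ, ∀ v, c v = μ • v := fun c => by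
    let c' : Module.End ℂ K := c.restrictScalars ℂ
    obtain ⟨μ, hμ⟩ := Module.End.exists_eigenvalue c'
    refine ⟨μ, fun v => ?_⟩
    have h1 : Module.End.eigenspace c' μ = ⊤ := by
      refine (hD _ fun d hd v hv => ?_).resolve_left hμ
      rw [Module.End.mem_eigenspace_iff] at hv ⊢
      have h2 : c ((⟨d, hd⟩ : D) • v) = (⟨d, hd⟩ : D) • c v := c.map_smul _ _
      change c (d v) = _
      refine h2.trans ?_
      change d (c' v) = _
      rw [hv, map_smul]
    exact Module.End.mem_eigenspace_iff.1 (h1 ▸ Submodule.mem_top : v ∈ Module.End.eigenspace c' μ)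
  rw [eq_top_iff]
  intro g _
  -- As the commutant of D is scalar, every ℂ-linear g commutes with it. Jacobson density then makes
  -- g agree with an element of D on a basis.
  let f : Module.End (Module.End D K) K :=
    { toFun := g
      map_add' := map_add g
      map_smul' := fun c v => by
        obtain ⟨μ, hμ⟩ := schur c
        simp only [Module.End.smul_def, hμ, map_smul, RingHom.id_apply] }
  let b := Module.finBasis ℂ K
  obtain ⟨r, hr⟩ := jacobson_density (R := D) f (Finset.univ.image b)
  have : g = r.1 := b.ext fun i => hr (b i) (by simp)
  rw [this]
  exact r.2

end Burnside

section Homogeneous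

open scoped Matrix.Norms.L2Operator

variable {A : Type u} [NonUnitalCStarAlgebra A]

section Restrict

variable {K : Type*} [NormedAddCommGroup K] [InnerProductSpace ℂ K] [CompleteSpace K]

theorem inner_nonUnital_map_star_left (π : A →⋆ₙₐ[ℂ] (K →L[ℂ] K)) (b : A) (v w : K) :
    ⟪π (star b) v, w⟫_ℂ = ⟪v, π b w⟫_ℂ := by
  rw [map_star, ContinuousLinearMap.star_eq_adjoint, ContinuousLinearMap.adjoint_inner_left]

/-- The restriction of a representation to an invariant subspace. -/
noncomputable def restrictRep (σ : A →⋆ₙₐ[ℂ] (K →L[ℂ] K)) (W : Submodule ℂ K) [CompleteSpace W]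
    (hW : ∀ a, ∀ v ∈ W, σ a v ∈ W) : A →⋆ₙₐ[ℂ] (W →L[ℂ] W) where
  toFun a := ((σ a).comp W.subtypeL).codRestrict W fun v => hW a v v.2
  map_smul' c a := by
    ext v
    change σ (c • a) v = c • σ a v
    rw [map_smul, smul_apply]
  map_zero' := by ext; simp
  map_add' a b := by
    ext v
    change σ (a + b) v = σ a v + σ b v
    rw [map_add, add_apply]
  map_mul' a b := by
    ext v
    change σ (a * b) v = σ a (σ b v)
    rw [map_mul, mul_apply_eq_comp]
  map_star' a := by
    refine (ContinuousLinearMap.eq_adjoint_iff _ _).2 fun v w => ?_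
    exact inner_nonUnital_map_star_left σ a v w

theorem coe_restrictRep (σ : A →⋆ₙₐ[ℂ] (K →L[ℂ] K)) (W : Submodule ℂ K) [CompleteSpace W]
    (hW : ∀ a, ∀ v ∈ W, σ a v ∈ W) (a : A) (v : W) : (restrictRep σ W hW a v : K) = σ a v := rfl

end Restrict

variable {n : ℕ}

/-- Converse to the definition of homogeneity. A minimal invariant subspace on which σ is nonzero
carries an irreducible representation, so it already has dimension n and fills K. -/
theorem IsNHomogeneous.isIrreducibleRep (hA : IsNHomogeneous n A) {K : Type u}
    [NormedAddCommGroup K] [InnerProductSpace ℂ K] [CompleteSpace K] [FiniteDimensional ℂ K]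
    (hK : Module.finrank ℂ K = n) (σ : A →⋆ₙₐ[ℂ] (K →L[ℂ] K)) (hσ : ∃ a, σ a ≠ 0) :
    IsIrreducibleRep σ := by
  let S : Set (Submodule ℂ K) := {W | (∀ a, ∀ v ∈ W, σ a v ∈ W) ∧ ∃ a, ∃ v ∈ W, σ a v ≠ 0}
  have hS : S.Nonempty := by
    obtain ⟨a, ha⟩ := hσ
    obtain ⟨v, hv⟩ : ∃ v, σ a v ≠ 0 := by
      by_contra! h
      exact ha (ContinuousLinearMap.ext h)
    exact ⟨⊤, fun _ _ _ => Submodule.mem_top, a, v, Submodule.mem_top, hv⟩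
  obtain ⟨W, ⟨hW, a, v, hvW, hav⟩, hmin⟩ := wellFounded_lt.has_min S hS
  have hsub : ∀ V ≤ W, (∀ a, ∀ v ∈ V, σ a v ∈ V) → V = ⊥ ∨ V = W := fun V hV hinv => by
    by_cases hz : ∃ a, ∃ v ∈ V, σ a v ≠ 0
    · exact Or.inr (hV.lt_or_eq.resolve_left (hmin V ⟨hinv, hz⟩))
    · push Not at hz
      left
      -- If σ vanishes on V, it is still nonzero on the complement of V in W. Minimality gives W ≤
      -- Vᗮ, so V is orthogonal to itself.
      have h1 : W ⊓ Vᗮ ∈ S := by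
        refine ⟨fun b w hw => ⟨hW b w hw.1, ?_⟩, a, v - V.starProjection v,
          ⟨W.sub_mem hvW (hV (V.starProjection_apply_mem v)),
            V.sub_starProjection_mem_orthogonal v⟩, ?_⟩
        · refine (V.mem_orthogonal _).2 fun x hx => ?_
          rw [← inner_nonUnital_map_star_left, hz _ _ hx, inner_zero_left]
        · rwa [map_sub, hz a _ (V.starProjection_apply_mem v), sub_zero]
      have h2 : W ⊓ Vᗮ = W := inf_le_left.lt_or_eq.resolve_left (hmin _ h1)
      have h3 : V ≤ Vᗮ := hV.trans (inf_eq_left.1 h2)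
      rw [Submodule.eq_bot_iff]
      intro x hx
      exact inner_self_eq_zero.1 ((V.mem_orthogonal x).1 (h3 hx) x hx)
  have hirr : IsIrreducibleRep (restrictRep σ W hW) := fun V _ hinv => by
    have h1 := hsub (V.map W.subtype) (Submodule.map_subtype_le _ _) fun b x hx => by
      obtain ⟨y, hy, rfl⟩ := hx
      exact ⟨restrictRep σ W hW b y, hinv b y hy, rfl⟩
    refine h1.imp (fun h => ?_) fun h => ?_
    · exact Submodule.map_injective_of_injective W.injective_subtype (h.trans (Submodule.map_bot _).symm)
    · refine Submodule.map_injective_of_injective W.injective_subtype ?_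
      rw [h, Submodule.map_subtype_top]
  have hfin := hA W (restrictRep σ W hW)
    ⟨a, fun h => hav (by rw [← coe_restrictRep σ W hW a ⟨v, hvW⟩, h]; rfl)⟩ hirr
  have hWtop : W = ⊤ := Submodule.eq_top_of_finrank_eq (hfin.trans hK.symm)
  intro V _ hinv
  exact hWtop ▸ hsub V (hWtop ▸ le_top) hinv

theorem IsNHomogeneous.mulVec_irreducible (hA : IsNHomogeneous n A)
    (π : A →⋆ₙₐ[ℂ] Matrix (Fin n) (Fin n) ℂ) (hπ : ∃ a, π a ≠ 0) (W : Submodule ℂ (Fin n → ℂ))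
    (hW : ∀ a, ∀ v ∈ W, (π a).mulVec v ∈ W) : W = ⊥ ∨ W = ⊤ := by
  -- `ULift` moves ℂⁿ to the universe over which `IsNHomogeneous` quantifies.
  let e : EuclideanSpace ℂ (Fin n) ≃ₗᵢ[ℂ] EuclideanSpace ℂ (ULift.{u} (Fin n)) :=
    LinearIsometryEquiv.piLpCongrLeft 2 ℂ ℂ Equiv.ulift.symm
  let Φ : Matrix (Fin n) (Fin n) ℂ ≃⋆ₐ[ℂ] (EuclideanSpace ℂ (ULift.{u} (Fin n)) →L[ℂ]
      EuclideanSpace ℂ (ULift.{u} (Fin n))) :=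
    (Matrix.toEuclideanCLM (n := Fin n) (𝕜 := ℂ)).trans e.conjStarAlgEquiv
  let σ := (Φ : Matrix (Fin n) (Fin n) ℂ →⋆ₙₐ[ℂ] (EuclideanSpace ℂ (ULift.{u} (Fin n)) →L[ℂ]
    EuclideanSpace ℂ (ULift.{u} (Fin n)))).comp π
  have hσ : ∃ a, σ a ≠ 0 := hπ.imp fun a ha h => ha ((map_eq_zero_iff Φ Φ.injective).1 h)
  let l : (Fin n → ℂ) ≃ₗ[ℂ] EuclideanSpace ℂ (ULift.{u} (Fin n)) :=
    (WithLp.linearEquiv 2 ℂ (Fin n → ℂ)).symm.trans e.toLinearEquiv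
  have hl : ∀ a v, σ a (l v) = l ((π a).mulVec v) := fun a v => by
    change e (Matrix.toEuclideanCLM (n := Fin n) (𝕜 := ℂ) (π a) (e.symm (e (WithLp.toLp 2 v)))) = _
    rw [LinearIsometryEquiv.symm_apply_apply, Matrix.toEuclideanCLM_toLp]
    rfl
  have h1 := hA.isIrreducibleRep (by simp) σ hσ (W.map l.toLinearMap)
    (Submodule.closed_of_finiteDimensional _) (by
      rintro a _ ⟨v, hv, rfl⟩
      exact ⟨_, hW a v hv, (hl a v).symm⟩)
  refine h1.imp (fun h => ?_) fun h => ?_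
  · exact Submodule.map_injective_of_injective (f := l.toLinearMap) l.injective
      (h.trans (Submodule.map_bot _).symm)
  · refine Submodule.map_injective_of_injective (f := l.toLinearMap) l.injective ?_
    rw [h, Submodule.map_top, LinearEquiv.range]

/-- The known form of *-automorphisms of B(ℂⁿ), as conjugations by unitary maps, carried over to
matrices. -/
theorem Matrix.exists_unitary_of_starAlgEquiv
    (ψ : Matrix (Fin n) (Fin n) ℂ ≃⋆ₐ[ℂ] Matrix (Fin n) (Fin n) ℂ) :
    ∃ U : Matrix.unitaryGroup (Fin n) ℂ, ∀ x, ψ x = U * x * star (U : Matrix (Fin n) (Fin n) ℂ) := by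
  let Φ := Matrix.toEuclideanCLM (n := Fin n) (𝕜 := ℂ)
  let f := (Φ.symm.trans ψ).trans Φ
  obtain ⟨V, hV⟩ := f.eq_linearIsometryEquivConjStarAlgEquiv
    (LinearMap.continuous_of_finiteDimensional f.toAlgEquiv.toLinearMap)
  let u := Unitary.linearIsometryEquiv.symm V
  have hu : ∀ x, f x = u * x * star (u : EuclideanSpace ℂ (Fin n) →L[ℂ] EuclideanSpace ℂ (Fin n)) :=
    fun x => by
      rw [hV, ← Unitary.conjStarAlgAut_symm_unitaryLinearIsometryEquiv]
      rfl
  refine ⟨⟨Φ.symm u, Unitary.map_mem Φ.symm u.2⟩, fun x => EquivLike.injective Φ ?_⟩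
  have h1 := hu (Φ x)
  simp only [f, StarAlgEquiv.trans_apply, StarAlgEquiv.symm_apply_apply] at h1
  rw [h1]
  simp only [map_mul, map_star, StarAlgEquiv.apply_symm_apply]

variable [NeZero n]

/-- Burnside applies to the unital algebra D generated by the range, giving D = M_n. The range is a
nonzero two-sided ideal of D, and M_n is simple. -/
theorem IsNHomogeneous.surjective (hA : IsNHomogeneous n A)
    (π : A →⋆ₙₐ[ℂ] Matrix (Fin n) (Fin n) ℂ) (hπ : ∃ a, π a ≠ 0) : Function.Surjective π := by
  let D : Subalgebra ℂ (Matrix (Fin n) (Fin n) ℂ) := Algebra.adjoin ℂ (Set.range π)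
  have hD : ∀ x, x ∈ D := by
    have h1 : D.map (Matrix.toLinAlgEquiv' (R := ℂ) (n := Fin n)).toAlgHom = ⊤ := by
      refine Subalgebra.eq_top_of_irreducible _ fun W hW => hA.mulVec_irreducible π hπ W fun a v hv =>
        hW _ ⟨π a, Algebra.subset_adjoin ⟨a, rfl⟩, rfl⟩ v hv
    intro x
    have h2 : Matrix.toLinAlgEquiv' x ∈ D.map (Matrix.toLinAlgEquiv' (R := ℂ) (n := Fin n)).toAlgHom :=
      h1 ▸ Algebra.mem_top
    obtain ⟨y, hy, hxy⟩ := h2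
    rwa [← (Matrix.toLinAlgEquiv' (R := ℂ) (n := Fin n)).injective hxy]
  have hleft : ∀ x y, y ∈ Set.range π → x * y ∈ Set.range π := fun x y hy => by
    induction hD x using Algebra.adjoin_induction generalizing y with
    | mem x hx =>
      obtain ⟨a, rfl⟩ := hx
      obtain ⟨b, rfl⟩ := hy
      exact ⟨a * b, map_mul π a b⟩
    | algebraMap c =>
      obtain ⟨b, rfl⟩ := hy
      exact ⟨c • b, by rw [map_smul, Algebra.smul_def]⟩
    | add x z _ _ hx hz =>
      obtain ⟨a, ha⟩ := hx y hy
      obtain ⟨b, hb⟩ := hz y hy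
      exact ⟨a + b, by rw [map_add, ha, hb, add_mul]⟩
    | mul x z _ _ hx hz =>
      rw [mul_assoc]
      exact hx _ (hz _ hy)
  have hstar : ∀ x ∈ Set.range π, star x ∈ Set.range π := by
    rintro _ ⟨a, rfl⟩
    exact ⟨star a, map_star π a⟩
  let I : TwoSidedIdeal (Matrix (Fin n) (Fin n) ℂ) := TwoSidedIdeal.mk' (Set.range π)
    ⟨0, map_zero π⟩
    (by rintro _ _ ⟨a, rfl⟩ ⟨b, rfl⟩; exact ⟨a + b, map_add π a b⟩)
    (by rintro _ ⟨a, rfl⟩; exact ⟨-a, map_neg π a⟩)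
    (fun {x y} hy => hleft x y hy)
    (fun {x y} hx => by
      have := hstar _ (hleft (star y) (star x) (hstar x hx))
      rwa [star_mul, star_star, star_star] at this)
  have hI : ∀ x, x ∈ I ↔ x ∈ Set.range π := TwoSidedIdeal.mem_mk' _ _ _ _ _ _
  rcases eq_bot_or_eq_top I with h | h
  · obtain ⟨a, ha⟩ := hπ
    have : π a ∈ I := (hI _).2 ⟨a, rfl⟩
    rw [h] at this
    exact absurd ((TwoSidedIdeal.mem_bot _).1 this) ha
  · intro x
    exact (hI x).1 (h ▸ TwoSidedIdeal.mem_top _)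

/-- Two representations on `ℂⁿ` that are not unitarily equivalent can be separated. -/
theorem IsNHomogeneous.exists_unitary_or_separating (hA : IsNHomogeneous n A)
    (π π' : A →⋆ₙₐ[ℂ] Matrix (Fin n) (Fin n) ℂ) (hπ : ∃ a, π a ≠ 0) (hπ' : ∃ a, π' a ≠ 0) :
    (∃ U : Matrix.unitaryGroup (Fin n) ℂ,
      ∀ a, π' a = U * π a * star (U : Matrix (Fin n) (Fin n) ℂ)) ∨
    ∃ a, π a = 0 ∧ π' a = 1 := by
  have hs := hA.surjective π hπ
  have hs' := hA.surjective π' hπ'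
  by_cases hker : ∀ a, π a = 0 → π' a = 0
  · left
    -- Here π' factors through π. The induced map of M_n is onto, hence bijective by dimension, and
    -- so an inner *-automorphism.
    have hker' : ∀ a b, π a = π b → π' a = π' b := fun a b h => by
      rw [← sub_eq_zero, ← map_sub]
      exact hker _ (by rw [map_sub, h, sub_self])
    choose s hsr using hs
    have hψ : ∀ a, π' (s (π a)) = π' a := fun a => hker' _ _ (hsr _)
    let ψ : Matrix (Fin n) (Fin n) ℂ →ₗ[ℂ] Matrix (Fin n) (Fin n) ℂ :=
      { toFun := fun x => π' (s x)
        map_add' := fun x y => by rw [← map_add]; exact hker' _ _ (by simp only [map_add, hsr])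
        map_smul' := fun c x => by
          rw [RingHom.id_apply, ← map_smul]; exact hker' _ _ (by simp only [map_smul, hsr]) }
    have hψs : Function.Surjective ψ := fun y => by
      obtain ⟨a, rfl⟩ := hs' y
      exact ⟨π a, hψ a⟩
    have hψi := LinearMap.injective_iff_surjective.2 hψs
    let e := LinearEquiv.ofBijective ψ ⟨hψi, hψs⟩
    have he : ∀ a, e (π a) = π' a := hψ
    let E : Matrix (Fin n) (Fin n) ℂ ≃⋆ₐ[ℂ] Matrix (Fin n) (Fin n) ℂ :=
      { e with
        map_mul' := fun x y => by
          change e (x * y) = e x * e y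
          rw [← hsr x, ← hsr y, ← map_mul, he, he, he, map_mul]
        map_star' := fun x => by
          change e (star x) = star (e x)
          rw [← hsr x, ← map_star, he, he, map_star] }
    obtain ⟨U, hU⟩ := Matrix.exists_unitary_of_starAlgEquiv E
    exact ⟨U, fun a => (he a).symm.trans (hU (π a))⟩
  · right
    push Not at hker
    obtain ⟨a, ha, ha'⟩ := hker
    -- The image under π' of the kernel of π is a nonzero ideal of the simple algebra M_n, so it
    -- contains 1.
    let I : TwoSidedIdeal (Matrix (Fin n) (Fin n) ℂ) := TwoSidedIdeal.mk' (π' '' {a | π a = 0})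
      ⟨0, by simp⟩
      (by
        rintro _ _ ⟨a, ha, rfl⟩ ⟨b, hb, rfl⟩
        exact ⟨a + b, by simp_all, map_add π' a b⟩)
      (by
        rintro _ ⟨a, ha, rfl⟩
        exact ⟨-a, by simp_all, map_neg π' a⟩)
      (by
        rintro x _ ⟨a, ha, rfl⟩
        obtain ⟨b, rfl⟩ := hs' x
        exact ⟨b * a, by simp_all, map_mul π' b a⟩)
      (by
        rintro _ y ⟨a, ha, rfl⟩
        obtain ⟨b, rfl⟩ := hs' y
        exact ⟨a * b, by simp_all, map_mul π' a b⟩)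
    have hI : ∀ x, x ∈ I ↔ x ∈ π' '' {a | π a = 0} := TwoSidedIdeal.mem_mk' _ _ _ _ _ _
    rcases eq_bot_or_eq_top I with h | h
    · have : π' a ∈ I := (hI _).2 ⟨a, ha, rfl⟩
      rw [h] at this
      exact absurd ((TwoSidedIdeal.mem_bot _).1 this) ha'
    · obtain ⟨b, hb, hb1⟩ := (hI 1).1 (h ▸ TwoSidedIdeal.mem_top _)
      exact ⟨b, hb, hb1⟩

/-- A representation on an `n`-dimensional Hilbert space is equivalent to one by matrices. -/
theorem exists_matrixRep {K : Type*} [NormedAddCommGroup K] [InnerProductSpace ℂ K]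
    [CompleteSpace K] (hK : Module.finrank ℂ K = n) (τ : A →⋆ₙₐ[ℂ] (K →L[ℂ] K)) :
    ∃ (π : A →⋆ₙₐ[ℂ] Matrix (Fin n) (Fin n) ℂ) (f : K ≃ₗᵢ[ℂ] EuclideanSpace ℂ (Fin n)),
      ∀ a, Matrix.toEuclideanCLM (n := Fin n) (𝕜 := ℂ) (π a) = f.conjStarAlgEquiv (τ a) := by
  have : FiniteDimensional ℂ K := Module.finite_of_finrank_pos (hK ▸ NeZero.pos n)
  let f := ((stdOrthonormalBasis ℂ K).reindex (finCongr hK)).repr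
  let Φ : (K →L[ℂ] K) →⋆ₙₐ[ℂ] (EuclideanSpace ℂ (Fin n) →L[ℂ] EuclideanSpace ℂ (Fin n)) :=
    f.conjStarAlgEquiv
  let Ψ : (EuclideanSpace ℂ (Fin n) →L[ℂ] EuclideanSpace ℂ (Fin n)) →⋆ₙₐ[ℂ]
    Matrix (Fin n) (Fin n) ℂ := (Matrix.toEuclideanCLM (n := Fin n) (𝕜 := ℂ)).symm
  exact ⟨(Ψ.comp Φ).comp τ, f, fun a => StarAlgEquiv.apply_symm_apply
    (Matrix.toEuclideanCLM (n := Fin n) (𝕜 := ℂ)) _⟩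

/-! ### Matrix representations detect positivity and norm. -/

theorem re_inner_neg_star_mul_self {K : Type*} [NormedAddCommGroup K] [InnerProductSpace ℂ K]
    [CompleteSpace K] (σ : A →⋆ₙₐ[ℂ] (K →L[ℂ] K)) (b : A) (v : K) :
    (⟪v, σ (-(star b * b)) v⟫_ℂ).re = -‖σ b v‖ ^ 2 := by
  rw [map_neg, map_mul, neg_apply, mul_apply_eq_comp, inner_neg_right,
    ← inner_nonUnital_map_star_left, star_star, inner_self_eq_norm_sq_to_K]
  norm_cast

theorem re_inner_ofReal_smul_add {K : Type*} [NormedAddCommGroup K] [InnerProductSpace ℂ K]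
    (c : ℝ) (v w : K) : (⟪v, (c : ℂ) • v + w⟫_ℂ).re = c * ‖v‖ ^ 2 + (⟪v, w⟫_ℂ).re := by
  rw [inner_add_right, inner_smul_right, inner_self_eq_norm_sq_to_K, Complex.add_re,
    Complex.re_ofReal_mul]
  norm_cast

/-- Positivity of `c + a` can be tested on the nonzero representations in `M_n`. -/
theorem IsNHomogeneous.re_nonneg (hA : IsNHomogeneous n A) {c : ℝ} (hc : 0 ≤ c) (a : A)
    (ha : ∀ π : A →⋆ₙₐ[ℂ] Matrix (Fin n) (Fin n) ℂ, (∃ a, π a ≠ 0) →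
      ∀ v : EuclideanSpace ℂ (Fin n),
        0 ≤ c * ‖v‖ ^ 2 + (⟪v, Matrix.toEuclideanCLM (n := Fin n) (𝕜 := ℂ) (π a) v⟫_ℂ).re)
    {H : Type*} [NormedAddCommGroup H] [InnerProductSpace ℂ H] [CompleteSpace H]
    (ρ : A →⋆ₙₐ[ℂ] (H →L[ℂ] H)) (h : H) : 0 ≤ c * ‖h‖ ^ 2 + (⟪h, ρ a h⟫_ℂ).re := by
  -- The detection of positivity needs a unit, so c + a is taken in the unitization.
  have key := re_inner_nonneg_of_irreducible
    (algebraMap ℂ (Unitization ℂ A) c + (a : Unitization ℂ A)) (fun K _ _ _ σ hσ ξ => ?_)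
    (Unitization.starLift ρ) h
  · rw [map_add, AlgHomClass.commutes, Algebra.algebraMap_eq_smul_one] at key
    change 0 ≤ (⟪h, ((c : ℂ) • (1 : H →L[ℂ] H) + Unitization.starLift ρ (a : Unitization ℂ A)) h⟫_ℂ).re at key
    have h1 : Unitization.starLift ρ (a : Unitization ℂ A) = ρ a :=
      congr($(Equiv.symm_apply_apply Unitization.starLift ρ) a)
    rw [h1, add_apply, smul_apply, one_apply_eq_self, re_inner_ofReal_smul_add] at key
    exact key
  · let τ : A →⋆ₙₐ[ℂ] (K →L[ℂ] K) := (σ : _ →⋆ₙₐ[ℂ] _).comp (Unitization.inrNonUnitalStarAlgHom ℂ A)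
    have hτ : ∀ a, τ a = σ (a : Unitization ℂ A) := fun _ => rfl
    rw [map_add, AlgHomClass.commutes, Algebra.algebraMap_eq_smul_one, ← hτ, add_apply,
      smul_apply, one_apply_eq_self, re_inner_ofReal_smul_add]
    -- An irreducible representation of the unitization either restricts to a nonzero, still
    -- irreducible representation of A, hence to an n-dimensional one, or kills A; in the latter
    -- case c ≥ 0 is enough.
    by_cases hz : ∃ b, τ b ≠ 0
    · have hirr : IsIrreducibleRep τ := fun W hW hinv => hσ W hW fun b v hv => by
        change σ b v ∈ W
        induction b with
        | inl_add_inr r b =>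
          rw [map_add, ← Unitization.algebraMap_eq_inl, AlgHomClass.commutes,
            Algebra.algebraMap_eq_smul_one]
          exact W.add_mem (W.smul_mem _ hv) (hinv b v hv)
      have hfin := hA K τ hz hirr
      have : FiniteDimensional ℂ K := Module.finite_of_finrank_pos (hfin ▸ NeZero.pos n)
      obtain ⟨π, f, hπ⟩ := exists_matrixRep hfin τ
      have h1 := ha π (hz.imp fun b hb h => hb ?_) (f ξ)
      swap
      · have h2 := hπ b
        rwa [h, map_zero, eq_comm, map_eq_zero_iff _ (EquivLike.injective _)] at h2
      rw [hπ, LinearIsometryEquiv.conjStarAlgEquiv_apply_apply,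
        LinearIsometryEquiv.symm_apply_apply, LinearIsometryEquiv.inner_map_map,
        LinearIsometryEquiv.norm_map] at h1
      exact h1
    · push Not at hz
      rw [hz]
      simp only [zero_apply, inner_zero_right, Complex.zero_re, add_zero]
      positivity

/-- Apply the positivity test to C² - a*a. -/
theorem IsNHomogeneous.norm_le (hA : IsNHomogeneous n A) {C : ℝ} (hC : 0 ≤ C) (a : A)
    (ha : ∀ π : A →⋆ₙₐ[ℂ] Matrix (Fin n) (Fin n) ℂ, (∃ a, π a ≠ 0) → ‖π a‖ ≤ C)
    {H : Type*} [NormedAddCommGroup H] [InnerProductSpace ℂ H] [CompleteSpace H]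
    (ρ : A →⋆ₙₐ[ℂ] (H →L[ℂ] H)) : ‖ρ a‖ ≤ C := by
  refine ContinuousLinearMap.opNorm_le_bound _ hC fun h => ?_
  have h1 := hA.re_nonneg (sq_nonneg C) (-(star a * a)) (fun π hπ v => ?_) ρ h
  · rw [re_inner_neg_star_mul_self] at h1
    exact le_of_sq_le_sq (by rw [mul_pow]; linarith) (by positivity)
  · let Φ : Matrix (Fin n) (Fin n) ℂ →⋆ₙₐ[ℂ] (EuclideanSpace ℂ (Fin n) →L[ℂ] EuclideanSpace ℂ (Fin n)) :=
      Matrix.toEuclideanCLM (n := Fin n) (𝕜 := ℂ)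
    let σ := Φ.comp π
    have h2 := re_inner_neg_star_mul_self σ a v
    have h3 : ‖σ a v‖ ≤ C * ‖v‖ :=
      ((σ a).le_opNorm v).trans (mul_le_mul_of_nonneg_right (ha π hπ) (norm_nonneg v))
    change 0 ≤ C ^ 2 * ‖v‖ ^ 2 + (⟪v, σ (-(star a * a)) v⟫_ℂ).re
    rw [h2, ← mul_pow]
    have := pow_le_pow_left₀ (norm_nonneg _) h3 2
    linarith

end Homogeneous

/-! ### The topology of the `n`-spectrum -/

section Spectrum

open scoped Matrix.Norms.L2Operator

variable {H : Type u} [NormedAddCommGroup H] [InnerProductSpace ℂ H] [CompleteSpace H]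
  {n k : ℕ} {T : Fin k → H →L[ℂ] H}

instance isClosed_generatedCStar : IsClosed (generatedCStar T : Set (H →L[ℂ] H)) :=
  NonUnitalStarSubalgebra.isClosed_topologicalClosure _

theorem generatedCStar_induction {p : generatedCStar T → Prop} (hp : IsClosed {a | p a})
    (gen : ∀ j, p ⟨T j, mem_generatedCStar T j⟩) (zero : p 0)
    (add : ∀ a b, p a → p b → p (a + b)) (mul : ∀ a b, p a → p b → p (a * b))
    (smul : ∀ (c : ℂ) a, p a → p (c • a)) (star' : ∀ a, p a → p (star a)) (a : generatedCStar T) :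
    p a := by
  let S : NonUnitalStarSubalgebra ℂ (H →L[ℂ] H) :=
    { carrier := Subtype.val '' {a : generatedCStar T | p a}
      zero_mem' := ⟨0, zero, rfl⟩
      add_mem' := by
        rintro _ _ ⟨a, ha, rfl⟩ ⟨b, hb, rfl⟩
        exact ⟨a + b, add a b ha hb, rfl⟩
      mul_mem' := by
        rintro _ _ ⟨a, ha, rfl⟩ ⟨b, hb, rfl⟩
        exact ⟨a * b, mul a b ha hb, rfl⟩
      smul_mem' := by
        rintro c _ ⟨a, ha, rfl⟩
        exact ⟨c • a, smul c a ha, rfl⟩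
      star_mem' := by
        rintro _ ⟨a, ha, rfl⟩
        exact ⟨star a, star' a ha, rfl⟩ }
  have hS : IsClosed (S : Set (H →L[ℂ] H)) :=
    isClosed_generatedCStar.isClosedEmbedding_subtypeVal.isClosedMap _ hp
  have h1 : generatedCStar T ≤ S := by
    refine NonUnitalStarSubalgebra.topologicalClosure_minimal _ (NonUnitalStarAlgebra.adjoin_le ?_) hS
    rintro _ ⟨j, rfl⟩
    exact ⟨_, gen j, rfl⟩
  obtain ⟨b, hb, hba⟩ := h1 a.2
  rwa [← Subtype.ext hba]

theorem continuous_rep (π : generatedCStar T →⋆ₙₐ[ℂ] Matrix (Fin n) (Fin n) ℂ) : Continuous π :=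
  AddMonoidHomClass.continuous_of_bound π 1 fun a => by
    simpa using NonUnitalStarAlgHom.norm_apply_le π a

theorem rep_ext {π π' : generatedCStar T →⋆ₙₐ[ℂ] Matrix (Fin n) (Fin n) ℂ}
    (h : ∀ j, π ⟨T j, mem_generatedCStar T j⟩ = π' ⟨T j, mem_generatedCStar T j⟩) : π = π' := by
  ext1 a
  refine generatedCStar_induction (p := fun a => π a = π' a)
    (isClosed_eq (continuous_rep π) (continuous_rep π')) h (by simp) (fun a b ha hb => ?_)
    (fun a b ha hb => ?_) (fun c a ha => ?_) (fun a ha => ?_) a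
  · rw [map_add, map_add, ha, hb]
  · rw [map_mul, map_mul, ha, hb]
  · rw [map_smul, map_smul, ha]
  · rw [map_star, map_star, ha]

namespace nSpectrum

/-- The representation of `C*(T)` that belongs to a point of the `n`-spectrum. -/
noncomputable def rep (x : nSpectrum n T) :
    generatedCStar T →⋆ₙₐ[ℂ] Matrix (Fin n) (Fin n) ℂ := x.2.choose

theorem rep_ne_zero (x : nSpectrum n T) : ∃ a, rep x a ≠ 0 := x.2.choose_spec.1

theorem coe_apply (x : nSpectrum n T) (j : Fin k) :
    x.1 j = rep x ⟨T j, mem_generatedCStar T j⟩ := x.2.choose_spec.2 j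

theorem norm_rep_le (x : nSpectrum n T) (a : generatedCStar T) : ‖rep x a‖ ≤ ‖a‖ :=
  NonUnitalStarAlgHom.norm_apply_le (rep x) a

/-- The point of the `n`-spectrum given by a representation. -/
noncomputable def ofRep (π : generatedCStar T →⋆ₙₐ[ℂ] Matrix (Fin n) (Fin n) ℂ) (hπ : ∃ a, π a ≠ 0) :
    nSpectrum n T := ⟨fun j => π ⟨T j, mem_generatedCStar T j⟩, π, hπ, fun _ => rfl⟩

theorem rep_ofRep (π : generatedCStar T →⋆ₙₐ[ℂ] Matrix (Fin n) (Fin n) ℂ) (hπ : ∃ a, π a ≠ 0) :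
    rep (ofRep π hπ) = π :=
  rep_ext fun j => (coe_apply (ofRep π hπ) j).symm

theorem ext_of_rep {x y : nSpectrum n T} (h : ∀ a, rep x a = rep y a) : x = y :=
  Subtype.ext (funext fun j => by rw [coe_apply, coe_apply, h])

theorem coe_smul_apply (U : Matrix.unitaryGroup (Fin n) ℂ) (x : nSpectrum n T) (j : Fin k) :
    (U • x).1 j = (U : Matrix (Fin n) (Fin n) ℂ) * x.1 j * star (U : Matrix (Fin n) (Fin n) ℂ) :=
  rfl

theorem rep_smul (U : Matrix.unitaryGroup (Fin n) ℂ) (x : nSpectrum n T) (a : generatedCStar T) :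
    rep (U • x) a =
      (U : Matrix (Fin n) (Fin n) ℂ) * rep x a * star (U : Matrix (Fin n) (Fin n) ℂ) := by
  let Φ : Matrix (Fin n) (Fin n) ℂ →⋆ₙₐ[ℂ] Matrix (Fin n) (Fin n) ℂ :=
    (Unitary.conjStarAlgAut ℂ (Matrix (Fin n) (Fin n) ℂ) U :
      Matrix (Fin n) (Fin n) ℂ ≃⋆ₐ[ℂ] Matrix (Fin n) (Fin n) ℂ)
  have h : rep (U • x) = Φ.comp (rep x) := rep_ext fun j => by
    rw [← coe_apply, coe_smul_apply, coe_apply]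
    rfl
  rw [h]
  rfl

/-- For a generator the function is a coordinate of the spectrum. Representations are contractive,
so norm limits in a become uniform limits in x. -/
theorem continuous_rep_apply (a : generatedCStar T) :
    Continuous fun x : nSpectrum n T => rep x a := by
  refine generatedCStar_induction (p := fun a => Continuous fun x : nSpectrum n T => rep x a)
    ?_ (fun j => ?_) ?_ (fun a b ha hb => ?_) (fun a b ha hb => ?_) (fun c a ha => ?_)
    (fun a ha => ?_) a
  · refine isClosed_of_closure_subset fun a ha => ?_
    refine continuous_of_uniform_approx_of_continuous fun u hu => ?_
    obtain ⟨ε, hε, hεu⟩ := Metric.mem_uniformity_dist.1 hu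
    obtain ⟨b, hb, hab⟩ := Metric.mem_closure_iff.1 ha ε hε
    refine ⟨_, hb, fun x => hεu ?_⟩
    rw [dist_eq_norm, ← map_sub]
    exact (norm_rep_le x _).trans_lt (by rwa [← dist_eq_norm])
  · simp only [← coe_apply]
    exact (continuous_apply j).comp continuous_subtype_val
  · simp only [map_zero]
    fun_prop
  · simp only [map_add]
    exact ha.add hb
  · simp only [map_mul]
    exact ha.mul hb
  · simp only [map_smul]
    exact ha.const_smul c
  · simp only [map_star]
    exact ha.star

/-- Along an ultrafilter every `rep x b` converges in a compact ball, and the limits form a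
representation. The lower bound at a keeps it nonzero, so it is a point of the spectrum. In
particular `rep · a` vanishes at infinity. -/
theorem isCompact_le_norm (a : generatedCStar T) {ε : ℝ} (hε : 0 < ε) :
    IsCompact {x : nSpectrum n T | ε ≤ ‖rep x a‖} := by
  refine isCompact_iff_ultrafilter_le_nhds.2 fun f hf => ?_
  have : ProperSpace (Matrix (Fin n) (Fin n) ℂ) := FiniteDimensional.proper ℂ _
  have hlim : ∀ b : generatedCStar T, ∃ L, Tendsto (fun x : nSpectrum n T => rep x b) f (𝓝 L) :=
    fun b => by
      have h1 : ∀ x : nSpectrum n T, rep x b ∈ Metric.closedBall 0 ‖b‖ := fun x =>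
        mem_closedBall_zero_iff.2 (norm_rep_le x b)
      have h2 : ((f.map fun x => rep x b : Ultrafilter (Matrix (Fin n) (Fin n) ℂ)) :
          Filter (Matrix (Fin n) (Fin n) ℂ)) ≤ 𝓟 (Metric.closedBall 0 ‖b‖) := by
        exact tendsto_principal.2 (Eventually.of_forall h1)
      obtain ⟨L, -, hL⟩ := (isCompact_closedBall _ _).ultrafilter_le_nhds _ h2
      exact ⟨L, hL⟩
  choose L hL using hlim
  have huniq : ∀ b M, Tendsto (fun x : nSpectrum n T => rep x b) f (𝓝 M) → L b = M :=
    fun b M h => tendsto_nhds_unique (hL b) h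
  let π : generatedCStar T →⋆ₙₐ[ℂ] Matrix (Fin n) (Fin n) ℂ :=
    { toFun := L
      map_smul' := fun c b => huniq _ _ (by
        simpa only [map_smul, MonoidHom.id_apply] using (hL b).const_smul c)
      map_zero' := huniq _ _ (by simpa only [map_zero] using tendsto_const_nhds)
      map_add' := fun b c => huniq _ _ (by simpa only [map_add] using (hL b).add (hL c))
      map_mul' := fun b c => huniq _ _ (by simpa only [map_mul] using (hL b).mul (hL c))
      map_star' := fun b => huniq _ _ (by simpa only [map_star] using (hL b).star) }
  have hπa : ε ≤ ‖π a‖ := ge_of_tendsto (hL a).norm (le_principal_iff.1 hf)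
  have hπ : ∃ a, π a ≠ 0 := ⟨a, fun h => by rw [h, norm_zero] at hπa; linarith⟩
  refine ⟨ofRep π hπ, ?_, ?_⟩
  · rwa [Set.mem_ofPred_eq, rep_ofRep]
  · have h1 : Tendsto id (f : Filter (nSpectrum n T)) (𝓝 (ofRep π hπ)) := by
      refine tendsto_subtype_rng.2 (tendsto_pi_nhds.2 fun j => ?_)
      simp only [id, coe_apply, rep_ofRep]
      exact hL ⟨T j, mem_generatedCStar T j⟩
    exact h1

instance : LocallyCompactSpace (nSpectrum n T) := by
  have : WeaklyLocallyCompactSpace (nSpectrum n T) := ⟨fun x => by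
    obtain ⟨a, ha⟩ := rep_ne_zero x
    have h1 : 0 < ‖rep x a‖ := norm_pos_iff.2 ha
    exact ⟨_, isCompact_le_norm a (half_pos h1),
      (continuous_rep_apply a).norm.continuousAt.eventually_const_le (half_lt_self h1)⟩⟩
  infer_instance

instance : ContinuousSMul (Matrix.unitaryGroup (Fin n) ℂ) (nSpectrum n T) := by
  refine ⟨continuous_induced_rng.2 (continuous_pi fun j => ?_)⟩
  change Continuous fun p : Matrix.unitaryGroup (Fin n) ℂ × nSpectrum n T =>
    (p.1 : Matrix (Fin n) (Fin n) ℂ) * p.2.1 j * star (p.1 : Matrix (Fin n) (Fin n) ℂ)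
  have h1 : Continuous fun p : Matrix.unitaryGroup (Fin n) ℂ × nSpectrum n T =>
    (p.1 : Matrix (Fin n) (Fin n) ℂ) := continuous_subtype_val.comp continuous_fst
  have h2 : Continuous fun p : Matrix.unitaryGroup (Fin n) ℂ × nSpectrum n T => p.2.1 j :=
    (continuous_apply j).comp (continuous_subtype_val.comp continuous_snd)
  exact (h1.mul h2).mul h1.star

end nSpectrum

end Spectrum

/-! ### Averages of matrices over a finite set of unitaries -/

section Weyl

open scoped Matrix.Norms.L2Operator

variable {n : ℕ}

theorem Matrix.norm_smul_one [NeZero n] (c : ℂ) :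
    ‖c • (1 : Matrix (Fin n) (Fin n) ℂ)‖ = ‖c‖ := by
  rw [norm_smul, CStarRing.norm_one, mul_one]

theorem norm_conj_unitary {R : Type*} [NormedRing R] [StarRing R] [CStarRing R] {u : R}
    (hu : u ∈ unitary R) (b : R) : ‖u * b * star u‖ = ‖b‖ := by
  rw [CStarRing.norm_mul_mem_unitary _ (Unitary.star_mem hu), CStarRing.norm_mem_unitary_mul _ hu]

variable [NeZero n]

/-- The matrix `diag(s) P` where `P` is the permutation matrix of `i ↦ i + c`. -/
def signShift (p : (Fin n → ℤˣ) × Fin n) : Matrix (Fin n) (Fin n) ℂ :=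
  Matrix.of fun i j => if j = i + p.2 then ((p.1 i : ℤ) : ℂ) else 0

theorem signShift_conj (p : (Fin n → ℤˣ) × Fin n) (b : Matrix (Fin n) (Fin n) ℂ) (i j : Fin n) :
    (signShift p * b * star (signShift p)) i j =
      ((p.1 i * p.1 j : ℤˣ) : ℤ) * b (i + p.2) (j + p.2) := by
  simp only [Matrix.mul_apply, Matrix.star_apply, signShift, Matrix.of_apply, ite_mul, zero_mul,
    Finset.sum_ite_eq', Finset.mem_univ, if_true, apply_ite star, mul_ite, star_zero, mul_zero]
  simp [mul_right_comm]

theorem signShift_mem (p : (Fin n → ℤˣ) × Fin n) :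
    signShift p ∈ Matrix.unitaryGroup (Fin n) ℂ := by
  rw [Matrix.mem_unitaryGroup_iff]
  ext i j
  have h := signShift_conj p 1 i j
  rw [mul_one] at h
  rw [h]
  by_cases hij : i = j
  · subst hij
    simp [← sq]
  · simp [hij]

theorem sum_units_mul (i j : Fin n) :
    ∑ s : Fin n → ℤˣ, (((s i * s j : ℤˣ) : ℤ) : ℂ) =
      if i = j then (Fintype.card (Fin n → ℤˣ) : ℂ) else 0 := by
  split_ifs with h
  · subst h
    simp [← sq]
  -- Flipping the sign at i permutes the summands and negates each of them.
  · let t : Fin n → ℤˣ := Pi.mulSingle i (-1)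
    have h1 : ∑ s : Fin n → ℤˣ, (((s i * s j : ℤˣ) : ℤ) : ℂ) =
        ∑ s : Fin n → ℤˣ, -(((s i * s j : ℤˣ) : ℤ) : ℂ) := by
      refine Fintype.sum_equiv (Equiv.mulRight t) _ _ fun s => ?_
      have h2 : t i = -1 := Pi.mulSingle_eq_same _ _
      have h3 : t j = 1 := Pi.mulSingle_eq_of_ne (Ne.symm h) _
      simp [h2, h3]
    rw [Finset.sum_neg_distrib] at h1
    exact self_eq_neg.1 h1

/-- The normalized trace, as a scalar matrix. -/
noncomputable def scalarTrace (b : Matrix (Fin n) (Fin n) ℂ) : Matrix (Fin n) (Fin n) ℂ :=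
  (b.trace / n) • (1 : Matrix (Fin n) (Fin n) ℂ)

/-- The random signs kill the off-diagonal entries and the cyclic shifts equalize the diagonal, so
the trace is a finite average of unitary conjugates. -/
theorem sum_signShift (b : Matrix (Fin n) (Fin n) ℂ) :
    ((Fintype.card ((Fin n → ℤˣ) × Fin n) : ℂ)⁻¹) •
      ∑ p, signShift p * b * star (signShift p) = scalarTrace b := by
  have hn : (n : ℂ) ≠ 0 := by exact_mod_cast NeZero.ne n
  have hN : (Fintype.card (Fin n → ℤˣ) : ℂ) ≠ 0 := by exact_mod_cast Fintype.card_ne_zero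
  have h1 : ∑ p, signShift p * b * star (signShift p) =
      ((Fintype.card (Fin n → ℤˣ) : ℂ) * b.trace) • (1 : Matrix (Fin n) (Fin n) ℂ) := by
    ext i j
    simp only [Matrix.sum_apply, signShift_conj, Fintype.sum_prod_type, ← Finset.mul_sum,
      ← Finset.sum_mul, sum_units_mul, Matrix.smul_apply, Matrix.one_apply, smul_eq_mul]
    split_ifs with h
    · subst h
      rw [mul_one]
      congr 1
      exact Equiv.sum_comp (Equiv.addLeft i) fun j => b j j
    · simp
  rw [h1, scalarTrace, smul_smul, Fintype.card_prod, Fintype.card_fin]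
  congr 1
  push_cast
  field_simp

theorem norm_average_le {ι R : Type*} [Fintype ι] [Nonempty ι] [SeminormedAddCommGroup R]
    [NormedSpace ℂ R] (f : ι → R) {C : ℝ} (hf : ∀ i, ‖f i‖ ≤ C) :
    ‖((Fintype.card ι : ℂ)⁻¹) • ∑ i, f i‖ ≤ C := by
  have hN : (0 : ℝ) < Fintype.card ι := by exact_mod_cast Fintype.card_pos
  rw [norm_smul, norm_inv, Complex.norm_natCast, inv_mul_le_iff₀ hN]
  calc ‖∑ i, f i‖ ≤ ∑ i, ‖f i‖ := norm_sum_le _ _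
    _ ≤ ∑ _i : ι, C := Finset.sum_le_sum fun i _ => hf i
    _ = _ := by simp

theorem norm_scalarTrace_le (b : Matrix (Fin n) (Fin n) ℂ) : ‖scalarTrace b‖ ≤ ‖b‖ := by
  rw [← sum_signShift]
  exact norm_average_le _ fun p => (norm_conj_unitary (signShift_mem p) b).le

end Weyl

/-! ### Central elements from averaging -/

section Averaging

open scoped Matrix.Norms.L2Operator

/-- The spectrum is finite, so the discontinuity of `Complex.arg` does no harm. The exponential form
matters because self-adjoint elements lift through surjections. -/
theorem Matrix.exists_exp_eq_unitary {n : ℕ} (U : Matrix.unitaryGroup (Fin n) ℂ) :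
    ∃ S : selfAdjoint (Matrix (Fin n) (Fin n) ℂ), selfAdjoint.expUnitary S = U := by
  refine ⟨Unitary.argSelfAdjoint U, Subtype.ext ?_⟩
  have h1 : ContinuousOn Complex.arg (spectrum ℂ (U : Matrix (Fin n) (Fin n) ℂ)) :=
    (Matrix.finite_spectrum _).continuousOn _
  rw [selfAdjoint.expUnitary_coe, Unitary.argSelfAdjoint_coe, ← CFC.exp_eq_normedSpace_exp (𝕜 := ℂ),
    ← cfc_comp_smul .., ← cfc_comp' ..]
  conv_rhs => rw [← cfc_id' ℂ (U : Matrix (Fin n) (Fin n) ℂ)]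
  refine cfc_congr fun y hy => ?_
  have hy₁ : ‖y‖ = 1 := spectrum.norm_eq_one_of_unitary U.2 hy
  have : Complex.I * y.arg = Complex.log y :=
    Complex.ext (by simp [Complex.log_re, hy₁]) (by simp [Complex.log_im])
  have hy0 : y ≠ 0 := fun h => by simp [h] at hy₁
  simpa [← Complex.exp_eq_exp_ℂ, this] using Complex.exp_log hy0

variable {H : Type u} [NormedAddCommGroup H] [InnerProductSpace ℂ H] [CompleteSpace H]
  {n k : ℕ} {T : Fin k → H →L[ℂ] H} [NeZero n]

namespace IsNHomogeneousSystem

open nSpectrum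

variable (hT : IsNHomogeneousSystem n T)

include hT in
theorem norm_le (a : generatedCStar T) {C : ℝ} (hC : 0 ≤ C)
    (ha : ∀ x : nSpectrum n T, ‖rep x a‖ ≤ C) : ‖a‖ ≤ C :=
  IsNHomogeneous.norm_le hT hC a (fun π hπ => rep_ofRep π hπ ▸ ha (ofRep π hπ))
    (NonUnitalStarSubalgebraClass.subtype (R := ℂ) (generatedCStar T))

include hT in
theorem rep_injective {a b : generatedCStar T} (h : ∀ x : nSpectrum n T, rep x a = rep x b) :
    a = b := by
  rw [← sub_eq_zero, ← norm_le_zero_iff]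
  exact hT.norm_le _ le_rfl fun x => by rw [map_sub, h, sub_self, norm_zero]

include hT in
-- The map from C*(T) to functions on the spectrum is isometric and C*(T) is complete, so its image
-- is uniformly closed.
theorem exists_of_approx {F : nSpectrum n T → Matrix (Fin n) (Fin n) ℂ}
    (hF : ∀ ε > 0, ∃ a : generatedCStar T, ∀ x, ‖rep x a - F x‖ ≤ ε) :
    ∃ a : generatedCStar T, ∀ x, rep x a = F x := by
  choose s hs using fun m : ℕ => hF (1 / (m + 1)) (by positivity)
  have hlim := tendsto_one_div_add_atTop_nhds_zero_nat (𝕜 := ℝ)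
  have hc : CauchySeq s := by
    refine cauchySeq_of_le_tendsto_0 (fun N : ℕ => 1 / ((N : ℝ) + 1) + 1 / ((N : ℝ) + 1))
      (fun i j N hi hj => ?_) (by simpa using hlim.add hlim)
    rw [dist_eq_norm]
    refine hT.norm_le _ (by positivity) fun x => ?_
    rw [map_sub, ← sub_sub_sub_cancel_right _ _ (F x)]
    refine (norm_sub_le _ _).trans (add_le_add ((hs i x).trans ?_) ((hs j x).trans ?_)) <;>
    · gcongr
  obtain ⟨a, ha⟩ := cauchySeq_tendsto_of_complete hc
  refine ⟨a, fun x => ?_⟩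
  have h1 : Tendsto (fun m => rep x (s m)) atTop (𝓝 (rep x a)) :=
    ((continuous_rep (rep x)).tendsto a).comp ha
  refine tendsto_nhds_unique h1 ?_
  rw [tendsto_iff_norm_sub_tendsto_zero]
  exact squeeze_zero (fun _ => norm_nonneg _) (fun m => hs m x) hlim

end IsNHomogeneousSystem

namespace nSpectrum

/-- The extension of a representation to the unitization. -/
noncomputable def urep (x : nSpectrum n T) :
    Unitization ℂ (generatedCStar T) →⋆ₐ[ℂ] Matrix (Fin n) (Fin n) ℂ :=
  Unitization.starLift (rep x)

theorem urep_inr (x : nSpectrum n T) (a : generatedCStar T) :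
    urep x (a : Unitization ℂ (generatedCStar T)) = rep x a :=
  congr($(Equiv.symm_apply_apply Unitization.starLift (rep x)) a)

theorem continuous_urep_apply (w : Unitization ℂ (generatedCStar T)) :
    Continuous fun x : nSpectrum n T => urep x w := by
  induction w with
  | inl_add_inr r a =>
    simp only [map_add, ← Unitization.algebraMap_eq_inl, AlgHomClass.commutes, urep_inr]
    exact continuous_const.add (continuous_rep_apply a)

/-- Conjugation by an element of the unitization. -/
noncomputable def conjBy (u : Unitization ℂ (generatedCStar T)) (a : generatedCStar T) :
    generatedCStar T := (u * a * star u).snd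

theorem rep_conjBy (x : nSpectrum n T) (u : Unitization ℂ (generatedCStar T))
    (a : generatedCStar T) : rep x (conjBy u a) = urep x u * rep x a * star (urep x u) := by
  -- C*(T) is an ideal of its unitization, so taking `snd` loses nothing.
  have h1 : ((conjBy u a : generatedCStar T) : Unitization ℂ (generatedCStar T)) =
      u * a * star u := by
    refine Unitization.ext ?_ rfl
    simp
  rw [← urep_inr, h1, map_mul, map_mul, map_star, urep_inr]

/-- Maps of `C*(T)` that act as averages of unitary conjugations in every representation. -/
def IsAveraging (n : ℕ) (α : generatedCStar T → generatedCStar T) : Prop :=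
  ∀ (b : generatedCStar T) (x : nSpectrum n T), (rep x (α b)).trace = (rep x b).trace ∧
    ∀ c : ℂ, ‖rep x (α b) - c • (1 : Matrix (Fin n) (Fin n) ℂ)‖ ≤
      ‖rep x b - c • (1 : Matrix (Fin n) (Fin n) ℂ)‖

omit [NeZero n] in
theorem IsAveraging.norm_le {α : generatedCStar T → generatedCStar T} (hα : IsAveraging n α)
    (b : generatedCStar T) (x : nSpectrum n T) : ‖rep x (α b)‖ ≤ ‖rep x b‖ := by
  simpa using (hα b x).2 0

theorem IsAveraging.norm_sub_scalarTrace_le {α : generatedCStar T → generatedCStar T}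
    (hα : IsAveraging n α) (b : generatedCStar T) (x : nSpectrum n T) :
    ‖rep x (α b) - scalarTrace (rep x b)‖ ≤ ‖rep x b - scalarTrace (rep x b)‖ := (hα b x).2 _

theorem IsAveraging.scalarTrace_eq {α : generatedCStar T → generatedCStar T}
    (hα : IsAveraging n α) (b : generatedCStar T) (x : nSpectrum n T) :
    scalarTrace (rep x (α b)) = scalarTrace (rep x b) := by
  rw [scalarTrace, scalarTrace, (hα b x).1]

/-- Conjugation by a unitary preserves the trace and fixes c • 1, so averaging cannot increase the
distance to a scalar matrix. -/
theorem isAveraging_of_unitary {ι : Type*} [Fintype ι] [Nonempty ι]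
    (u : ι → unitary (Unitization ℂ (generatedCStar T))) :
    IsAveraging n fun b => ((Fintype.card ι : ℂ)⁻¹) • ∑ i, conjBy (u i : Unitization ℂ (generatedCStar T)) b := by
  intro b x
  have hN : (Fintype.card ι : ℂ) ≠ 0 := by exact_mod_cast Fintype.card_ne_zero
  have hu : ∀ i, urep x (u i : Unitization ℂ (generatedCStar T)) ∈ unitary (Matrix (Fin n) (Fin n) ℂ) := fun i =>
    Unitary.map_mem (urep x) (u i).2
  have hrep : rep x (((Fintype.card ι : ℂ)⁻¹) • ∑ i, conjBy (u i : Unitization ℂ (generatedCStar T)) b) =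
      ((Fintype.card ι : ℂ)⁻¹) • ∑ i, urep x (u i : Unitization ℂ (generatedCStar T)) * rep x b *
        star (urep x (u i : Unitization ℂ (generatedCStar T))) := by
    rw [map_smul, map_sum]
    simp only [rep_conjBy]
  constructor
  · have h1 : ∀ i, (urep x (u i : Unitization ℂ (generatedCStar T)) * rep x b *
        star (urep x (u i : Unitization ℂ (generatedCStar T)))).trace = (rep x b).trace := fun i => by
      rw [Matrix.trace_mul_comm, ← mul_assoc, Unitary.star_mul_self_of_mem (hu i), one_mul]
    rw [hrep, Matrix.trace_smul, Matrix.trace_sum, Finset.sum_congr rfl fun i _ => h1 i]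
    simp [hN]
  · intro c
    have h1 : rep x (((Fintype.card ι : ℂ)⁻¹) • ∑ i, conjBy (u i : Unitization ℂ (generatedCStar T)) b) - c • 1 =
        ((Fintype.card ι : ℂ)⁻¹) • ∑ i, urep x (u i : Unitization ℂ (generatedCStar T)) * (rep x b - c • 1) *
          star (urep x (u i : Unitization ℂ (generatedCStar T))) := by
      rw [hrep]
      simp only [mul_sub, sub_mul, Finset.sum_sub_distrib, smul_sub, mul_smul_comm, mul_one,
        smul_mul_assoc, Unitary.mul_star_self_of_mem (hu _)]
      congr 1
      rw [Finset.sum_const, Finset.card_univ, ← Nat.cast_smul_eq_nsmul ℂ, smul_smul,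
        inv_mul_cancel₀ hN, one_smul]
    rw [h1]
    exact norm_average_le _ fun i => (norm_conj_unitary (hu i) _).le

end nSpectrum

namespace IsNHomogeneousSystem

open nSpectrum

variable (hT : IsNHomogeneousSystem n T)

include hT in
theorem rep_surjective (x : nSpectrum n T) : Function.Surjective (rep x) :=
  IsNHomogeneous.surjective hT (rep x) (rep_ne_zero x)

include hT in
-- Write U as exp(iS), lift S to a self-adjoint element by surjectivity of `rep x`, and exponentiate
-- in the unitization.
theorem exists_unitary_lift (x : nSpectrum n T) (U : Matrix.unitaryGroup (Fin n) ℂ) :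
    ∃ u : unitary (Unitization ℂ (generatedCStar T)), urep x (u : Unitization ℂ _) = U := by
  obtain ⟨S, hS⟩ := Matrix.exists_exp_eq_unitary U
  obtain ⟨a, ha⟩ := hT.rep_surjective x S
  let b : generatedCStar T := (2⁻¹ : ℂ) • (a + star a)
  have hb : star b = b := by
    simp only [b, star_smul, star_add, star_star, add_comm (star a)]
    simp
  have hbS : rep x b = S := by
    have h1 : star (S : Matrix (Fin n) (Fin n) ℂ) = S := S.2
    simp only [b, map_smul, map_add, map_star, ha, h1]
    rw [← two_smul ℂ (S : Matrix (Fin n) (Fin n) ℂ), smul_smul]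
    simp
  let c : selfAdjoint (Unitization ℂ (generatedCStar T)) := ⟨(b : Unitization ℂ _), by
    rw [selfAdjoint.mem_iff, ← Unitization.inr_star, hb]⟩
  refine ⟨selfAdjoint.expUnitary c, ?_⟩
  have hcont : Continuous (urep x) := AddMonoidHomClass.continuous_of_bound (urep x) 1 fun w => by
    simpa using NonUnitalStarAlgHom.norm_apply_le (urep x) w
  let +nondep : NormedAlgebra ℚ (Unitization ℂ (generatedCStar T)) :=
    NormedAlgebra.restrictScalars ℚ ℂ _
  let +nondep : NormedAlgebra ℚ (Matrix (Fin n) (Fin n) ℂ) :=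
    NormedAlgebra.restrictScalars ℚ ℂ _
  rw [selfAdjoint.expUnitary_coe, NormedSpace.map_exp _ hcont, map_smul, urep_inr, hbS, ← hS,
    selfAdjoint.expUnitary_coe]

include hT in
-- Unitary lifts of the `signShift` matrices at x remain close to them at nearby points, where their
-- average is therefore nearly the normalized trace.
theorem exists_averaging_nhds (x : nSpectrum n T) {ε : ℝ} (hε : 0 < ε) :
    ∃ α : generatedCStar T → generatedCStar T, IsAveraging n α ∧ ∀ᶠ y in 𝓝 x, ∀ b,
      ‖rep y (α b) - scalarTrace (rep y b)‖ ≤ ε * ‖rep y b‖ := by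
  choose u hu using fun p : (Fin n → ℤˣ) × Fin n =>
    hT.exists_unitary_lift x ⟨signShift p, signShift_mem p⟩
  refine ⟨_, isAveraging_of_unitary u, ?_⟩
  -- Half of ε, since the unitary occurs on both sides of the conjugation.
  have h1 : ∀ᶠ y in 𝓝 x, ∀ p, ‖urep y (u p : Unitization ℂ (generatedCStar T)) - signShift p‖ < ε / 2 := by
    rw [eventually_all]
    intro p
    have h2 := (((continuous_urep_apply (u p : Unitization ℂ (generatedCStar T))).sub
      (continuous_const (y := signShift p))).norm.tendsto x)
    simp only [Pi.sub_apply, hu, sub_self, norm_zero] at h2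
    exact h2.eventually_lt_const (half_pos hε)
  filter_upwards [h1] with y hy b
  rw [map_smul, map_sum, ← sum_signShift, ← smul_sub, ← Finset.sum_sub_distrib]
  refine norm_average_le _ fun p => ?_
  rw [rep_conjBy]
  set v := urep y (u p : Unitization ℂ (generatedCStar T))
  set w := signShift p
  have hv : v ∈ unitary _ := Unitary.map_mem (urep y) (u p).2
  have hw : w ∈ unitary _ := signShift_mem p
  have h3 : v * rep y b * star v - w * rep y b * star w =
      (v - w) * rep y b * star v + w * rep y b * star (v - w) := by
    rw [star_sub]; noncomm_ring
  rw [h3]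
  refine (norm_add_le _ _).trans ?_
  rw [CStarRing.norm_mul_mem_unitary _ (Unitary.star_mem hv), mul_assoc w,
    CStarRing.norm_mem_unitary_mul _ hw]
  calc _ ≤ ‖v - w‖ * ‖rep y b‖ + ‖rep y b‖ * ‖star (v - w)‖ :=
        add_le_add (norm_mul_le _ _) (norm_mul_le _ _)
    _ = 2 * ‖v - w‖ * ‖rep y b‖ := by rw [norm_star]; ring
    _ ≤ ε * ‖rep y b‖ := by
      gcongr
      linarith [hy p]

include hT in
-- Local averagings are composed: each preserves the trace and does not increase norms or distances
-- to scalars, so a composite is good wherever either factor is.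
theorem exists_averaging_compact {K : Set (nSpectrum n T)} (hK : IsCompact K) {ε : ℝ}
    (hε : 0 < ε) : ∃ α : generatedCStar T → generatedCStar T, IsAveraging n α ∧ ∀ y ∈ K, ∀ b,
      ‖rep y (α b) - scalarTrace (rep y b)‖ ≤ ε * ‖rep y b‖ := by
  refine hK.induction_on (p := fun K => ∃ α : generatedCStar T → generatedCStar T,
    IsAveraging n α ∧ ∀ y ∈ K, ∀ b, ‖rep y (α b) - scalarTrace (rep y b)‖ ≤ ε * ‖rep y b‖)
    ⟨id, fun b x => ⟨rfl, fun c => le_rfl⟩, by simp⟩ ?_ ?_ ?_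
  · rintro s t hst ⟨α, hα, h⟩
    exact ⟨α, hα, fun y hy => h y (hst hy)⟩
  · rintro s t ⟨α, hα, h⟩ ⟨β, hβ, h'⟩
    refine ⟨α ∘ β, fun b x => ⟨((hα (β b) x).1).trans (hβ b x).1, fun c =>
      ((hα (β b) x).2 c).trans ((hβ b x).2 c)⟩, ?_⟩
    rintro y (hy | hy) b
    · have h1 := h y hy (β b)
      rw [hβ.scalarTrace_eq] at h1
      exact h1.trans (by gcongr; exact hβ.norm_le b y)
    · have h1 := hα.norm_sub_scalarTrace_le (β b) y
      rw [hβ.scalarTrace_eq] at h1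
      exact h1.trans (h' y hy b)
  · intro x _
    obtain ⟨α, hα, h⟩ := hT.exists_averaging_nhds x hε
    exact ⟨_, mem_nhdsWithin_of_mem_nhds h, α, hα, fun y hy => hy⟩

include hT in
-- The source of central elements: average on the compact set where `rep x a` is not small;
-- elsewhere both the average and the trace are small anyway.
theorem exists_scalarTrace (a : generatedCStar T) :
    ∃ c : generatedCStar T, ∀ x : nSpectrum n T, rep x c = scalarTrace (rep x a) := by
  refine hT.exists_of_approx fun ε hε => ?_
  -- The relative error times ‖rep x a‖ ≤ ‖a‖ stays below ε; the 1 covers a = 0.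
  have hδ : 0 < ε / (2 * (‖a‖ + 1)) := by positivity
  obtain ⟨α, hα, h⟩ := hT.exists_averaging_compact (isCompact_le_norm a (half_pos hε)) hδ
  refine ⟨α a, fun x => ?_⟩
  by_cases hx : ε / 2 ≤ ‖rep x a‖
  · refine (h x hx a).trans ?_
    have h1 := norm_rep_le x a
    rw [div_mul_eq_mul_div, div_le_iff₀ (by positivity)]
    nlinarith [norm_nonneg a]
  · push Not at hx
    refine (norm_sub_le _ _).trans ?_
    linarith [hα.norm_le a x, norm_scalarTrace_le (rep x a)]

end IsNHomogeneousSystem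

end Averaging

/-! ### The Stone–Weierstrass theorem for `n`-homogeneous systems -/

section StoneWeierstrass

open scoped Matrix.Norms.L2Operator

variable {H : Type u} [NormedAddCommGroup H] [InnerProductSpace ℂ H] [CompleteSpace H]
  {n k : ℕ} {T : Fin k → H →L[ℂ] H} [NeZero n]

namespace nSpectrum

/-- Real functions `g` on the `n`-spectrum for which `g • 1` comes from an element of `C*(T)`. -/
def IsCentral (g : nSpectrum n T → ℝ) : Prop :=
  ∃ c : generatedCStar T, ∀ x, rep x c = (g x : ℂ) • (1 : Matrix (Fin n) (Fin n) ℂ)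

theorem IsCentral.mul {g g' : nSpectrum n T → ℝ} (hg : IsCentral g) (hg' : IsCentral g') :
    IsCentral fun x => g x * g' x := by
  obtain ⟨c, hc⟩ := hg
  obtain ⟨c', hc'⟩ := hg'
  exact ⟨c * c', fun x => by rw [map_mul, hc, hc', smul_mul_smul_comm, mul_one]; push_cast; rfl⟩

theorem IsCentral.continuous {g : nSpectrum n T → ℝ} (hg : IsCentral g) : Continuous g := by
  obtain ⟨c, hc⟩ := hg
  have h1 : Continuous fun x : nSpectrum n T => ((rep x c) 0 0).re :=
    Complex.continuous_re.comp ((continuous_rep_apply c).matrix_elem 0 0)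
  simpa [hc] using h1

theorem IsCentral.isCompact {g : nSpectrum n T → ℝ} (hg : IsCentral g) {ε : ℝ} (hε : 0 < ε) :
    IsCompact {x | ε ≤ |g x|} := by
  obtain ⟨c, hc⟩ := hg
  have h1 := isCompact_le_norm (n := n) c hε
  simpa only [hc, Matrix.norm_smul_one, Complex.norm_real, Real.norm_eq_abs] using h1

end nSpectrum

namespace IsNHomogeneousSystem

open nSpectrum

variable (hT : IsNHomogeneousSystem n T)

include hT in
-- Functional calculus commutes with every `rep x` and is evaluation of f on scalar matrices. The
-- condition f 0 = 0 keeps it inside C*(T), which may have no unit.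
theorem isCentral_comp {g : nSpectrum n T → ℝ} (hg : IsCentral g) {f : ℝ → ℝ} (hf : Continuous f)
    (hf0 : f 0 = 0) : IsCentral fun x => f (g x) := by
  obtain ⟨c, hc⟩ := hg
  have hsa : IsSelfAdjoint c := hT.rep_injective fun x => by
    rw [map_star, hc, star_smul, star_one, Complex.star_def, Complex.conj_ofReal]
  refine ⟨cfcₙ f c, fun x => ?_⟩
  have h1 : rep x c = algebraMap ℝ (Matrix (Fin n) (Fin n) ℂ) (g x) := by
    rw [hc, Algebra.algebraMap_eq_smul_one, Complex.coe_smul]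
  have hsa' : IsSelfAdjoint (rep x c) := hsa.map (rep x)
  rw [NonUnitalStarAlgHom.map_cfcₙ (S := ℂ) (rep x) f c hf.continuousOn hf0 (continuous_rep (rep x))
    hsa hsa', cfcₙ_eq_cfc hf.continuousOn hf0, h1, cfc_algebraMap,
    Algebra.algebraMap_eq_smul_one, Complex.coe_smul]

include hT in
-- The normalized trace of a*a is central, nonnegative, 1 where a is represented by 1, and 0 where a
-- is represented by 0.
theorem exists_isCentral_of_rep (a : generatedCStar T) : ∃ g : nSpectrum n T → ℝ,
    IsCentral g ∧ (∀ x, 0 ≤ g x) ∧ (∀ x, rep x a = 1 → g x = 1) ∧ ∀ x, rep x a = 0 → g x = 0 := by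
  obtain ⟨c, hc⟩ := hT.exists_scalarTrace (star a * a)
  have htr : ∀ M : Matrix (Fin n) (Fin n) ℂ, ∃ r : ℝ, 0 ≤ r ∧ (star M * M).trace = (r : ℂ) :=
    fun M => by
      refine ⟨∑ i, ∑ j, ‖M j i‖ ^ 2, by positivity, ?_⟩
      push_cast
      simp only [Matrix.trace, Matrix.diag, Matrix.mul_apply, Matrix.star_apply]
      refine Finset.sum_congr rfl fun i _ => Finset.sum_congr rfl fun j _ => ?_
      rw [Complex.star_def, Complex.conj_mul']
  have hn : (n : ℝ) ≠ 0 := by exact_mod_cast NeZero.ne n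
  choose r hr0 hr using htr
  refine ⟨fun x => r (rep x a) / n, ⟨c, fun x => ?_⟩, fun x => by have := hr0 (rep x a); positivity,
    fun x hx => ?_, fun x hx => ?_⟩
  · rw [hc, map_mul, map_star, scalarTrace, hr]
    push_cast
    rfl
  · have h1 := hr 1
    rw [star_one, one_mul, Matrix.trace_one, Fintype.card_fin] at h1
    have h2 : r 1 = n := by exact_mod_cast h1.symm
    change r (rep x a) / n = 1
    rw [hx, h2, div_self hn]
  · have h1 := hr 0
    rw [mul_zero, Matrix.trace_zero] at h1
    have h2 : r 0 = 0 := by exact_mod_cast h1.symm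
    change r (rep x a) / n = 0
    rw [hx, h2, zero_div]

/-- The piecewise linear function that is `0` for `t ≤ 1/3` and `1` for `t ≥ 2/3`. -/
noncomputable def ramp (t : ℝ) : ℝ := max 0 (min 1 (3 * t - 1))

theorem continuous_ramp : Continuous ramp := by unfold ramp; fun_prop

theorem ramp_nonneg (t : ℝ) : 0 ≤ ramp t := le_max_left _ _

theorem ramp_le_one (t : ℝ) : ramp t ≤ 1 := max_le zero_le_one (min_le_left _ _)

theorem ramp_of_le {t : ℝ} (ht : t ≤ 1 / 3) : ramp t = 0 :=
  max_eq_left ((min_le_right _ _).trans (by linarith))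

theorem ramp_of_ge {t : ℝ} (ht : 2 / 3 ≤ t) : ramp t = 1 := by
  rw [ramp, min_eq_left (by linarith), max_eq_right zero_le_one]

include hT in
-- Urysohn's lemma on the orbit space. Central functions are constant on orbits, which is why N has
-- to contain the whole orbit of x.
theorem exists_bump (x : nSpectrum n T) {N : Set (nSpectrum n T)} (hN : IsOpen N)
    (hxN : ∀ U : Matrix.unitaryGroup (Fin n) ℂ, U • x ∈ N) :
    ∃ g : nSpectrum n T → ℝ, IsCentral g ∧ (∀ y, 0 ≤ g y ∧ g y ≤ 1) ∧ (∀ᶠ y in 𝓝 x, g y = 1) ∧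
      ∀ y ∉ N, g y = 0 := by
  have hramp : ∀ {g : nSpectrum n T → ℝ}, IsCentral g → g x = 1 →
      ∀ᶠ y in 𝓝 x, ramp (g y) = 1 := fun {g} hg hgx => by
    have h1 : ∀ᶠ y in 𝓝 x, 2 / 3 ≤ g y :=
      hg.continuous.continuousAt.eventually_const_le (by rw [hgx]; norm_num)
    exact h1.mono fun y hy => ramp_of_ge hy
  obtain ⟨a₀, ha₀⟩ := hT.rep_surjective x 1
  obtain ⟨g₀, hg₀, hg₀n, hg₀1, -⟩ := hT.exists_isCentral_of_rep a₀
  -- The factor `ramp ∘ g₀` vanishes where g₀ ≤ 1/3, so only this compact part of the complement of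
  -- N remains to be killed, by a finite product.
  have hC : IsCompact ({y | 1 / 3 ≤ |g₀ y|} \ N) := (hg₀.isCompact (by norm_num)).diff hN
  obtain ⟨g, hg, hg01, hg1, hg0⟩ := hC.induction_on (p := fun S => ∃ g : nSpectrum n T → ℝ,
      IsCentral g ∧ (∀ y, 0 ≤ g y ∧ g y ≤ 1) ∧ (∀ᶠ y in 𝓝 x, g y = 1) ∧ ∀ y ∈ S, g y = 0)
    ⟨fun y => ramp (g₀ y), hT.isCentral_comp hg₀ continuous_ramp (ramp_of_le (by norm_num)),
      fun y => ⟨ramp_nonneg _, ramp_le_one _⟩, hramp hg₀ (hg₀1 x ha₀), by simp⟩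
    (by
      rintro s t hst ⟨g, h1, h2, h3, h4⟩
      exact ⟨g, h1, h2, h3, fun y hy => h4 y (hst hy)⟩)
    (by
      rintro s t ⟨g, h1, h2, h3, h4⟩ ⟨g', h1', h2', h3', h4'⟩
      refine ⟨_, h1.mul h1', fun y => ⟨mul_nonneg (h2 y).1 (h2' y).1,
        mul_le_one₀ (h2 y).2 (h2' y).1 (h2' y).2⟩, ?_, ?_⟩
      · filter_upwards [h3, h3'] with y hy hy'
        rw [hy, hy', mul_one]
      · rintro y (hy | hy)
        · simp [h4 y hy]
        · simp [h4' y hy])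
    (by
      rintro y ⟨-, hyN⟩
      -- A point y equivalent to x lies on its orbit, hence in N; every other y is separated from x
      -- by an element of C*(T).
      rcases IsNHomogeneous.exists_unitary_or_separating hT (rep y) (rep x) (rep_ne_zero y)
        (rep_ne_zero x) with ⟨U, hU⟩ | ⟨a, hay, hax⟩
      · refine absurd (hxN (star U)) ?_
        have : star U • x = y := ext_of_rep fun a => by
          rw [rep_smul, hU]
          have h1 : star (U : Matrix (Fin n) (Fin n) ℂ) * U = 1 :=
            Unitary.star_mul_self_of_mem U.2
          rw [Unitary.coe_star, star_star, mul_assoc, mul_assoc, h1, mul_one, ← mul_assoc, h1,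
            one_mul]
        rwa [this]
      · obtain ⟨g, hg, -, hg1, hg0⟩ := hT.exists_isCentral_of_rep a
        refine ⟨{z | g z < 1 / 3}, mem_nhdsWithin_of_mem_nhds ?_, fun z => ramp (g z),
          hT.isCentral_comp hg continuous_ramp (ramp_of_le (by norm_num)),
          fun y => ⟨ramp_nonneg _, ramp_le_one _⟩, hramp hg (hg1 x hax), fun z hz => ?_⟩
        · exact hg.continuous.continuousAt.eventually_lt_const (by rw [hg0 y hay]; norm_num)
        · exact ramp_of_le (le_of_lt hz))
  refine ⟨_, hg.mul (hT.isCentral_comp hg₀ continuous_ramp (ramp_of_le (by norm_num))),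
    fun y => ⟨mul_nonneg (hg01 y).1 (ramp_nonneg _),
      mul_le_one₀ (hg01 y).2 (ramp_nonneg _) (ramp_le_one _)⟩, ?_, fun y hy => ?_⟩
  · filter_upwards [hg1, hramp hg₀ (hg₀1 x ha₀)] with y hy hy'
    rw [hy, hy', mul_one]
  · by_cases h : 1 / 3 ≤ |g₀ y|
    · rw [hg0 y ⟨h, hy⟩, zero_mul]
    · rw [abs_of_nonneg (hg₀n y)] at h
      rw [ramp_of_le (not_le.1 h).le, mul_zero]

end IsNHomogeneousSystem

/-- Continuous equivariant functions that vanish at infinity. -/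
def IsC0Equivariant {X : Type*} [TopologicalSpace X] [MulAction (Matrix.unitaryGroup (Fin n) ℂ) X]
    (F : X → Matrix (Fin n) (Fin n) ℂ) : Prop :=
  Continuous F ∧ Tendsto F (cocompact X) (𝓝 0) ∧ ∀ (U : Matrix.unitaryGroup (Fin n) ℂ) (x : X),
    F (U • x) = (U : Matrix (Fin n) (Fin n) ℂ) * F x * star (U : Matrix (Fin n) (Fin n) ℂ)

theorem IsC0Equivariant.isCompact_le_norm {X : Type*} [TopologicalSpace X]
    [MulAction (Matrix.unitaryGroup (Fin n) ℂ) X] {F : X → Matrix (Fin n) (Fin n) ℂ}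
    (hF : IsC0Equivariant F) {ε : ℝ} (hε : 0 < ε) : IsCompact {x | ε ≤ ‖F x‖} := by
  have h1 : ∀ᶠ x in cocompact X, ‖F x‖ < ε := by
    have := hF.2.1.norm
    rw [norm_zero] at this
    exact this.eventually_lt_const hε
  obtain ⟨K, hK, hKs⟩ := mem_cocompact.1 h1
  refine hK.of_isClosed_subset (isClosed_le continuous_const hF.1.norm) fun x hx => ?_
  by_contra hxK
  exact not_lt.2 (show ε ≤ ‖F x‖ from hx) (hKs hxK)

namespace IsNHomogeneousSystem

open nSpectrum

variable (hT : IsNHomogeneousSystem n T)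

include hT in
/-- Every equivariant continuous function that vanishes at infinity comes from `C*(T)`. -/
theorem exists_rep_eq {F : nSpectrum n T → Matrix (Fin n) (Fin n) ℂ} (hF : IsC0Equivariant F) :
    ∃ a : generatedCStar T, ∀ x, rep x a = F x := by
  refine hT.exists_of_approx fun ε hε => ?_
  have hε2 := half_pos hε
  -- Induction on compact sets replaces a partition of unity: a approximates g • F with an error
  -- weighted by g.
  obtain ⟨g, hg, hg01, hg1, a, ha⟩ := (hF.isCompact_le_norm hε2).induction_on
    (p := fun S => ∃ g : nSpectrum n T → ℝ, IsCentral g ∧ (∀ y, 0 ≤ g y ∧ g y ≤ 1) ∧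
      (∀ y ∈ S, g y = 1) ∧ ∃ a : generatedCStar T, ∀ y,
        ‖rep y a - (g y : ℂ) • F y‖ ≤ ε / 2 * g y)
    ⟨fun _ => 0, ⟨0, by simp⟩, by simp, by simp, 0, by simp⟩
    (by
      rintro s t hst ⟨g, h1, h2, h3, h4⟩
      exact ⟨g, h1, h2, fun y hy => h3 y (hst hy), h4⟩)
    (by
      rintro s t ⟨g, ⟨c, hc⟩, h2, h3, a, ha⟩ ⟨g', ⟨c', hc'⟩, h2', h3', a', ha'⟩
      -- The new weight is 1 - (1 - g)(1 - g'), equal to 1 wherever g or g' is; the second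
      -- approximation enters with factor 1 - g.
      refine ⟨fun y => g y + g' y - g y * g' y, ⟨c + c' - c * c', fun x => ?_⟩, fun y => ?_, ?_,
        a + a' - c * a', fun y => ?_⟩
      · rw [map_sub, map_add, map_mul, hc, hc', smul_mul_smul_comm, mul_one]
        push_cast
        module
      · have := h2 y
        have := h2' y
        constructor <;> nlinarith
      · rintro y (hy | hy)
        · simp [h3 y hy]
        · simp [h3' y hy]
      · have h5 : rep y (a + a' - c * a') - ((g y + g' y - g y * g' y : ℝ) : ℂ) • F y =
            (rep y a - (g y : ℂ) • F y) + ((1 - g y : ℝ) : ℂ) • (rep y a' - (g' y : ℂ) • F y) := by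
          rw [map_sub, map_add, map_mul, hc, smul_mul_assoc, one_mul]
          push_cast
          module
        rw [h5]
        refine (norm_add_le _ _).trans ?_
        rw [norm_smul, Complex.norm_real, Real.norm_of_nonneg (by linarith [(h2 y).2])]
        have h6 := ha y
        have h7 := mul_le_mul_of_nonneg_left (ha' y) (by linarith [(h2 y).2] : 0 ≤ 1 - g y)
        linarith)
    (by
      intro x _
      -- Matching F at x matches it on the whole orbit, because both sides are equivariant.
      obtain ⟨a, ha⟩ := hT.rep_surjective x (F x)
      have hNo : IsOpen {y : nSpectrum n T | ‖rep y a - F y‖ < ε / 2} :=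
        isOpen_lt ((continuous_rep_apply a).sub hF.1).norm continuous_const
      obtain ⟨g, hg, hg01, hg1, hg0⟩ := hT.exists_bump x hNo fun U => by
        rw [Set.mem_ofPred_eq, rep_smul, hF.2.2, ha, sub_self, norm_zero]
        exact hε2
      obtain ⟨c, hc⟩ := hg
      refine ⟨{y | g y = 1}, mem_nhdsWithin_of_mem_nhds hg1, g, ⟨c, hc⟩, hg01, fun y hy => hy,
        c * a, fun y => ?_⟩
      rw [map_mul, hc, smul_mul_assoc, one_mul, ← smul_sub, norm_smul, Complex.norm_real,
        Real.norm_of_nonneg (hg01 y).1]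
      by_cases hy : ‖rep y a - F y‖ < ε / 2
      · rw [mul_comm]
        exact mul_le_mul_of_nonneg_right hy.le (hg01 y).1
      · rw [hg0 y hy, zero_mul, mul_zero])
  -- Where g may differ from 1, ‖F‖ is below ε/2, so both terms of the splitting below are at most
  -- ε/2.
  refine ⟨a, fun x => ?_⟩
  have h1 : rep x a - F x = (rep x a - (g x : ℂ) • F x) - ((1 - g x : ℝ) : ℂ) • F x := by
    push_cast
    module
  rw [h1]
  refine (norm_sub_le _ _).trans ?_
  have h2 := ha x
  have h3 := hg01 x
  rw [norm_smul, Complex.norm_real, Real.norm_of_nonneg (by linarith)]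
  by_cases hx : ε / 2 ≤ ‖F x‖
  · rw [hg1 x hx] at h2 ⊢
    simp only [sub_self, zero_mul, add_zero]
    linarith
  · have h4 : (1 - g x) * ‖F x‖ ≤ 1 * (ε / 2) := by
      gcongr
      · linarith
      · exact (not_le.1 hx).le
    nlinarith

end IsNHomogeneousSystem

end StoneWeierstrass

/-! ### Normal functionals on bounded measurable functions -/

section NormalFunctional

variable {X : Type*} [MeasurableSpace X]

/-- Bounded measurable complex functions. -/
def IsBddMeasurable (f : X → ℂ) : Prop := Measurable f ∧ ∃ C : ℝ, ∀ x, ‖f x‖ ≤ C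

theorem IsBddMeasurable.indicator_const {A : Set X} (hA : MeasurableSet A) (c : ℂ) :
    IsBddMeasurable (A.indicator fun _ => c) := by
  refine ⟨measurable_const.indicator hA, ‖c‖, fun x => ?_⟩
  exact norm_indicator_le_norm_self (fun _ => c) x

theorem IsBddMeasurable.const (c : ℂ) : IsBddMeasurable fun _ : X => c :=
  ⟨measurable_const, ‖c‖, fun _ => le_rfl⟩

theorem IsBddMeasurable.add {f g : X → ℂ} (hf : IsBddMeasurable f) (hg : IsBddMeasurable g) :
    IsBddMeasurable (f + g) := by
  obtain ⟨hf, C, hC⟩ := hf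
  obtain ⟨hg, D, hD⟩ := hg
  exact ⟨hf.add hg, C + D, fun x => (norm_add_le _ _).trans (add_le_add (hC x) (hD x))⟩

theorem IsBddMeasurable.mul {f g : X → ℂ} (hf : IsBddMeasurable f) (hg : IsBddMeasurable g) :
    IsBddMeasurable (f * g) := by
  obtain ⟨hf, C, hC⟩ := hf
  obtain ⟨hg, D, hD⟩ := hg
  refine ⟨hf.mul hg, C * D, fun x => ?_⟩
  rw [Pi.mul_apply, norm_mul]
  exact mul_le_mul (hC x) (hD x) (norm_nonneg _) ((norm_nonneg _).trans (hC x))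

theorem IsBddMeasurable.smul {f : X → ℂ} (hf : IsBddMeasurable f) (c : ℂ) :
    IsBddMeasurable (c • f) :=
  (IsBddMeasurable.const c).mul hf

theorem IsBddMeasurable.comp {f : X → ℂ} (hf : IsBddMeasurable f) {ψ : X → X}
    (hψ : Measurable ψ) : IsBddMeasurable (f ∘ ψ) :=
  ⟨hf.1.comp hψ, hf.2.imp fun _ h x => h (ψ x)⟩

theorem IsBddMeasurable.sum {ι : Type*} (s : Finset ι) {f : ι → X → ℂ}
    (hf : ∀ i ∈ s, IsBddMeasurable (f i)) : IsBddMeasurable (∑ i ∈ s, f i) :=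
  Finset.sum_induction f IsBddMeasurable (fun _ _ => IsBddMeasurable.add)
    (IsBddMeasurable.const 0) hf

theorem IsBddMeasurable.of_compactSupport [TopologicalSpace X] [BorelSpace X] {φ : X → ℝ}
    (hφ : Continuous φ) (hc : HasCompactSupport φ) : IsBddMeasurable fun x => (φ x : ℂ) :=
  ⟨(Complex.continuous_ofReal.comp hφ).measurable,
    (hφ.bounded_above_of_compact_support hc).imp fun C h x => by
      rw [Complex.norm_real]; exact h x⟩

/-- Induction principle for bounded measurable functions. -/
theorem IsBddMeasurable.induction {P : (X → ℂ) → Prop}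
    (indicator : ∀ (c : ℂ) (A : Set X), MeasurableSet A → P (A.indicator fun _ => c))
    (add : ∀ f g, IsBddMeasurable f → IsBddMeasurable g → P f → P g → P (f + g))
    (lim : ∀ (F : ℕ → X → ℂ) (f : X → ℂ) (C : ℝ), (∀ m, Measurable (F m)) → (∀ m x, ‖F m x‖ ≤ C) →
      (∀ x, Tendsto (fun m => F m x) atTop (𝓝 (f x))) → (∀ m, P (F m)) → P f)
    {f : X → ℂ} (hf : IsBddMeasurable f) : P f := by
  classical
  have hs : ∀ F : SimpleFunc X ℂ, P F := by
    intro F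
    induction F using SimpleFunc.induction with
    | const c hs =>
      rw [SimpleFunc.coe_piecewise, SimpleFunc.coe_const, SimpleFunc.coe_const,
        Function.const_zero, Set.piecewise_eq_indicator]
      exact indicator c _ hs
    | add hd hf hg =>
      rename_i f g
      rw [SimpleFunc.coe_add]
      exact add _ _ ⟨f.measurable, f.exists_forall_norm_le⟩ ⟨g.measurable, g.exists_forall_norm_le⟩
        hf hg
  obtain ⟨hm, C, hC⟩ := hf
  have hsm := hm.stronglyMeasurable
  exact lim (fun m => hsm.approxBounded (max C 0) m) f (max C 0)
    (fun m => (hsm.approxBounded (max C 0) m).measurable)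
    (fun m x => hsm.norm_approxBounded_le (le_max_right _ _) m x)
    (fun x => hsm.tendsto_approxBounded_of_norm_le ((hC x).trans (le_max_left _ _)))
    fun m => hs _

/-- Linear functionals on the bounded measurable functions that are continuous along bounded
pointwise convergent sequences. -/
structure IsNormalFunctional (Λ : (X → ℂ) → ℂ) : Prop where
  add : ∀ f g, IsBddMeasurable f → IsBddMeasurable g → Λ (f + g) = Λ f + Λ g
  smul : ∀ (c : ℂ) f, IsBddMeasurable f → Λ (c • f) = c * Λ f
  tendsto : ∀ (F : ℕ → X → ℂ) (f : X → ℂ) (C : ℝ), (∀ m, Measurable (F m)) →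
    (∀ m x, ‖F m x‖ ≤ C) → (∀ x, Tendsto (fun m => F m x) atTop (𝓝 (f x))) →
    Tendsto (fun m => Λ (F m)) atTop (𝓝 (Λ f))

theorem isBddMeasurable_of_tendsto {F : ℕ → X → ℂ} {f : X → ℂ} {C : ℝ}
    (hF : ∀ m, Measurable (F m)) (hC : ∀ m x, ‖F m x‖ ≤ C)
    (hf : ∀ x, Tendsto (fun m => F m x) atTop (𝓝 (f x))) : IsBddMeasurable f :=
  ⟨measurable_of_tendsto_metrizable hF (tendsto_pi_nhds.2 hf), C, fun x =>
    le_of_tendsto (hf x).norm (Eventually.of_forall fun m => hC m x)⟩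

theorem indicator_const_eq_smul (A : Set X) (c : ℂ) :
    (A.indicator fun _ => c) = c • A.indicator (fun _ => (1 : ℂ)) := by
  ext x
  by_cases hx : x ∈ A <;> simp [hx]

namespace IsNormalFunctional

variable {Λ Λ' : (X → ℂ) → ℂ}

theorem zero' (hΛ : IsNormalFunctional Λ) : Λ 0 = 0 := by
  simpa using hΛ.smul 0 0 (IsBddMeasurable.const 0)

theorem ext_indicator (hΛ : IsNormalFunctional Λ) (hΛ' : IsNormalFunctional Λ')
    (h : ∀ A : Set X, MeasurableSet A →
      Λ (A.indicator fun _ => 1) = Λ' (A.indicator fun _ => 1))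
    {f : X → ℂ} (hf : IsBddMeasurable f) : Λ f = Λ' f := by
  refine hf.induction (P := fun f => Λ f = Λ' f) (fun c A hA => ?_) (fun f g hf hg h1 h2 => ?_)
    fun F f C hF hC hf h1 => ?_
  · rw [indicator_const_eq_smul, hΛ.smul _ _ (.indicator_const hA 1),
      hΛ'.smul _ _ (.indicator_const hA 1), h A hA]
  · rw [hΛ.add _ _ hf hg, hΛ'.add _ _ hf hg, h1, h2]
  · exact tendsto_nhds_unique (hΛ.tendsto F f C hF hC hf)
      (by simpa only [h1] using hΛ'.tendsto F f C hF hC hf)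

theorem fadd (hΛ : IsNormalFunctional Λ) (hΛ' : IsNormalFunctional Λ') :
    IsNormalFunctional fun f => Λ f + Λ' f where
  add f g hf hg := by rw [hΛ.add f g hf hg, hΛ'.add f g hf hg]; ring
  smul c f hf := by rw [hΛ.smul c f hf, hΛ'.smul c f hf]; ring
  tendsto F f C hF hC hf := (hΛ.tendsto F f C hF hC hf).add (hΛ'.tendsto F f C hF hC hf)

theorem const_mul (hΛ : IsNormalFunctional Λ) (a : ℂ) : IsNormalFunctional fun f => a * Λ f where
  add f g hf hg := by rw [hΛ.add f g hf hg]; ring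
  smul c f hf := by rw [hΛ.smul c f hf]; ring
  tendsto F f C hF hC hf := (hΛ.tendsto F f C hF hC hf).const_mul a

theorem zero : IsNormalFunctional fun _ : X → ℂ => 0 where
  add _ _ _ _ := by simp
  smul _ _ _ := by simp
  tendsto _ _ _ _ _ _ := tendsto_const_nhds

theorem sum {ι : Type*} (s : Finset ι) {Λ : ι → (X → ℂ) → ℂ}
    (hΛ : ∀ i, IsNormalFunctional (Λ i)) : IsNormalFunctional fun f => ∑ i ∈ s, Λ i f := by
  classical
  induction s using Finset.induction_on with
  | empty => simpa using zero
  | insert i s hi ih =>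
    simp only [Finset.sum_insert hi]
    exact (hΛ i).fadd ih

theorem comp (hΛ : IsNormalFunctional Λ) {ψ : X → X} (hψ : Measurable ψ) :
    IsNormalFunctional fun f => Λ (f ∘ ψ) where
  add _ _ hf hg := hΛ.add _ _ (hf.comp hψ) (hg.comp hψ)
  smul _ _ hf := hΛ.smul _ _ (hf.comp hψ)
  tendsto _ _ C hF hC hf := hΛ.tendsto _ _ C (fun m => (hF m).comp hψ) (fun m _ => hC m _)
    fun _ => hf _

theorem fsum_apply (hΛ : IsNormalFunctional Λ) {ι : Type*} (s : Finset ι) {f : ι → X → ℂ}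
    (hf : ∀ i ∈ s, IsBddMeasurable (f i)) : Λ (∑ i ∈ s, f i) = ∑ i ∈ s, Λ (f i) := by
  classical
  induction s using Finset.induction_on with
  | empty => simpa using hΛ.zero'
  | insert i s hi ih =>
    rw [Finset.sum_insert hi, Finset.sum_insert hi, hΛ.add _ _ (hf i (Finset.mem_insert_self _ _))
      (.sum s fun j hj => hf j (Finset.mem_insert_of_mem hj)),
      ih fun j hj => hf j (Finset.mem_insert_of_mem hj)]

theorem hasSum_indicator (hΛ : IsNormalFunctional Λ) {A : ℕ → Set X}
    (hA : ∀ i, MeasurableSet (A i)) (hd : Pairwise (Function.onFun Disjoint A)) :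
    HasSum (fun i => Λ ((A i).indicator fun _ => 1)) (Λ ((⋃ i, A i).indicator fun _ => 1)) := by
  have h1 : ∀ s : Finset ℕ, ∑ i ∈ s, Λ ((A i).indicator fun _ => 1) =
      Λ ((⋃ i ∈ s, A i).indicator fun _ => 1) := fun s => by
    rw [← hΛ.fsum_apply _ fun i _ => .indicator_const (hA i) 1]
    congr 1
    ext x
    rw [Finset.sum_apply, Finset.indicator_biUnion_apply]
    exact fun i _ j _ hij => hd hij
  rw [HasSum, SummationFilter.unconditional_filter]
  -- The finite subsets of ℕ have a countably generated `atTop`, so continuity along sequences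
  -- yields unconditional summability.
  refine tendsto_of_seq_tendsto fun s hs => ?_
  simp only [Function.comp_def, h1]
  refine hΛ.tendsto _ _ 1 (fun m => measurable_const.indicator
    (Finset.measurableSet_biUnion _ fun i _ => hA i))
    (fun m x => (norm_indicator_le_norm_self _ _).trans (by simp)) fun x => ?_
  refine tendsto_const_nhds.congr' ?_
  by_cases hx : x ∈ ⋃ i, A i
  · obtain ⟨i, hi⟩ := Set.mem_iUnion.1 hx
    filter_upwards [hs.eventually_ge_atTop {i}] with m hm
    rw [Set.indicator_of_mem hx, Set.indicator_of_mem]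
    exact Set.mem_biUnion (Finset.mem_coe.2 (Finset.singleton_subset_iff.1 hm)) hi
  · refine Eventually.of_forall fun m => ?_
    dsimp only
    rw [Set.indicator_of_notMem hx, Set.indicator_of_notMem]
    exact fun h => hx (Set.iUnion₂_subset_iUnion _ _ h)

/-- The indicator of a closed set is a bounded pointwise limit of C_c functions: continuous outer
approximations times cutoffs from a compact exhaustion. Closed sets are a π-system generating the
Borel sets, so Dynkin's lemma applies. -/
theorem ext_compactSupport [TopologicalSpace X] [BorelSpace X] [LocallyCompactSpace X] [T2Space X]
    [SecondCountableTopology X] (hΛ : IsNormalFunctional Λ) (hΛ' : IsNormalFunctional Λ')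
    (h : ∀ φ : X → ℝ, Continuous φ → HasCompactSupport φ →
      Λ (fun x => (φ x : ℂ)) = Λ' fun x => (φ x : ℂ))
    {f : X → ℂ} (hf : IsBddMeasurable f) : Λ f = Λ' f := by
  have hclosed : ∀ s : Set X, IsClosed s →
      Λ (s.indicator fun _ => 1) = Λ' (s.indicator fun _ => 1) := by
    intro s hs
    let K := CompactExhaustion.choice X
    have hχ : ∀ m, ∃ χ : C(X, ℝ), Set.EqOn χ 1 (K m) ∧ HasCompactSupport χ ∧
        ∀ x, χ x ∈ Set.Icc (0 : ℝ) 1 := fun m => by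
      obtain ⟨χ, h1, -, h2, h3⟩ := exists_continuous_one_zero_of_isCompact (K.isCompact m)
        isClosed_empty (Set.disjoint_empty _)
      exact ⟨χ, h1, h2, h3⟩
    choose χ h1 h2 h3 using hχ
    let φ : ℕ → X → ℝ := fun m x => hs.apprSeq m x * χ m x
    have hφ : ∀ m, Continuous (φ m) := fun m => by fun_prop
    have hφc : ∀ m, HasCompactSupport (φ m) := fun m => (h2 m).mul_left
    have hb : ∀ m x, ‖((φ m x : ℝ) : ℂ)‖ ≤ 1 := fun m x => by
      rw [Complex.norm_real, Real.norm_of_nonneg (mul_nonneg (by positivity) (h3 m x).1)]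
      refine mul_le_one₀ ?_ (h3 m x).1 (h3 m x).2
      exact_mod_cast HasOuterApproxClosed.apprSeq_apply_le_one hs m x
    have hlim : ∀ x, Tendsto (fun m => ((φ m x : ℝ) : ℂ)) atTop
        (𝓝 (s.indicator (fun _ => (1 : ℂ)) x)) := fun x => by
      have h4 := (tendsto_pi_nhds.1 (HasOuterApproxClosed.tendsto_apprSeq hs)) x
      have h5 : Tendsto (fun m => (((hs.apprSeq m x : NNReal) : ℝ) : ℂ)) atTop
          (𝓝 (((s.indicator (fun _ => (1 : NNReal)) x : NNReal) : ℝ) : ℂ)) :=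
        ((Complex.continuous_ofReal.comp NNReal.continuous_coe).tendsto _).comp h4
      have h6 : (((s.indicator (fun _ => (1 : NNReal)) x : NNReal) : ℝ) : ℂ) =
          s.indicator (fun _ => (1 : ℂ)) x := by
        by_cases hx : x ∈ s <;> simp [hx]
      rw [h6] at h5
      refine h5.congr' ?_
      obtain ⟨N, hN⟩ := K.exists_mem x
      filter_upwards [eventually_ge_atTop N] with m hm
      have h7 : χ m x = 1 := h1 m (K.subset hm hN)
      simp [φ, h7]
    have hm : ∀ m, Measurable fun x => ((φ m x : ℝ) : ℂ) := fun m =>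
      (Complex.continuous_ofReal.comp (hφ m)).measurable
    refine tendsto_nhds_unique (hΛ.tendsto _ _ 1 hm hb hlim) ?_
    simp only [fun m => h (φ m) (hφ m) (hφc m)]
    exact hΛ'.tendsto _ _ 1 hm hb hlim
  have hgen : ‹MeasurableSpace X› = MeasurableSpace.generateFrom {s : Set X | IsClosed s} :=
    BorelSpace.measurable_eq.trans borel_eq_generateFrom_isClosed
  refine hΛ.ext_indicator hΛ' (fun A hA => ?_) hf
  induction A, hA using MeasurableSpace.induction_on_inter
    hgen (fun s hs t ht _ => IsClosed.inter hs ht) with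
  | empty =>
    rw [Set.indicator_empty]
    exact hΛ.zero'.trans hΛ'.zero'.symm
  | basic t ht => exact hclosed t ht
  | compl t ht ih =>
    have h1 : (tᶜ.indicator fun _ => (1 : ℂ)) =
        (Set.univ.indicator fun _ => (1 : ℂ)) + (-1 : ℂ) • t.indicator fun _ => (1 : ℂ) := by
      ext x
      by_cases hx : x ∈ t <;> simp [hx]
    have h2 := IsBddMeasurable.indicator_const ht 1
    have h3 := IsBddMeasurable.indicator_const (X := X) MeasurableSet.univ 1
    rw [h1, hΛ.add _ _ h3 (h2.smul _), hΛ'.add _ _ h3 (h2.smul _), hΛ.smul _ _ h2,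
      hΛ'.smul _ _ h2, ih, hclosed _ isClosed_univ]
  | iUnion A hd hA ih =>
    refine (hΛ.hasSum_indicator hA hd).unique ?_
    simp only [ih]
    exact hΛ'.hasSum_indicator hA hd

end IsNormalFunctional

theorem isNormalFunctional_integral (μ : Measure X) [IsFiniteMeasure μ] :
    IsNormalFunctional fun f : X → ℂ => ∫ x, f x ∂μ := by
  have hi : ∀ f : X → ℂ, IsBddMeasurable f → Integrable f μ := fun f hf => by
    obtain ⟨hf, C, hC⟩ := hf
    exact .of_bound hf.aestronglyMeasurable C (Eventually.of_forall hC)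
  refine ⟨fun f g hf hg => integral_add (hi f hf) (hi g hg), fun c f hf => integral_const_mul c f,
    fun F f C hF hC hf => ?_⟩
  exact tendsto_integral_of_dominated_convergence (fun _ => C)
    (fun m => (hF m).aestronglyMeasurable) (integrable_const C)
    (fun m => Eventually.of_forall (hC m)) (Eventually.of_forall hf)

theorem cintegral_indicator_const (ν : ComplexMeasure X) {A : Set X} (hA : MeasurableSet A)
    (c : ℂ) : cintegral (A.indicator fun _ => c) ν = c * ν A := by
  have := OperatorMeasure.isFiniteMeasure_variation ν
  exact VectorMeasure.integral_indicator_const (μ := ν) (B := ContinuousLinearMap.mul ℝ ℂ) c hA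

theorem isNormalFunctional_cintegral (ν : ComplexMeasure X) :
    IsNormalFunctional fun f : X → ℂ => cintegral f ν := by
  have := OperatorMeasure.isFiniteMeasure_variation ν
  have hi : ∀ f : X → ℂ, IsBddMeasurable f → ν.Integrable f := fun f hf => by
    obtain ⟨hf, C, hC⟩ := hf
    exact Integrable.of_bound hf.aestronglyMeasurable C (Eventually.of_forall hC)
  have hadd : ∀ f g : X → ℂ, IsBddMeasurable f → IsBddMeasurable g →
      cintegral (f + g) ν = cintegral f ν + cintegral g ν := fun f g hf hg =>
    VectorMeasure.integral_add (hi f hf) (hi g hg)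
  have hlim : ∀ (F : ℕ → X → ℂ) (f : X → ℂ) (C : ℝ), (∀ m, Measurable (F m)) →
      (∀ m x, ‖F m x‖ ≤ C) → (∀ x, Tendsto (fun m => F m x) atTop (𝓝 (f x))) →
      Tendsto (fun m => cintegral (F m) ν) atTop (𝓝 (cintegral f ν)) := fun F f C hF hC hf =>
    VectorMeasure.tendsto_integral_filter_of_norm_le_const
      (Eventually.of_forall fun m => (hF m).aestronglyMeasurable)
      ⟨C, Eventually.of_forall fun m => Eventually.of_forall (hC m)⟩ (Eventually.of_forall hf)
  refine ⟨hadd, fun c f hf => ?_, hlim⟩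
  -- `cintegral` pairs through a real bilinear map, so complex homogeneity is checked on indicators
  -- and passed to limits.
  refine hf.induction (P := fun f => cintegral (c • f) ν = c * cintegral f ν)
    (fun d A hA => ?_) (fun f g hf hg h1 h2 => ?_) fun F f C hF hC hf h1 => ?_
  · rw [cintegral_indicator_const ν hA, ← mul_assoc, ← cintegral_indicator_const ν hA]
    congr 1
    ext x
    by_cases hx : x ∈ A <;> simp [hx]
  · rw [smul_add, hadd _ _ (hf.smul c) (hg.smul c), hadd _ _ hf hg, h1, h2, mul_add]
  · refine tendsto_nhds_unique (hlim (fun m => c • F m) (c • f) (‖c‖ * C)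
      (fun m => (hF m).const_smul c) (fun m x => ?_) fun x => (hf x).const_mul c) ?_
    · rw [Pi.smul_apply, norm_smul]
      exact mul_le_mul_of_nonneg_left (hC m x) (norm_nonneg _)
    · simp only [h1]
      exact (hlim F f C hF hC hf).const_mul c

end NormalFunctional

/-! ### Construction of operator-valued measures -/

section OperatorMeasureConstruction

open scoped CompactlySupported

variable {X : Type*} [MeasurableSpace X] {H : Type*} [NormedAddCommGroup H] [InnerProductSpace ℂ H]
  [CompleteSpace H]

namespace OperatorMeasure

variable (E : OperatorMeasure X H)

theorem ext_of_measurableSet {E E' : OperatorMeasure X H}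
    (h : ∀ A, MeasurableSet A → E.toFun A = E'.toFun A) : E = E' := by
  have h1 : E.toFun = E'.toFun := funext fun A => by
    by_cases hA : MeasurableSet A
    · exact h A hA
    · rw [E.not_measurable' A hA, E'.not_measurable' A hA]
  cases E
  cases E'
  cases h1
  rfl

theorem inner_integral' {f : X → ℂ} (hf : IsBddMeasurable f) (h w : H) :
    ⟪w, integral f E h⟫_ℂ = cintegral f (E.scalar h w) := by
  obtain ⟨hf, C, hC⟩ := hf
  exact E.inner_integral hf hC h w

theorem isNormalFunctional (h w : H) : IsNormalFunctional fun f => ⟪w, integral f E h⟫_ℂ := by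
  have hn := isNormalFunctional_cintegral (E.scalar h w)
  refine ⟨fun f g hf hg => ?_, fun c f hf => ?_, fun F f C hF hC hf => ?_⟩
  · rw [E.inner_integral' hf, E.inner_integral' hg, E.inner_integral' (hf.add hg), hn.add f g hf hg]
  · rw [E.inner_integral' hf, E.inner_integral' (hf.smul c), hn.smul c f hf]
  · simp only [E.inner_integral' (isBddMeasurable_of_tendsto hF hC hf),
      fun m => E.inner_integral' (show IsBddMeasurable (F m) from ⟨hF m, C, hC m⟩)]
    exact hn.tendsto F f C hF hC hf

theorem integral_indicator {A : Set X} (hA : MeasurableSet A) :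
    integral (A.indicator fun _ => 1) E = E.toFun A := by
  refine ContinuousLinearMap.ext fun h => ext_inner_left ℂ fun w => ?_
  rw [E.inner_integral' (.indicator_const hA 1), cintegral_indicator_const _ hA, one_mul]
  rfl

theorem integral_smul {f : X → ℂ} (hf : IsBddMeasurable f) (c : ℂ) :
    integral (c • f) E = c • integral f E := by
  refine ContinuousLinearMap.ext fun h => ext_inner_left ℂ fun w => ?_
  rw [smul_apply, inner_smul_right]
  exact (E.isNormalFunctional h w).smul c f hf

/-- Two operator-valued measures with the same integrals of real functions in `C_c(X)` agree. -/
theorem ext_of_compactSupport [TopologicalSpace X] [BorelSpace X] [LocallyCompactSpace X]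
    [T2Space X] [SecondCountableTopology X] {E E' : OperatorMeasure X H}
    (h : ∀ φ : X → ℝ, Continuous φ → HasCompactSupport φ →
      integral (fun x => (φ x : ℂ)) E = integral (fun x => (φ x : ℂ)) E') : E = E' := by
  refine ext_of_measurableSet fun A hA => ContinuousLinearMap.ext fun u =>
    ext_inner_left ℂ fun w => ?_
  rw [← E.integral_indicator hA, ← E'.integral_indicator hA]
  exact (E.isNormalFunctional u w).ext_compactSupport (E'.isNormalFunctional u w)
    (fun φ h1 h2 => by rw [h φ h1 h2]) (.indicator_const hA 1)

/-- Finite linear combinations of operator-valued measures. -/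
noncomputable def linearComb {ι : Type*} (s : Finset ι) (c : ι → ℂ)
    (E : ι → OperatorMeasure X H) : OperatorMeasure X H where
  toFun A := ∑ i ∈ s, c i • (E i).toFun A
  not_measurable' A hA := Finset.sum_eq_zero fun i _ => by
    rw [(E i).not_measurable' A hA, smul_zero]
  empty' := Finset.sum_eq_zero fun i _ => by rw [(E i).empty', smul_zero]
  hasSum_iUnion' A hA hd h w := by
    simp only [sum_apply, smul_apply, inner_sum,
      inner_smul_right]
    exact hasSum_sum fun i _ => ((E i).hasSum_iUnion' A hA hd h w).mul_left _

theorem integral_linearComb {ι : Type*} (s : Finset ι) (c : ι → ℂ)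
    (E : ι → OperatorMeasure X H) {f : X → ℂ} (hf : IsBddMeasurable f) :
    integral f (linearComb s c E) = ∑ i ∈ s, c i • integral f (E i) := by
  refine ContinuousLinearMap.ext fun h => ext_inner_left ℂ fun w => ?_
  simp only [sum_apply, smul_apply, inner_sum,
    inner_smul_right]
  refine ((linearComb s c E).isNormalFunctional h w).ext_indicator
    (.sum s fun i => ((E i).isNormalFunctional h w).const_mul (c i)) (fun A hA => ?_) hf
  simp only [integral_indicator _ hA, linearComb, sum_apply,
    smul_apply, inner_sum, inner_smul_right]

/-- A family of normal functionals, sesquilinear in the parameters and locally bounded, is given by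
an operator-valued measure. -/
theorem exists_of_sesquilinear (Λ : H → H → (X → ℂ) → ℂ) (hΛ : ∀ h w, IsNormalFunctional (Λ h w))
    (add_left : ∀ h₁ h₂ w f, IsBddMeasurable f → Λ (h₁ + h₂) w f = Λ h₁ w f + Λ h₂ w f)
    (smul_left : ∀ c h w f, IsBddMeasurable f → Λ (c • h) w f = c * Λ h w f)
    (add_right : ∀ h w₁ w₂ f, IsBddMeasurable f → Λ h (w₁ + w₂) f = Λ h w₁ f + Λ h w₂ f)
    (smul_right : ∀ c h w f, IsBddMeasurable f → Λ h (c • w) f = starRingEnd ℂ c * Λ h w f)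
    {C : ℝ} (bound : ∀ h w A, MeasurableSet A →
      ‖Λ h w (A.indicator fun _ => 1)‖ ≤ C * (‖h‖ + ‖w‖) ^ 2) :
    ∃ E : OperatorMeasure X H, ∀ h w f, IsBddMeasurable f → ⟪w, integral f E h⟫_ℂ = Λ h w f := by
  classical
  have hS : ∀ A : Set X, ∃ S : H →L[ℂ] H, (MeasurableSet A → ∀ h w,
      ⟪w, S h⟫_ℂ = Λ h w (A.indicator fun _ => 1)) ∧ (¬ MeasurableSet A → S = 0) := by
    intro A
    by_cases hA : MeasurableSet A
    swap
    · exact ⟨0, fun h => absurd h hA, fun _ => rfl⟩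
    have hb := IsBddMeasurable.indicator_const hA 1
    let B : H →L⋆[ℂ] H →L[ℂ] ℂ := LinearMap.mkContinuous₂
      (LinearMap.mk₂'ₛₗ (starRingEnd ℂ) (RingHom.id ℂ)
        (fun w h => Λ h w (A.indicator fun _ => 1))
        (fun w₁ w₂ h => add_right h w₁ w₂ _ hb) (fun c w h => smul_right c h w _ hb)
        (fun w h₁ h₂ => add_left h₁ h₂ w _ hb) (fun c w h => smul_left c h w _ hb))
      -- On unit vectors the bound reads C (1 + 1)², and sesquilinearity scales it to all vectors.
      (C * 4) (fun w h => by
        change ‖Λ h w (A.indicator fun _ => 1)‖ ≤ _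
        by_cases hh : ‖h‖ = 0
        · rw [norm_eq_zero.1 hh, ← zero_smul ℂ (0 : H), smul_left _ _ _ _ hb]
          simp
        by_cases hw : ‖w‖ = 0
        · rw [norm_eq_zero.1 hw, ← zero_smul ℂ (0 : H), smul_right _ _ _ _ hb]
          simp
        have hunit : ∀ v : H, ‖v‖ ≠ 0 → ‖(((‖v‖ : ℝ) : ℂ)⁻¹) • v‖ = 1 := fun v hv => by
          rw [norm_smul, norm_inv, Complex.norm_real, norm_norm, inv_mul_cancel₀ hv]
        have hscale : ∀ v : H, ‖v‖ ≠ 0 → ((‖v‖ : ℝ) : ℂ) • (((‖v‖ : ℝ) : ℂ)⁻¹) • v = v :=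
          fun v hv => smul_inv_smul₀ (by exact_mod_cast hv) v
        have h1 := bound _ _ A hA |>.trans_eq
          (show C * (‖(((‖h‖ : ℝ) : ℂ)⁻¹) • h‖ + ‖(((‖w‖ : ℝ) : ℂ)⁻¹) • w‖) ^ 2 = C * 4 by
            rw [hunit h hh, hunit w hw]; norm_num)
        conv_lhs => rw [← hscale h hh, ← hscale w hw]
        rw [smul_left _ _ _ _ hb, smul_right _ _ _ _ hb, norm_mul, norm_mul, RCLike.norm_conj,
          Complex.norm_real, Complex.norm_real, norm_norm, norm_norm]
        calc ‖h‖ * (‖w‖ * _) ≤ ‖h‖ * (‖w‖ * (C * 4)) := by gcongr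
          _ = C * 4 * ‖w‖ * ‖h‖ := by ring)
    refine ⟨(InnerProductSpace.continuousLinearMapOfBilin B).adjoint, fun _ h w => ?_,
      fun h => absurd hA h⟩
    rw [ContinuousLinearMap.adjoint_inner_right,
      InnerProductSpace.continuousLinearMapOfBilin_apply]
    rfl
  choose S hS hS0 using hS
  refine ⟨⟨S, hS0, ?_, fun A hA hd h w => ?_⟩, fun h w f hf => ?_⟩
  · refine ContinuousLinearMap.ext fun h => ext_inner_left ℂ fun w => ?_
    rw [hS _ MeasurableSet.empty, Set.indicator_empty]
    simpa [Pi.zero_def] using (hΛ h w).zero'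
  · simp only [fun i => hS (A i) (hA i), hS _ (MeasurableSet.iUnion hA)]
    exact (hΛ h w).hasSum_indicator hA hd
  · refine (isNormalFunctional _ h w).ext_indicator (hΛ h w) (fun A hA => ?_) hf
    rw [integral_indicator _ hA, ← hS A hA]

variable [TopologicalSpace X] [BorelSpace X] [LocallyCompactSpace X] [T2Space X]
  [SecondCountableTopology X]

/-- A positive functional on `C_c(X, ℝ)` bounded by `C` on functions with values in `[0, 1]` is
given by a measure of total mass at most `C`. -/
theorem exists_measure_of_positive (L : C_c(X, ℝ) →ₗ[ℝ] ℝ) (hL : ∀ φ, 0 ≤ φ → 0 ≤ L φ) {C : ℝ}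
    (hC : ∀ φ : C_c(X, ℝ), (∀ x, 0 ≤ φ x ∧ φ x ≤ 1) → L φ ≤ C) :
    ∃ μ : Measure X, μ Set.univ ≤ ENNReal.ofReal C ∧ ∀ φ : C_c(X, ℝ), ∫ x, φ x ∂μ = L φ := by
  refine ⟨RealRMK.rieszMeasure (PositiveLinearMap.mk₀ L hL), ?_, fun φ =>
    RealRMK.integral_rieszMeasure _ φ⟩
  -- Each compact set of the exhaustion is dominated by a cutoff χ with L χ ≤ C, so the total mass
  -- is at most C.
  let K := CompactExhaustion.choice X
  have hmono : Monotone fun m => K m := monotone_nat_of_le_succ fun m => K.subset_succ m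
  rw [← K.iUnion_eq, hmono.measure_iUnion]
  refine iSup_le fun m => ?_
  obtain ⟨χ, h1, -, h2, h3⟩ := exists_continuous_one_zero_of_isCompact (K.isCompact m)
    isClosed_empty (Set.disjoint_empty _)
  exact (RealRMK.rieszMeasure_le_of_eq_one _ (f := ⟨χ, h2⟩) (fun x => (h3 x).1) (K.isCompact m)
    fun x hx => h1 hx).trans (ENNReal.ofReal_le_ofReal (hC ⟨χ, h2⟩ h3))

/-- A positive operator-valued map on `C_c(X, ℝ)` is given by an operator-valued measure. -/
theorem exists_of_positive (Φ : C_c(X, ℝ) →ₗ[ℝ] (H →L[ℂ] H)) (hsa : ∀ φ, IsSelfAdjoint (Φ φ))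
    (hpos : ∀ φ, 0 ≤ φ → ∀ h, 0 ≤ (⟪h, Φ φ h⟫_ℂ).re) {C : ℝ}
    (hC : ∀ φ : C_c(X, ℝ), (∀ x, 0 ≤ φ x ∧ φ x ≤ 1) → ‖Φ φ‖ ≤ C) :
    ∃ E : OperatorMeasure X H, ∀ φ : C_c(X, ℝ), integral (fun x => (φ x : ℂ)) E = Φ φ := by
  have hC0 : 0 ≤ C := (norm_nonneg _).trans (hC 0 fun x => by simp)
  -- Scalar Riesz representation of the quadratic forms φ ↦ ⟨Φ(φ) h, h⟩.
  have hμ : ∀ h : H, ∃ μ : Measure X, μ Set.univ ≤ ENNReal.ofReal (C * ‖h‖ ^ 2) ∧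
      ∀ φ : C_c(X, ℝ), ∫ x, φ x ∂μ = (⟪h, Φ φ h⟫_ℂ).re := by
    intro h
    refine exists_measure_of_positive
      { toFun := fun φ => (⟪h, Φ φ h⟫_ℂ).re
        map_add' := fun φ ψ => by rw [map_add, add_apply, inner_add_right, Complex.add_re]
        map_smul' := fun c φ => by
          rw [map_smul, smul_apply, ← Complex.coe_smul, inner_smul_right, Complex.re_ofReal_mul]
          rfl }
      (fun φ hφ => hpos φ hφ h) fun φ hφ => ?_
    calc (⟪h, Φ φ h⟫_ℂ).re ≤ ‖⟪h, Φ φ h⟫_ℂ‖ := Complex.re_le_norm _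
      _ ≤ ‖h‖ * ‖Φ φ h‖ := norm_inner_le_norm _ _
      _ ≤ ‖h‖ * (C * ‖h‖) := by
        gcongr
        exact ((Φ φ).le_opNorm h).trans (by gcongr; exact hC φ hφ)
      _ = C * ‖h‖ ^ 2 := by ring
  choose μ hμ1 hμ2 using hμ
  have hfin : ∀ h, IsFiniteMeasure (μ h) := fun h => ⟨(hμ1 h).trans_lt ENNReal.ofReal_lt_top⟩
  -- The polarization identity, arranged so that Λ h w φ = ⟪w, Φ φ h⟫ for φ in C_c.
  let Λ : H → H → (X → ℂ) → ℂ := fun h w f => 4⁻¹ * (∫ x, f x ∂μ (w + h) +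
    (-1) * ∫ x, f x ∂μ (w - h) + (-Complex.I) * ∫ x, f x ∂μ (w + Complex.I • h) +
      Complex.I * ∫ x, f x ∂μ (w - Complex.I • h))
  have hI : ∀ u, IsNormalFunctional fun f => ∫ x, f x ∂μ u := fun u =>
    isNormalFunctional_integral (μ u)
  have hΛ : ∀ h w, IsNormalFunctional (Λ h w) := fun h w =>
    ((((hI _).fadd ((hI _).const_mul _)).fadd ((hI _).const_mul _)).fadd
      ((hI _).const_mul _)).const_mul _
  have hint : ∀ (φ : C_c(X, ℝ)) u, ∫ x, (φ x : ℂ) ∂μ u = ⟪Φ φ u, u⟫_ℂ := fun φ u => by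
    rw [integral_complex_ofReal, hμ2]
    have h1 : starRingEnd ℂ ⟪u, Φ φ u⟫_ℂ = ⟪u, Φ φ u⟫_ℂ := by
      rw [inner_conj_symm, ← ContinuousLinearMap.adjoint_inner_right,
        ContinuousLinearMap.isSelfAdjoint_iff'.1 (hsa φ)]
    rw [← inner_conj_symm (Φ φ u), h1]
    exact Complex.conj_eq_iff_re.1 h1
  have hΦ : ∀ (φ : C_c(X, ℝ)) h w, Λ h w (fun x => (φ x : ℂ)) = ⟪w, Φ φ h⟫_ℂ := fun φ h w => by
    have h1 := inner_map_polarization' (Φ φ : H →ₗ[ℂ] H) w h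
    simp only [ContinuousLinearMap.coe_coe] at h1
    have h2 : ⟪w, Φ φ h⟫_ℂ = ⟪Φ φ w, h⟫_ℂ := by
      rw [← ContinuousLinearMap.adjoint_inner_right,
        ContinuousLinearMap.isSelfAdjoint_iff'.1 (hsa φ)]
    rw [h2, h1]
    simp only [Λ, hint]
    ring
  -- Sesquilinearity of Λ is evident only on C_c, where it is inherited from Φ; uniqueness extends
  -- it to bounded Borel functions.
  have hext : ∀ {Λ₁ Λ₂ : (X → ℂ) → ℂ}, IsNormalFunctional Λ₁ → IsNormalFunctional Λ₂ →
      (∀ φ : C_c(X, ℝ), Λ₁ (fun x => (φ x : ℂ)) = Λ₂ fun x => (φ x : ℂ)) →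
      ∀ f, IsBddMeasurable f → Λ₁ f = Λ₂ f := fun h1 h2 h3 f hf =>
    h1.ext_compactSupport h2 (fun φ h4 h5 => h3 ⟨⟨φ, h4⟩, h5⟩) hf
  obtain ⟨E, hE⟩ := exists_of_sesquilinear Λ hΛ
    (fun h₁ h₂ w => hext (hΛ _ _) ((hΛ _ _).fadd (hΛ _ _)) fun φ => by
      rw [hΦ, hΦ, hΦ, map_add, inner_add_right])
    (fun c h w => hext (hΛ _ _) ((hΛ _ _).const_mul _) fun φ => by
      rw [hΦ, hΦ, map_smul, inner_smul_right])
    (fun h w₁ w₂ => hext (hΛ _ _) ((hΛ _ _).fadd (hΛ _ _)) fun φ => by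
      rw [hΦ, hΦ, hΦ, inner_add_left])
    (fun c h w => hext (hΛ _ _) ((hΛ _ _).const_mul _) fun φ => by
      rw [hΦ, hΦ, inner_smul_left])
    (C := C) (fun h w A hA => by
      have hb : ∀ u, ‖u‖ ≤ ‖h‖ + ‖w‖ →
          ‖∫ x, A.indicator (fun _ => (1 : ℂ)) x ∂μ u‖ ≤ C * (‖h‖ + ‖w‖) ^ 2 := fun u hu => by
        rw [integral_indicator_const _ hA, norm_smul, norm_one, mul_one,
          Real.norm_of_nonneg measureReal_nonneg]
        refine (measureReal_mono (Set.subset_univ A)).trans ?_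
        refine (ENNReal.toReal_le_of_le_ofReal (by positivity) (hμ1 u)).trans ?_
        gcongr
      have hI : ‖Complex.I • h‖ = ‖h‖ := by rw [norm_smul, Complex.norm_I, one_mul]
      have h1 := hb (w + h) ((norm_add_le _ _).trans_eq (add_comm _ _))
      have h2 := hb (w - h) ((norm_sub_le _ _).trans_eq (add_comm _ _))
      have h3 := hb (w + Complex.I • h) ((norm_add_le _ _).trans_eq (by rw [hI, add_comm]))
      have h4 := hb (w - Complex.I • h) ((norm_sub_le _ _).trans_eq (by rw [hI, add_comm]))
      have h5 := norm_add₄_le (a := ∫ x, A.indicator (fun _ => (1 : ℂ)) x ∂μ (w + h))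
        (b := (-1) * ∫ x, A.indicator (fun _ => (1 : ℂ)) x ∂μ (w - h))
        (c := (-Complex.I) * ∫ x, A.indicator (fun _ => (1 : ℂ)) x ∂μ (w + Complex.I • h))
        (d := Complex.I * ∫ x, A.indicator (fun _ => (1 : ℂ)) x ∂μ (w - Complex.I • h))
      simp only [norm_mul, norm_neg, norm_one, Complex.norm_I, one_mul] at h5
      simp only [Λ]
      rw [norm_mul, norm_inv, RCLike.norm_ofNat]
      linarith)
  refine ⟨E, fun φ => ContinuousLinearMap.ext fun h => ext_inner_left ℂ fun w => ?_⟩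
  rw [hE h w (fun x => (φ x : ℂ)) (.of_compactSupport φ.continuous φ.hasCompactSupport), hΦ]

end OperatorMeasure

end OperatorMeasureConstruction

/-! ### Averaging over the unitary group -/

section Average

open scoped Matrix.Norms.L2Operator BoundedContinuousFunction

variable {n : ℕ}

instance Matrix.unitaryGroup.instCompactSpace : CompactSpace (Matrix.unitaryGroup (Fin n) ℂ) := by
  refine isCompact_iff_compactSpace.1 (Metric.isCompact_of_isClosed_isBounded isClosed_unitary ?_)
  refine isBounded_iff_forall_norm_le.2 ⟨1, fun U hU => ?_⟩
  rcases subsingleton_or_nontrivial (Matrix (Fin n) (Fin n) ℂ) with h | h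
  · rw [Subsingleton.elim U 0, norm_zero]
    exact zero_le_one
  · exact (CStarRing.norm_of_mem_unitary hU).le

noncomputable instance Matrix.unitaryGroup.instMeasurableSpace :
    MeasurableSpace (Matrix.unitaryGroup (Fin n) ℂ) := borel _

instance Matrix.unitaryGroup.instBorelSpace : BorelSpace (Matrix.unitaryGroup (Fin n) ℂ) := ⟨rfl⟩

/-- The Haar probability measure on the unitary group. -/
noncomputable def unitaryHaar (n : ℕ) : Measure (Matrix.unitaryGroup (Fin n) ℂ) :=
  Measure.haarMeasure ⊤

instance : (unitaryHaar n).IsHaarMeasure := by unfold unitaryHaar; infer_instance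

instance : IsProbabilityMeasure (unitaryHaar n) :=
  ⟨by simpa [unitaryHaar] using Measure.haarMeasure_self (K₀ := (⊤ : TopologicalSpace.PositiveCompacts
    (Matrix.unitaryGroup (Fin n) ℂ)))⟩

/-- Compact groups are unimodular: a right translate is again a Haar probability measure, hence the
same one. This makes averages insensitive to twisting. -/
instance : (unitaryHaar n).IsMulRightInvariant := ⟨fun g => by
  have : IsProbabilityMeasure (Measure.map (· * g) (unitaryHaar n)) :=
    Measure.isProbabilityMeasure_map (measurable_mul_const g).aemeasurable
  exact Measure.isHaarMeasure_eq_of_isProbabilityMeasure _ _⟩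

variable {X : Type*} [MulAction (Matrix.unitaryGroup (Fin n) ℂ) X]

/-- The action of a unitary on matrix-valued functions; its fixed points are the equivariant
functions. -/
def utwist (U : Matrix.unitaryGroup (Fin n) ℂ) (F : X → Matrix (Fin n) (Fin n) ℂ) :
    X → Matrix (Fin n) (Fin n) ℂ := fun x =>
  (U : Matrix (Fin n) (Fin n) ℂ) * F (U⁻¹ • x) * star (U : Matrix (Fin n) (Fin n) ℂ)

/-- The average of a matrix-valued function over the unitary group. -/
noncomputable def uaverage (F : X → Matrix (Fin n) (Fin n) ℂ) : X → Matrix (Fin n) (Fin n) ℂ :=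
  fun x => ∫ U, utwist U F x ∂unitaryHaar n

theorem utwist_of_equivariant {F : X → Matrix (Fin n) (Fin n) ℂ}
    (hF : ∀ (U : Matrix.unitaryGroup (Fin n) ℂ) (x : X), F (U • x) =
      (U : Matrix (Fin n) (Fin n) ℂ) * F x * star (U : Matrix (Fin n) (Fin n) ℂ))
    (U : Matrix.unitaryGroup (Fin n) ℂ) : utwist U F = F :=
  funext fun x => by rw [utwist, ← hF, smul_inv_smul]

theorem utwist_mul (U : Matrix.unitaryGroup (Fin n) ℂ) (F G : X → Matrix (Fin n) (Fin n) ℂ) :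
    utwist U (fun x => F x * G x) = fun x => utwist U F x * utwist U G x := by
  funext x
  have h : star (U : Matrix (Fin n) (Fin n) ℂ) * (U : Matrix (Fin n) (Fin n) ℂ) = 1 :=
    Unitary.coe_star_mul_self U
  simp only [utwist, mul_assoc]
  rw [← mul_assoc (star (U : Matrix (Fin n) (Fin n) ℂ)) (U : Matrix (Fin n) (Fin n) ℂ), h, one_mul]

theorem utwist_utwist (U V : Matrix.unitaryGroup (Fin n) ℂ)
    (F : X → Matrix (Fin n) (Fin n) ℂ) : utwist U (utwist V F) = utwist (U * V) F := by
  funext x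
  simp only [utwist, mul_inv_rev, mul_smul, Submonoid.coe_mul, star_mul, mul_assoc]

theorem utwist_smul_apply (U V : Matrix.unitaryGroup (Fin n) ℂ)
    (F : X → Matrix (Fin n) (Fin n) ℂ) (x : X) : utwist (V * U) F (V • x) =
      (V : Matrix (Fin n) (Fin n) ℂ) * utwist U F x * star (V : Matrix (Fin n) (Fin n) ℂ) := by
  simp only [utwist, mul_inv_rev, mul_smul, inv_smul_smul, Submonoid.coe_mul, star_mul,
    mul_assoc]

theorem norm_utwist (U : Matrix.unitaryGroup (Fin n) ℂ) (F : X → Matrix (Fin n) (Fin n) ℂ)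
    (x : X) : ‖utwist U F x‖ = ‖F (U⁻¹ • x)‖ := norm_conj_unitary U.2 _

theorem uaverage_utwist (V : Matrix.unitaryGroup (Fin n) ℂ) (F : X → Matrix (Fin n) (Fin n) ℂ) :
    uaverage (utwist V F) = uaverage F := by
  funext x
  simp only [uaverage, utwist_utwist]
  exact integral_mul_right_eq_self (fun U => utwist U F x) V

theorem uaverage_of_equivariant {F : X → Matrix (Fin n) (Fin n) ℂ}
    (hF : ∀ (U : Matrix.unitaryGroup (Fin n) ℂ) (x : X), F (U • x) =
      (U : Matrix (Fin n) (Fin n) ℂ) * F x * star (U : Matrix (Fin n) (Fin n) ℂ)) :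
    uaverage F = F := by
  funext x
  simp [uaverage, utwist_of_equivariant hF]

theorem uaverage_smul (c : ℂ) (F : X → Matrix (Fin n) (Fin n) ℂ) :
    uaverage (c • F) = c • uaverage F := by
  funext x
  simp only [uaverage, Pi.smul_apply, ← integral_smul]
  congr 1
  funext U
  simp [utwist]

theorem uaverage_conjTranspose (F : X → Matrix (Fin n) (Fin n) ℂ) :
    uaverage (fun x => star (F x)) = fun x => star (uaverage F x) := by
  funext x
  have h1 := (starL' ℝ : Matrix (Fin n) (Fin n) ℂ ≃L[ℝ] _).integral_comp_comm
    (μ := unitaryHaar n) fun U => utwist U F x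
  simp only [starL'_apply] at h1
  rw [uaverage, uaverage, ← h1]
  congr 1
  funext U
  simp [utwist, mul_assoc]

variable [TopologicalSpace X] [ContinuousSMul (Matrix.unitaryGroup (Fin n) ℂ) X]

theorem continuous_utwist_uncurry {F : X → Matrix (Fin n) (Fin n) ℂ} (hF : Continuous F) :
    Continuous fun p : Matrix.unitaryGroup (Fin n) ℂ × X => utwist p.1 F p.2 := by
  have h1 : Continuous fun p : Matrix.unitaryGroup (Fin n) ℂ × X =>
      (p.1 : Matrix (Fin n) (Fin n) ℂ) := continuous_subtype_val.comp continuous_fst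
  exact (h1.mul (hF.comp (continuous_fst.inv.smul continuous_snd))).mul h1.star

theorem continuous_utwist {F : X → Matrix (Fin n) (Fin n) ℂ} (hF : Continuous F)
    (U : Matrix.unitaryGroup (Fin n) ℂ) : Continuous (utwist U F) :=
  (continuous_const.mul (hF.comp (continuous_const_smul U⁻¹))).mul continuous_const

theorem integrable_utwist {F : X → Matrix (Fin n) (Fin n) ℂ} (hF : Continuous F) (x : X) :
    Integrable (fun U => utwist U F x) (unitaryHaar n) :=
  ((continuous_utwist_uncurry hF).comp (Continuous.prodMk_left x)).integrable_of_hasCompactSupport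
    (HasCompactSupport.of_compactSpace _)

theorem uaverage_add {F G : X → Matrix (Fin n) (Fin n) ℂ} (hF : Continuous F) (hG : Continuous G) :
    uaverage (F + G) = uaverage F + uaverage G := by
  funext x
  rw [Pi.add_apply, uaverage, uaverage, uaverage,
    ← integral_add (integrable_utwist hF x) (integrable_utwist hG x)]
  congr 1
  funext U
  simp [utwist, mul_add, add_mul]

theorem uaverage_smul_apply {F : X → Matrix (Fin n) (Fin n) ℂ} (hF : Continuous F)
    (V : Matrix.unitaryGroup (Fin n) ℂ) (x : X) : uaverage F (V • x) =
      (V : Matrix (Fin n) (Fin n) ℂ) * uaverage F x * star (V : Matrix (Fin n) (Fin n) ℂ) := by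
  rw [uaverage, ← integral_mul_left_eq_self _ V]
  simp only [utwist_smul_apply]
  rw [integral_mul_const_of_integrable ((integrable_utwist hF x).const_mul _),
    integral_const_mul_of_integrable (integrable_utwist hF x)]
  rfl

/-- Averaging behaves like a conditional expectation: equivariant factors are fixed by twists and
come out of the integral. -/
theorem uaverage_mul {F G : X → Matrix (Fin n) (Fin n) ℂ} (hF : Continuous F)
    (hG : ∀ (U : Matrix.unitaryGroup (Fin n) ℂ) (x : X), G (U • x) =
      (U : Matrix (Fin n) (Fin n) ℂ) * G x * star (U : Matrix (Fin n) (Fin n) ℂ)) :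
    uaverage (fun x => G x * F x) = fun x => G x * uaverage F x := by
  funext x
  simp only [uaverage, utwist_mul, utwist_of_equivariant hG]
  exact integral_const_mul_of_integrable (integrable_utwist hF x)

/-- The twist of a compactly supported continuous function, in the Banach space of bounded
continuous functions. -/
noncomputable def utwistBCF {F : X → Matrix (Fin n) (Fin n) ℂ} (hF : Continuous F)
    (hc : HasCompactSupport F) (U : Matrix.unitaryGroup (Fin n) ℂ) :
    X →ᵇ Matrix (Fin n) (Fin n) ℂ :=
  BoundedContinuousFunction.ofNormedAddCommGroup (utwist U F) (continuous_utwist hF U)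
    (hF.bounded_above_of_compact_support hc).choose fun x => by
      rw [norm_utwist]
      exact (hF.bounded_above_of_compact_support hc).choose_spec _

theorem utwistBCF_apply {F : X → Matrix (Fin n) (Fin n) ℂ} (hF : Continuous F)
    (hc : HasCompactSupport F) (U : Matrix.unitaryGroup (Fin n) ℂ) (x : X) :
    utwistBCF hF hc U x = utwist U F x := rfl

/-- The saturation of the support of a function. -/
def saturatedSupport (F : X → Matrix (Fin n) (Fin n) ℂ) : Set X :=
  (fun p : Matrix.unitaryGroup (Fin n) ℂ × X => p.1 • p.2) '' (Set.univ ×ˢ tsupport F)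

theorem isCompact_saturatedSupport {F : X → Matrix (Fin n) (Fin n) ℂ} (hc : HasCompactSupport F) :
    IsCompact (saturatedSupport F) :=
  (isCompact_univ.prod hc).image continuous_smul

theorem utwist_eq_zero {F : X → Matrix (Fin n) (Fin n) ℂ} {x : X} (hx : x ∉ saturatedSupport F)
    (U : Matrix.unitaryGroup (Fin n) ℂ) : utwist U F x = 0 := by
  have h1 : F (U⁻¹ • x) = 0 := by
    by_contra h
    exact hx ⟨(U, U⁻¹ • x), ⟨Set.mem_univ _, subset_tsupport F h⟩, smul_inv_smul U x⟩
  rw [utwist, h1, mul_zero, zero_mul]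

/-- All twists of F live on one compact saturated set, so joint continuity is uniform in x. The
average is thus a Bochner integral in sup norm, through which bounded functionals pass. -/
theorem continuous_utwistBCF {F : X → Matrix (Fin n) (Fin n) ℂ} (hF : Continuous F)
    (hc : HasCompactSupport F) : Continuous (utwistBCF hF hc) := by
  refine continuous_iff_continuousAt.2 fun U => Metric.tendsto_nhds.2 fun ε hε => ?_
  obtain ⟨v, hv, h⟩ := (isCompact_saturatedSupport hc).mem_uniformity_of_prod
    (f := fun U x => utwist U F x) (by
      simp only [Function.uncurry_def]
      exact (continuous_utwist_uncurry hF).continuousOn)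
    (Set.mem_univ U) (Metric.dist_mem_uniformity (half_pos hε))
  rw [nhdsWithin_univ] at hv
  filter_upwards [hv] with V hV
  refine ((BoundedContinuousFunction.dist_le (half_pos hε).le).2 fun x => ?_).trans_lt
    (half_lt_self hε)
  by_cases hx : x ∈ saturatedSupport F
  · rw [utwistBCF_apply, utwistBCF_apply]
    exact (h V hV x hx).le
  · rw [utwistBCF_apply, utwistBCF_apply, utwist_eq_zero hx, utwist_eq_zero hx, dist_self]
    exact (half_pos hε).le

theorem integrable_utwistBCF {F : X → Matrix (Fin n) (Fin n) ℂ} (hF : Continuous F)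
    (hc : HasCompactSupport F) : Integrable (utwistBCF hF hc) (unitaryHaar n) :=
  (continuous_utwistBCF hF hc).integrable_of_hasCompactSupport (HasCompactSupport.of_compactSpace _)

theorem integral_utwistBCF_apply {F : X → Matrix (Fin n) (Fin n) ℂ} (hF : Continuous F)
    (hc : HasCompactSupport F) (x : X) :
    (∫ U, utwistBCF hF hc U ∂unitaryHaar n) x = uaverage F x :=
by
  have h1 := (BoundedContinuousFunction.evalCLM ℂ x).integral_comp_comm (integrable_utwistBCF hF hc)
  simp only [BoundedContinuousFunction.evalCLM_apply, utwistBCF_apply] at h1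
  exact h1.symm

theorem continuous_uaverage {F : X → Matrix (Fin n) (Fin n) ℂ} (hF : Continuous F)
    (hc : HasCompactSupport F) : Continuous (uaverage F) := by
  rw [← funext (integral_utwistBCF_apply hF hc)]
  exact BoundedContinuousFunction.continuous _

theorem hasCompactSupport_uaverage [T2Space X] {F : X → Matrix (Fin n) (Fin n) ℂ}
    (hc : HasCompactSupport F) : HasCompactSupport (uaverage F) :=
  .intro (isCompact_saturatedSupport hc) fun x hx => by
    simp [uaverage, utwist_eq_zero hx]

theorem isC0Equivariant_uaverage [T2Space X] {F : X → Matrix (Fin n) (Fin n) ℂ} (hF : Continuous F)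
    (hc : HasCompactSupport F) : IsC0Equivariant (uaverage F) :=
  ⟨continuous_uaverage hF hc, (hasCompactSupport_uaverage hc).is_zero_at_infty,
    uaverage_smul_apply hF⟩

/-- A continuous linear functional that is invariant on the orbit of a function `F` takes the same
value at `F` and its average. -/
theorem apply_uaverage_eq (L : (X →ᵇ Matrix (Fin n) (Fin n) ℂ) →L[ℂ] ℂ)
    (ℓ : (X → Matrix (Fin n) (Fin n) ℂ) → ℂ) (hL : ∀ F, L F = ℓ F)
    {F : X → Matrix (Fin n) (Fin n) ℂ} (hF : Continuous F) (hc : HasCompactSupport F)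
    (h : ∀ U : Matrix.unitaryGroup (Fin n) ℂ, ℓ (utwist U F) = ℓ F) :
    ℓ (uaverage F) = ℓ F := by
  rw [← funext (integral_utwistBCF_apply hF hc), ← hL,
    ← L.integral_comp_comm (integrable_utwistBCF hF hc)]
  have h1 : ∀ U, L (utwistBCF hF hc U) = ℓ F := fun U => by
    rw [hL, ← h U]
    congr 1
  simp [h1]

end Average

/-! ### Integration of matrix-valued functions -/

section MatrixFunctions

open scoped Matrix.Norms.L2Operator BoundedContinuousFunction

variable {n : ℕ}

noncomputable instance Matrix.instMeasurableSpaceBorel :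
    MeasurableSpace (Matrix (Fin n) (Fin n) ℂ) := borel _

instance Matrix.instBorelSpace : BorelSpace (Matrix (Fin n) (Fin n) ℂ) := ⟨rfl⟩

theorem Matrix.exists_norm_entry_le (n : ℕ) :
    ∃ K : ℝ, 0 ≤ K ∧ ∀ (A : Matrix (Fin n) (Fin n) ℂ) (i j : Fin n), ‖A i j‖ ≤ K * ‖A‖ := by
  let e : Fin n → Fin n → (Matrix (Fin n) (Fin n) ℂ →L[ℂ] ℂ) := fun i j =>
    LinearMap.toContinuousLinearMap (Matrix.entryLinearMap ℂ ℂ i j)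
  refine ⟨∑ i, ∑ j, ‖e i j‖, by positivity, fun A i j => ((e i j).le_opNorm A).trans ?_⟩
  gcongr
  exact (Finset.single_le_sum (f := fun j => ‖e i j‖) (fun _ _ => norm_nonneg _)
    (Finset.mem_univ j)).trans (Finset.single_le_sum (f := fun i => ∑ j, ‖e i j‖)
    (fun _ _ => by positivity) (Finset.mem_univ i))

variable {X : Type*} [MeasurableSpace X]

/-- Bounded Borel matrix-valued functions. -/
def IsBddMat (F : X → Matrix (Fin n) (Fin n) ℂ) : Prop := Measurable F ∧ ∃ C : ℝ, ∀ x, ‖F x‖ ≤ C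

namespace IsBddMat

variable {F G : X → Matrix (Fin n) (Fin n) ℂ}

theorem const (A : Matrix (Fin n) (Fin n) ℂ) : IsBddMat fun _ : X => A :=
  ⟨measurable_const, ‖A‖, fun _ => le_rfl⟩

theorem add (hF : IsBddMat F) (hG : IsBddMat G) : IsBddMat (F + G) := by
  obtain ⟨hF, C, hC⟩ := hF
  obtain ⟨hG, D, hD⟩ := hG
  exact ⟨hF.add hG, C + D, fun x => (norm_add_le _ _).trans (add_le_add (hC x) (hD x))⟩

theorem mul (hF : IsBddMat F) (hG : IsBddMat G) : IsBddMat fun x => F x * G x := by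
  obtain ⟨hF, C, hC⟩ := hF
  obtain ⟨hG, D, hD⟩ := hG
  refine ⟨hF.mul hG, C * D, fun x => (norm_mul_le _ _).trans ?_⟩
  exact mul_le_mul (hC x) (hD x) (norm_nonneg _) ((norm_nonneg _).trans (hC x))

theorem star (hF : IsBddMat F) : IsBddMat fun x => star (F x) :=
  ⟨continuous_star.measurable.comp hF.1, hF.2.imp fun _ h x => (norm_star _).trans_le (h x)⟩

theorem smul {φ : X → ℂ} (hφ : IsBddMeasurable φ) (hF : IsBddMat F) :
    IsBddMat fun x => φ x • F x := by
  obtain ⟨hφ, C, hC⟩ := hφ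
  obtain ⟨hF, D, hD⟩ := hF
  refine ⟨hφ.smul hF, C * D, fun x => (norm_smul_le _ _).trans ?_⟩
  exact mul_le_mul (hC x) (hD x) (norm_nonneg _) ((norm_nonneg _).trans (hC x))

theorem const_smul (hF : IsBddMat F) (c : ℂ) : IsBddMat (c • F) :=
  smul (.const c) hF

theorem entry (hF : IsBddMat F) (i j : Fin n) : IsBddMeasurable fun x => F x i j := by
  obtain ⟨hF, C, hC⟩ := hF
  obtain ⟨K, hK, h⟩ := Matrix.exists_norm_entry_le n
  refine ⟨(continuous_id.matrix_elem i j).measurable.comp hF, K * C, fun x => (h _ i j).trans ?_⟩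
  gcongr
  exact hC x

theorem sum {ι : Type*} (s : Finset ι) {F : ι → X → Matrix (Fin n) (Fin n) ℂ}
    (hF : ∀ i ∈ s, IsBddMat (F i)) : IsBddMat (∑ i ∈ s, F i) :=
  Finset.sum_induction F IsBddMat (fun _ _ => add) (const 0) hF

theorem of_continuous [TopologicalSpace X] [BorelSpace X] (hF : Continuous F)
    {C : ℝ} (hC : ∀ x, ‖F x‖ ≤ C) : IsBddMat F :=
  ⟨hF.measurable, C, hC⟩

theorem of_compactSupport [TopologicalSpace X] [BorelSpace X] (hF : Continuous F)
    (hc : HasCompactSupport F) : IsBddMat F :=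
  ⟨hF.measurable, hF.bounded_above_of_compact_support hc⟩

end IsBddMat

theorem mem_BorelCStar_iff [MulAction (Matrix.unitaryGroup (Fin n) ℂ) X]
    {F : X → Matrix (Fin n) (Fin n) ℂ} : F ∈ BorelCStar n X ↔ IsBddMat F ∧
      ∀ (U : Matrix.unitaryGroup (Fin n) ℂ) (x : X), F (U • x) =
        (U : Matrix (Fin n) (Fin n) ℂ) * F x * star (U : Matrix (Fin n) (Fin n) ℂ) :=
  and_assoc.symm

/-- Linear functionals on the bounded Borel matrix-valued functions that are continuous along
bounded pointwise convergent sequences. -/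
structure IsNormalMatFunctional (Ψ : (X → Matrix (Fin n) (Fin n) ℂ) → ℂ) : Prop where
  add : ∀ F G, IsBddMat F → IsBddMat G → Ψ (F + G) = Ψ F + Ψ G
  smul : ∀ (c : ℂ) F, IsBddMat F → Ψ (c • F) = c * Ψ F
  tendsto : ∀ (F : ℕ → X → Matrix (Fin n) (Fin n) ℂ) (F₀ : X → Matrix (Fin n) (Fin n) ℂ) (C : ℝ),
    (∀ m, Measurable (F m)) → (∀ m x, ‖F m x‖ ≤ C) →
    (∀ x, Tendsto (fun m => F m x) atTop (𝓝 (F₀ x))) →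
    Tendsto (fun m => Ψ (F m)) atTop (𝓝 (Ψ F₀))

theorem isBddMat_of_tendsto {F : ℕ → X → Matrix (Fin n) (Fin n) ℂ}
    {F₀ : X → Matrix (Fin n) (Fin n) ℂ} {C : ℝ}
    (hF : ∀ m, Measurable (F m)) (hC : ∀ m x, ‖F m x‖ ≤ C)
    (hf : ∀ x, Tendsto (fun m => F m x) atTop (𝓝 (F₀ x))) : IsBddMat F₀ :=
  ⟨measurable_of_tendsto_metrizable hF (tendsto_pi_nhds.2 hf), C, fun x =>
    le_of_tendsto (hf x).norm (Eventually.of_forall fun m => hC m x)⟩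

namespace IsNormalMatFunctional

variable {Ψ Ψ' : (X → Matrix (Fin n) (Fin n) ℂ) → ℂ}

theorem mul_left (hΨ : IsNormalMatFunctional Ψ) {A : X → Matrix (Fin n) (Fin n) ℂ}
    (hA : IsBddMat A) : IsNormalMatFunctional fun F => Ψ fun x => A x * F x where
  add F G hF hG := by
    rw [← hΨ.add _ _ (hA.mul hF) (hA.mul hG)]
    congr 1
    funext x
    simp [mul_add]
  smul c F hF := by
    rw [← hΨ.smul _ _ (hA.mul hF)]
    congr 1
    funext x
    simp
  tendsto F F₀ C hF hC hf := by
    obtain ⟨hA, D, hD⟩ := hA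
    refine hΨ.tendsto _ _ (D * C) (fun m => hA.mul (hF m)) (fun m x => (norm_mul_le _ _).trans ?_)
      fun x => (hf x).const_mul _
    exact mul_le_mul (hD x) (hC m x) (norm_nonneg _) ((norm_nonneg _).trans (hD x))

/-- The two conjugations cancel, so linearity survives; the adjoint rule compares functionals of
this form. -/
theorem conj (hΨ : IsNormalMatFunctional Ψ) :
    IsNormalMatFunctional fun F => star (Ψ fun x => star (F x)) where
  add F G hF hG := by
    rw [← star_add, ← hΨ.add _ _ hF.star hG.star]
    congr 2
    funext x
    simp
  smul c F hF := by
    have := hΨ.smul (star c) _ hF.star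
    rw [show c * star (Ψ fun x => star (F x)) = star (star c * Ψ fun x => star (F x)) by
      simp, ← this]
    congr 2
    funext x
    simp
  tendsto F F₀ C hF hC hf := (hΨ.tendsto _ _ C (fun m => continuous_star.measurable.comp (hF m))
    (fun m x => (norm_star _).trans_le (hC m x)) (fun x => (hf x).star)).star

theorem isNormalFunctional (hΨ : IsNormalMatFunctional Ψ) (B : Matrix (Fin n) (Fin n) ℂ) :
    IsNormalFunctional fun φ => Ψ fun x => φ x • B where
  add φ ψ hφ hψ := by
    rw [← hΨ.add _ _ (.smul hφ (.const B)) (.smul hψ (.const B))]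
    congr 1
    funext x
    simp [add_smul]
  smul c φ hφ := by
    rw [← hΨ.smul _ _ (.smul hφ (.const B))]
    congr 1
    funext x
    simp [mul_smul]
  tendsto F f C hF hC hf := hΨ.tendsto _ _ (C * ‖B‖) (fun m => (hF m).smul_const B)
    (fun m x => by rw [norm_smul]; gcongr; exact hC m x) fun x => (hf x).smul_const B

theorem map_sum (hΨ : IsNormalMatFunctional Ψ) {ι : Type*} (s : Finset ι)
    {F : ι → X → Matrix (Fin n) (Fin n) ℂ} (hF : ∀ i, IsBddMat (F i)) :
    Ψ (∑ i ∈ s, F i) = ∑ i ∈ s, Ψ (F i) := by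
  classical
  induction s using Finset.induction_on with
  | empty => simpa using hΨ.smul 0 0 (.const 0)
  | insert i s hi ih =>
    rw [Finset.sum_insert hi, Finset.sum_insert hi, hΨ.add _ _ (hF i) (.sum s fun j _ => hF j), ih]

theorem eq_sum (hΨ : IsNormalMatFunctional Ψ) {F : X → Matrix (Fin n) (Fin n) ℂ}
    (hF : IsBddMat F) : Ψ F = ∑ p : Fin n × Fin n,
      Ψ fun x => F x p.1 p.2 • Matrix.single p.1 p.2 (1 : ℂ) := by
  have h1 := hΨ.map_sum Finset.univ
    (F := fun (p : Fin n × Fin n) x => F x p.1 p.2 • Matrix.single p.1 p.2 (1 : ℂ))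
    fun p => .smul (hF.entry p.1 p.2) (.const _)
  rw [← h1]
  congr 1
  funext x
  conv_lhs => rw [Matrix.matrix_eq_sum_single (F x)]
  rw [Finset.sum_apply, Fintype.sum_prod_type]
  simp

/-- Normal functionals are determined by their values on the functions `φ e_{jk}` with real
`φ ∈ C_c(X)`. -/
theorem ext_compactSupport [TopologicalSpace X] [BorelSpace X] [LocallyCompactSpace X] [T2Space X]
    [SecondCountableTopology X] (hΨ : IsNormalMatFunctional Ψ) (hΨ' : IsNormalMatFunctional Ψ')
    (h : ∀ (φ : X → ℝ) (j k : Fin n), Continuous φ → HasCompactSupport φ →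
      Ψ (fun x => (φ x : ℂ) • Matrix.single j k (1 : ℂ)) =
        Ψ' fun x => (φ x : ℂ) • Matrix.single j k (1 : ℂ))
    {F : X → Matrix (Fin n) (Fin n) ℂ} (hF : IsBddMat F) : Ψ F = Ψ' F := by
  rw [hΨ.eq_sum hF, hΨ'.eq_sum hF]
  exact Finset.sum_congr rfl fun p _ => (hΨ.isNormalFunctional _).ext_compactSupport
    (hΨ'.isNormalFunctional _) (fun φ h1 h2 => h φ _ _ h1 h2) (hF.entry _ _)

/-- A norm convergent sequence is bounded and pointwise convergent, so normality gives sequential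
continuity in sup norm. -/
theorem exists_continuousLinearMap [TopologicalSpace X] [BorelSpace X]
    (hΨ : IsNormalMatFunctional Ψ) :
    ∃ L : (X →ᵇ Matrix (Fin n) (Fin n) ℂ) →L[ℂ] ℂ, ∀ F, L F = Ψ F := by
  have hb : ∀ F : X →ᵇ Matrix (Fin n) (Fin n) ℂ, IsBddMat F := fun F =>
    .of_continuous F.continuous F.norm_coe_le_norm
  refine ⟨⟨{ toFun := fun F => Ψ F
             map_add' := fun F G => hΨ.add F G (hb F) (hb G)
             map_smul' := fun c F => hΨ.smul c F (hb F) }, ?_⟩, fun _ => rfl⟩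
  refine SeqContinuous.continuous fun F F₀ hF => ?_
  obtain ⟨C, hC⟩ := isBounded_iff_forall_norm_le.1 (Metric.isBounded_range_of_tendsto F hF)
  exact hΨ.tendsto _ _ C (fun m => (F m).continuous.measurable)
    (fun m x => ((F m).norm_coe_le_norm x).trans (hC _ ⟨m, rfl⟩))
    fun x => ((BoundedContinuousFunction.evalCLM ℂ x).continuous.tendsto F₀).comp hF

end IsNormalMatFunctional

/-! ### Integration against a matrix of operator-valued measures; invariance under twists. -/

variable {H : Type*} [NormedAddCommGroup H] [InnerProductSpace ℂ H] [CompleteSpace H]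
  (E : Matrix (Fin n) (Fin n) (OperatorMeasure X H))

theorem isNormalMatFunctional_nIntegral (h w : H) :
    IsNormalMatFunctional fun F => ⟪w, nIntegral F E h⟫_ℂ := by
  simp only [nIntegral, sum_apply, inner_sum]
  have hn := fun j k => (E k j).isNormalFunctional h w
  refine ⟨fun F G hF hG => ?_, fun c F hF => ?_, fun F F₀ C hF hC hf => ?_⟩
  · simp only [← Finset.sum_add_distrib]
    exact Finset.sum_congr rfl fun j _ => Finset.sum_congr rfl fun k _ =>
      (hn j k).add _ _ (hF.entry j k) (hG.entry j k)
  · simp only [Finset.mul_sum]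
    exact Finset.sum_congr rfl fun j _ => Finset.sum_congr rfl fun k _ =>
      (hn j k).smul _ _ (hF.entry j k)
  · obtain ⟨K, hK, h⟩ := Matrix.exists_norm_entry_le n
    refine tendsto_finsetSum _ fun j _ => tendsto_finsetSum _ fun k _ =>
      (hn j k).tendsto _ _ (K * C) (fun m => (continuous_id.matrix_elem j k).measurable.comp (hF m))
        (fun m x => (h _ j k).trans (by gcongr; exact hC m x)) fun x =>
        ((continuous_id.matrix_elem j k).tendsto _).comp (hf x)

/-- Recovers the entries of E from `nIntegral`. The indices are transposed, as in a trace. -/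
theorem nIntegral_smul_single {φ : X → ℂ} (j k : Fin n) :
    nIntegral (fun x => φ x • Matrix.single j k (1 : ℂ)) E = (E k j).integral φ := by
  have h0 : ∀ E : OperatorMeasure X H, E.integral (fun _ => (0 : ℂ)) = 0 := fun E => by
    have := E.integral_smul (.const 0) 0
    simpa [Pi.zero_def] using this
  rw [nIntegral, Finset.sum_eq_single j, Finset.sum_eq_single k]
  · congr 1
    funext x
    simp
  · intro b _ hb
    convert h0 (E b j) using 2
    funext x
    simp [hb.symm]
  · simp
  · intro b _ hb
    refine Finset.sum_eq_zero fun c _ => ?_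
    convert h0 (E c b) using 2
    funext x
    simp [hb.symm]
  · simp

theorem nIntegral_smul_const {φ : X → ℂ} (hφ : IsBddMeasurable φ)
    (B : Matrix (Fin n) (Fin n) ℂ) :
    nIntegral (fun x => φ x • B) E = ∑ j, ∑ k, B j k • (E k j).integral φ := by
  refine Finset.sum_congr rfl fun j _ => Finset.sum_congr rfl fun k _ => ?_
  rw [← OperatorMeasure.integral_smul _ hφ]
  congr 1
  funext x
  simp [mul_comm]

theorem sum_comm_four {ι M : Type*} [Fintype ι] [AddCommMonoid M] (f : ι → ι → ι → ι → M) :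
    ∑ j, ∑ k, ∑ c, ∑ d, f j k c d = ∑ c, ∑ d, ∑ j, ∑ k, f j k c d := by
  rw [Finset.sum_congr rfl fun j _ => Finset.sum_comm, Finset.sum_comm]
  refine Finset.sum_congr rfl fun c _ => ?_
  rw [Finset.sum_congr rfl fun j _ => Finset.sum_comm, Finset.sum_comm]

variable [MulAction (Matrix.unitaryGroup (Fin n) ℂ) X] {E}

section Invariance

variable [TopologicalSpace X] [BorelSpace X] [ContinuousSMul (Matrix.unitaryGroup (Fin n) ℂ) X]

theorem IsBddMat.utwist {F : X → Matrix (Fin n) (Fin n) ℂ} (hF : IsBddMat F)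
    (U : Matrix.unitaryGroup (Fin n) ℂ) : IsBddMat (utwist U F) :=
  ⟨(measurable_const.mul (hF.1.comp (continuous_const_smul U⁻¹).measurable)).mul measurable_const,
    hF.2.imp fun _ h x => (norm_utwist U F x).trans_le (h _)⟩

theorem IsNormalMatFunctional.utwist {Ψ : (X → Matrix (Fin n) (Fin n) ℂ) → ℂ}
    (hΨ : IsNormalMatFunctional Ψ) (U : Matrix.unitaryGroup (Fin n) ℂ) :
    IsNormalMatFunctional fun F => Ψ (utwist U F) where
  add F G hF hG := by
    rw [← hΨ.add _ _ (hF.utwist U) (hG.utwist U)]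
    congr 1
    funext x
    simp [_root_.utwist, mul_add, add_mul]
  smul c F hF := by
    rw [← hΨ.smul _ _ (hF.utwist U)]
    congr 1
    funext x
    simp [_root_.utwist]
  tendsto F F₀ C hF hC hf := hΨ.tendsto _ _ C
    (fun m => (IsBddMat.utwist ⟨hF m, C, hC m⟩ U).1)
    (fun m x => (norm_utwist U _ x).trans_le (hC m _))
    fun x => ((hf _).const_mul _).mul_const _

/-- The defining relation of an n-measure is this identity for indicators; both sides are normal in
φ. -/
theorem IsNMeasure.integral_comp_inv_smul (hE : IsNMeasure E)
    (U : Matrix.unitaryGroup (Fin n) ℂ) (p q : Fin n) {φ : X → ℂ} (hφ : IsBddMeasurable φ) :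
    (E p q).integral (fun x => φ (U⁻¹ • x)) = ∑ j, ∑ k, ((U : Matrix (Fin n) (Fin n) ℂ) p j *
      star ((U : Matrix (Fin n) (Fin n) ℂ) q k)) • (E j k).integral φ := by
  refine ContinuousLinearMap.ext fun h => ext_inner_left ℂ fun w => ?_
  simp only [sum_apply, smul_apply, inner_sum, inner_smul_right]
  have hm : Measurable fun x : X => U⁻¹ • x := (continuous_const_smul U⁻¹).measurable
  refine (((E p q).isNormalFunctional h w).comp hm).ext_indicator
    (.sum _ fun j => .sum _ fun k => ((E j k).isNormalFunctional h w).const_mul _)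
    (fun A hA => ?_) hφ
  have h1 : (A.indicator fun _ => (1 : ℂ)) ∘ (fun x : X => U⁻¹ • x) =
      ((fun x => U • x) '' A).indicator fun _ => 1 := by
    funext x
    have h2 : x ∈ (fun x => U • x) '' A ↔ U⁻¹ • x ∈ A :=
      Set.mem_smul_set_iff_inv_smul_mem (A := A) (a := U) (x := x)
    by_cases hx : U⁻¹ • x ∈ A
    · rw [Set.indicator_of_mem (h2.2 hx), Function.comp_apply, Set.indicator_of_mem hx]
    · rw [Set.indicator_of_notMem (mt h2.1 hx), Function.comp_apply, Set.indicator_of_notMem hx]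
  have hA' : MeasurableSet ((fun x => U • x) '' A) := by
    have : (fun x : X => U • x) '' A = (fun x => U⁻¹ • x) ⁻¹' A := by
      ext x
      exact Set.mem_smul_set_iff_inv_smul_mem (A := A) (a := U) (x := x)
    rw [this]
    exact hm hA
  rw [h1, OperatorMeasure.integral_indicator _ hA', hE U A hA]
  simp only [OperatorMeasure.integral_indicator _ hA, sum_apply, smul_apply, inner_sum,
    inner_smul_right]

/-- The pairing of F with E is trace-like, so conjugating the values of F cancels the conjugation in
E(U.A) = U E(A) U⁻¹. -/
theorem IsNMeasure.nIntegral_utwist (hE : IsNMeasure E) (U : Matrix.unitaryGroup (Fin n) ℂ)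
    {F : X → Matrix (Fin n) (Fin n) ℂ} (hF : IsBddMat F) :
    nIntegral (utwist U F) E = nIntegral F E := by
  refine ContinuousLinearMap.ext fun h => ext_inner_left ℂ fun w => ?_
  have hn := isNormalMatFunctional_nIntegral E h w
  rw [hn.eq_sum hF, (hn.utwist U).eq_sum hF]
  refine Finset.sum_congr rfl fun p _ => ?_
  suffices hs : ∀ φ : X → ℂ, IsBddMeasurable φ → nIntegral (_root_.utwist U fun x => φ x •
      Matrix.single p.1 p.2 (1 : ℂ)) E = nIntegral (fun x => φ x • Matrix.single p.1 p.2 (1 : ℂ)) E by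
    rw [hs _ (hF.entry p.1 p.2)]
  intro φ hφ
  have hφ' : IsBddMeasurable fun x => φ (U⁻¹ • x) :=
    hφ.comp (continuous_const_smul U⁻¹).measurable
  let B : Matrix (Fin n) (Fin n) ℂ := (U : Matrix (Fin n) (Fin n) ℂ) *
    Matrix.single p.1 p.2 (1 : ℂ) * star (U : Matrix (Fin n) (Fin n) ℂ)
  have h1 : _root_.utwist U (fun x => φ x • Matrix.single p.1 p.2 (1 : ℂ)) =
      fun x => φ (U⁻¹ • x) • B := by
    funext x
    rw [_root_.utwist, mul_smul_comm, smul_mul_assoc]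
  have h2 : star (U : Matrix (Fin n) (Fin n) ℂ) * B * (U : Matrix (Fin n) (Fin n) ℂ) =
      Matrix.single p.1 p.2 (1 : ℂ) := by
    have h3 : star (U : Matrix (Fin n) (Fin n) ℂ) * (U : Matrix (Fin n) (Fin n) ℂ) = 1 :=
      Unitary.coe_star_mul_self U
    simp only [B, mul_assoc, h3, mul_one]
    rw [← mul_assoc, h3, one_mul]
  rw [h1, nIntegral_smul_const E hφ', ← h2, nIntegral_smul_const E hφ]
  simp only [hE.integral_comp_inv_smul U _ _ hφ, Finset.smul_sum, smul_smul]
  rw [sum_comm_four, Finset.sum_comm]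
  refine Finset.sum_congr rfl fun d _ => Finset.sum_congr rfl fun c _ => ?_
  simp only [Matrix.mul_apply, Matrix.star_apply, Finset.sum_mul, Finset.sum_smul]
  rw [Finset.sum_comm]
  refine Finset.sum_congr rfl fun k _ => Finset.sum_congr rfl fun j _ => ?_
  congr 1
  ring

/-- Averaging one factor does not change the integral. -/
theorem IsNMeasure.nIntegral_mul_uaverage (hE : IsNMeasure E)
    {f F : X → Matrix (Fin n) (Fin n) ℂ} (hf : f ∈ BorelCStar n X) (hF : Continuous F)
    (hc : HasCompactSupport F) :
    nIntegral (fun x => f x * uaverage F x) E = nIntegral (fun x => f x * F x) E := by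
  obtain ⟨hf, hfU⟩ := mem_BorelCStar_iff.1 hf
  refine ContinuousLinearMap.ext fun h => ext_inner_left ℂ fun w => ?_
  obtain ⟨L, hL⟩ := ((isNormalMatFunctional_nIntegral E h w).mul_left hf).exists_continuousLinearMap
  refine apply_uaverage_eq L (fun F => ⟪w, nIntegral (fun x => f x * F x) E h⟫_ℂ) hL hF hc
    fun U => ?_
  -- Twists fix the equivariant f, so twisting the product f F twists F alone.
  have h1 := hE.nIntegral_utwist U (hf.mul (.of_compactSupport hF hc))
  rw [utwist_mul, utwist_of_equivariant hfU] at h1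
  simp only [h1]

theorem IsNMeasure.nIntegral_uaverage (hE : IsNMeasure E)
    {F : X → Matrix (Fin n) (Fin n) ℂ} (hF : Continuous F) (hc : HasCompactSupport F) :
    nIntegral (uaverage F) E = nIntegral F E := by
  have h1 : (fun _ => 1 : X → Matrix (Fin n) (Fin n) ℂ) ∈ BorelCStar n X :=
    mem_BorelCStar_iff.2 ⟨.const 1, fun U _ => by
      rw [mul_one]; exact (Unitary.coe_mul_star_self U).symm⟩
  simpa using hE.nIntegral_mul_uaverage h1 hF hc

end Invariance

end MatrixFunctions

/-! ### The functional calculus on compactly supported functions -/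

section CompactCalculus

open scoped Matrix.Norms.L2Operator CompactlySupported
open nSpectrum

variable {n : ℕ}

/-- Continuous matrix-valued functions with compact support. -/
def IsCcMat {X : Type*} [TopologicalSpace X] (F : X → Matrix (Fin n) (Fin n) ℂ) : Prop :=
  Continuous F ∧ HasCompactSupport F

namespace IsCcMat

variable {X : Type*} [TopologicalSpace X] {F G : X → Matrix (Fin n) (Fin n) ℂ}

theorem add (hF : IsCcMat F) (hG : IsCcMat G) : IsCcMat (F + G) :=
  ⟨hF.1.add hG.1, hF.2.add hG.2⟩

theorem smul (hF : IsCcMat F) (c : ℂ) : IsCcMat (c • F) :=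
  ⟨hF.1.const_smul c, hF.2.smul_left (f := fun _ => c)⟩

theorem star (hF : IsCcMat F) : IsCcMat fun x => star (F x) :=
  ⟨hF.1.star, hF.2.comp_left (g := Star.star) (star_zero _)⟩

theorem mul_left (hF : IsCcMat F) (hG : Continuous G) : IsCcMat fun x => G x * F x :=
  ⟨hG.mul hF.1, hF.2.mul_left⟩

theorem sum {ι : Type*} (s : Finset ι) {F : ι → X → Matrix (Fin n) (Fin n) ℂ}
    (hF : ∀ i ∈ s, IsCcMat (F i)) : IsCcMat (∑ i ∈ s, F i) :=
  Finset.sum_induction F IsCcMat (fun _ _ => add) ⟨continuous_const, .zero⟩ hF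

theorem ofReal_smul {φ : X → ℝ} (hφ : Continuous φ) (hc : HasCompactSupport φ)
    (B : Matrix (Fin n) (Fin n) ℂ) : IsCcMat fun x => (φ x : ℂ) • B :=
  ⟨(Complex.continuous_ofReal.comp hφ).smul continuous_const,
    hc.comp_left (g := fun t : ℝ => (t : ℂ) • B) (by simp)⟩

theorem utwist [MulAction (Matrix.unitaryGroup (Fin n) ℂ) X] [T2Space X]
    [ContinuousSMul (Matrix.unitaryGroup (Fin n) ℂ) X] (hF : IsCcMat F)
    (U : Matrix.unitaryGroup (Fin n) ℂ) : IsCcMat (utwist U F) :=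
  ⟨continuous_utwist hF.1 U,
    .intro (isCompact_saturatedSupport hF.2) fun _ hx => utwist_eq_zero hx U⟩

end IsCcMat

variable {H : Type u} [NormedAddCommGroup H] [InnerProductSpace ℂ H] [CompleteSpace H]
  {k : ℕ} {T : Fin k → H →L[ℂ] H}

open Classical in
/-- The element of `C*(T)` that gives a function on the spectrum. -/
noncomputable def nSpectrum.lift (F : nSpectrum n T → Matrix (Fin n) (Fin n) ℂ) :
    generatedCStar T := if h : ∃ a, ∀ x : nSpectrum n T, rep x a = F x then h.choose else 0

/-- The element of `C*(T)` that gives the average of a function on the spectrum. -/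
noncomputable def nSpectrum.averageLift (F : nSpectrum n T → Matrix (Fin n) (Fin n) ℂ) :
    generatedCStar T := lift (uaverage F)

namespace IsNHomogeneousSystem

variable [NeZero n] (hT : IsNHomogeneousSystem n T)
  {F G : nSpectrum n T → Matrix (Fin n) (Fin n) ℂ}

include hT

theorem rep_lift (hF : IsC0Equivariant F) (x : nSpectrum n T) : rep x (lift F) = F x := by
  have h := hT.exists_rep_eq hF
  rw [lift, dif_pos h]
  exact h.choose_spec x

theorem rep_averageLift (hF : IsCcMat F) (x : nSpectrum n T) :
    rep x (averageLift F) = uaverage F x :=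
  hT.rep_lift (isC0Equivariant_uaverage hF.1 hF.2) x

theorem averageLift_eq (hF : IsCcMat F) {a : generatedCStar T}
    (h : ∀ x : nSpectrum n T, rep x a = uaverage F x) : averageLift F = a :=
  hT.rep_injective fun x => by rw [hT.rep_averageLift hF, h]

theorem averageLift_add (hF : IsCcMat F) (hG : IsCcMat G) :
    averageLift (F + G) = averageLift F + averageLift G :=
  hT.averageLift_eq (hF.add hG) fun x => by
    rw [map_add, hT.rep_averageLift hF, hT.rep_averageLift hG, uaverage_add hF.1 hG.1, Pi.add_apply]

theorem averageLift_smul (hF : IsCcMat F) (c : ℂ) : averageLift (c • F) = c • averageLift F :=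
  hT.averageLift_eq (hF.smul c) fun x => by
    rw [map_smul, hT.rep_averageLift hF, uaverage_smul, Pi.smul_apply]

theorem averageLift_star (hF : IsCcMat F) :
    averageLift (fun x => star (F x)) = star (averageLift F) :=
  hT.averageLift_eq hF.star fun x => by
    rw [map_star, hT.rep_averageLift hF, uaverage_conjTranspose]

theorem averageLift_rep_mul (hF : IsCcMat F) (a : generatedCStar T) :
    averageLift (fun x => rep x a * F x) = a * averageLift F :=
  hT.averageLift_eq (hF.mul_left (continuous_rep_apply a)) fun x => by
    rw [map_mul, hT.rep_averageLift hF, uaverage_mul hF.1 fun U x => rep_smul U x a]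

theorem averageLift_utwist (hF : IsCcMat F) (U : Matrix.unitaryGroup (Fin n) ℂ) :
    averageLift (utwist U F) = averageLift F :=
  hT.averageLift_eq (hF.utwist U) fun x => by
    rw [hT.rep_averageLift hF, uaverage_utwist]

theorem averageLift_sum {ι : Type*} (s : Finset ι)
    {F : ι → nSpectrum n T → Matrix (Fin n) (Fin n) ℂ} (hF : ∀ i, IsCcMat (F i)) :
    averageLift (∑ i ∈ s, F i) = ∑ i ∈ s, averageLift (F i) := by
  classical
  induction s using Finset.induction_on with
  | empty => simpa using hT.averageLift_smul (F := 0) ⟨continuous_const, .zero⟩ 0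
  | insert i s hi ih =>
    rw [Finset.sum_insert hi, Finset.sum_insert hi,
      hT.averageLift_add (hF i) (.sum s fun j _ => hF j), ih]

theorem norm_averageLift_le (hF : IsCcMat F) {C : ℝ} (hC : ∀ x, ‖F x‖ ≤ C) (hC0 : 0 ≤ C) :
    ‖averageLift F‖ ≤ C := by
  refine hT.norm_le _ hC0 fun x => ?_
  rw [hT.rep_averageLift hF]
  refine (norm_integral_le_of_norm_le_const (C := C) (Eventually.of_forall fun U => ?_)).trans ?_
  · rw [norm_utwist]
    exact hC _
  · simp

/-- Positivity is tested at the points of the spectrum, where the element is a Haar average of the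
positive matrices φ(U⁻¹x) (BU*)*(BU*). -/
theorem re_inner_averageLift_nonneg {φ : nSpectrum n T → ℝ} (hφ : Continuous φ)
    (hc : HasCompactSupport φ) (h0 : ∀ x, 0 ≤ φ x) (B : Matrix (Fin n) (Fin n) ℂ) (h : H) :
    0 ≤ (⟪h, (averageLift fun x => (φ x : ℂ) • (star B * B) : generatedCStar T).1 h⟫_ℂ).re := by
  have hF := IsCcMat.ofReal_smul hφ hc (star B * B)
  have h1 := IsNHomogeneous.re_nonneg hT le_rfl
    (averageLift fun x => (φ x : ℂ) • (star B * B) : generatedCStar T) (fun π hπ ξ => ?_)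
    (NonUnitalStarSubalgebraClass.subtype (R := ℂ) (generatedCStar T)) h
  · simpa using h1
  rw [zero_mul, zero_add, ← rep_ofRep π hπ, hT.rep_averageLift hF]
  let g : Matrix (Fin n) (Fin n) ℂ →L[ℝ] ℝ := LinearMap.toContinuousLinearMap
    { toFun := fun A => (⟪ξ, Matrix.toEuclideanCLM (n := Fin n) (𝕜 := ℂ) A ξ⟫_ℂ).re
      map_add' := fun A A' => by rw [map_add, add_apply, inner_add_right, Complex.add_re]
      map_smul' := fun c A => by
        rw [← Complex.coe_smul, map_smul, smul_apply, inner_smul_right, Complex.re_ofReal_mul]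
        rfl }
  have hg : ∀ A, g A = (⟪ξ, Matrix.toEuclideanCLM (n := Fin n) (𝕜 := ℂ) A ξ⟫_ℂ).re := fun _ => rfl
  rw [← hg, uaverage, ← g.integral_comp_comm (integrable_utwist hF.1 _)]
  refine integral_nonneg fun U => ?_
  have h2 : utwist U (fun x => (φ x : ℂ) • (star B * B)) (ofRep π hπ) =
      (φ (U⁻¹ • ofRep π hπ) : ℂ) • (star (B * star (U : Matrix (Fin n) (Fin n) ℂ)) *
        (B * star (U : Matrix (Fin n) (Fin n) ℂ))) := by
    rw [utwist, mul_smul_comm, smul_mul_assoc, star_mul, star_star]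
    simp only [mul_assoc]
  rw [Pi.zero_apply, h2, hg, map_smul, smul_apply, inner_smul_right, Complex.re_ofReal_mul, map_mul,
    map_star, ContinuousLinearMap.star_eq_adjoint, mul_apply_eq_comp,
    ContinuousLinearMap.adjoint_inner_right]
  exact mul_nonneg (h0 _) (inner_self_nonneg (𝕜 := ℂ))

theorem exists_positive_measure (B : Matrix (Fin n) (Fin n) ℂ) :
    ∃ E : OperatorMeasure (nSpectrum n T) H, ∀ φ : C_c(nSpectrum n T, ℝ),
      E.integral (fun x => (φ x : ℂ)) =
        (averageLift fun x => (φ x : ℂ) • (star B * B) : generatedCStar T).1 := by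
  have hcc : ∀ φ : C_c(nSpectrum n T, ℝ), IsCcMat fun x => (φ x : ℂ) • (star B * B) := fun φ =>
    .ofReal_smul φ.continuous φ.hasCompactSupport _
  refine OperatorMeasure.exists_of_positive (C := ‖star B * B‖)
    { toFun := fun φ => (averageLift fun x => (φ x : ℂ) • (star B * B) : generatedCStar T).1
      map_add' := fun φ ψ => ?_
      map_smul' := fun c φ => ?_ } (fun φ => ?_)
    (fun φ hφ => hT.re_inner_averageLift_nonneg φ.continuous φ.hasCompactSupport hφ B)
    fun φ hφ => ?_
  · rw [← NonUnitalStarSubalgebra.coe_add, ← hT.averageLift_add (hcc φ) (hcc ψ)]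
    congr 2
    funext x
    simp [add_smul]
  · rw [RingHom.id_apply, ← Complex.coe_smul, ← NonUnitalStarSubalgebra.coe_smul,
      ← hT.averageLift_smul (hcc φ)]
    congr 2
    funext x
    simp [mul_smul]
  · have h1 := hT.averageLift_star (hcc φ)
    simp only [star_smul, star_mul, star_star, Complex.star_def, Complex.conj_ofReal] at h1
    exact congrArg Subtype.val h1.symm
  · refine hT.norm_averageLift_le (hcc φ) (fun x => ?_) (norm_nonneg _)
    rw [norm_smul, Complex.norm_real, Real.norm_of_nonneg (hφ x).1]
    exact mul_le_of_le_one_left (norm_nonneg _) (hφ x).2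

omit hT in
-- Polarization of e_jk = e_jj* e_jk, reducing matrix units to the positive matrices B*B handled by
-- `exists_positive_measure`.
theorem single_eq_polarization (j k : Fin n) : Matrix.single j k (1 : ℂ) =
    ∑ m : Fin 4, (star (Complex.I ^ (m : ℕ)) / 4) •
      (star (Matrix.single j j (1 : ℂ) + Complex.I ^ (m : ℕ) • Matrix.single j k (1 : ℂ)) *
        (Matrix.single j j (1 : ℂ) + Complex.I ^ (m : ℕ) • Matrix.single j k (1 : ℂ))) := by
  have h1 : star (Matrix.single j j (1 : ℂ)) * Matrix.single j k (1 : ℂ) =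
      Matrix.single j k (1 : ℂ) := by
    rw [Matrix.star_eq_conjTranspose, Matrix.conjTranspose_single, star_one,
      Matrix.single_mul_single_same, one_mul]
  generalize Matrix.single j j (1 : ℂ) = A at *
  generalize Matrix.single j k (1 : ℂ) = D at *
  simp only [Fin.sum_univ_four, star_add, star_smul, add_mul, mul_add, smul_mul_assoc,
    mul_smul_comm, h1]
  simp only [Fin.coe_ofNat_eq_mod, Complex.star_def, map_pow, Complex.conj_I]
  match_scalars <;> ring_nf <;>
    simp [Complex.I_sq, Complex.I_pow_four, Complex.I_pow_three] <;> ring_nf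

theorem exists_matrixMeasure : ∃ E : Matrix (Fin n) (Fin n) (OperatorMeasure (nSpectrum n T) H),
    ∀ F : nSpectrum n T → Matrix (Fin n) (Fin n) ℂ, IsCcMat F →
      nIntegral F E = (averageLift F : generatedCStar T).1 := by
  choose E₀ hE₀ using hT.exists_positive_measure
  let E : Matrix (Fin n) (Fin n) (OperatorMeasure (nSpectrum n T) H) := fun k j =>
    OperatorMeasure.linearComb Finset.univ (fun m : Fin 4 => star (Complex.I ^ (m : ℕ)) / 4)
      fun m => E₀ (Matrix.single j j (1 : ℂ) + Complex.I ^ (m : ℕ) • Matrix.single j k (1 : ℂ))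
  have h1 : ∀ (φ : nSpectrum n T → ℝ) (j k : Fin n), Continuous φ → HasCompactSupport φ →
      nIntegral (fun x => (φ x : ℂ) • Matrix.single j k (1 : ℂ)) E =
        (averageLift fun x => (φ x : ℂ) • Matrix.single j k (1 : ℂ) : generatedCStar T).1 := by
    intro φ j k hφ hc
    rw [nIntegral_smul_single, OperatorMeasure.integral_linearComb _ _ _ (.of_compactSupport hφ hc)]
    have h2 := fun B => hE₀ B ⟨⟨φ, hφ⟩, hc⟩
    simp only [CompactlySupportedContinuousMap.coe_mk, ContinuousMap.coe_mk] at h2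
    simp only [h2]
    have h3 := hT.averageLift_sum (Finset.univ : Finset (Fin 4))
      (F := fun m => (star (Complex.I ^ (m : ℕ)) / 4) • fun x : nSpectrum n T => (φ x : ℂ) •
        (star (Matrix.single j j (1 : ℂ) + Complex.I ^ (m : ℕ) • Matrix.single j k (1 : ℂ)) *
        (Matrix.single j j (1 : ℂ) + Complex.I ^ (m : ℕ) • Matrix.single j k (1 : ℂ))))
      fun m => (IsCcMat.ofReal_smul hφ hc _).smul _
    simp only [hT.averageLift_smul (IsCcMat.ofReal_smul hφ hc _)] at h3
    have h4 : (fun x : nSpectrum n T => (φ x : ℂ) • Matrix.single j k (1 : ℂ)) =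
        ∑ m : Fin 4, (star (Complex.I ^ (m : ℕ)) / 4) • fun x : nSpectrum n T => (φ x : ℂ) •
        (star (Matrix.single j j (1 : ℂ) + Complex.I ^ (m : ℕ) • Matrix.single j k (1 : ℂ)) *
        (Matrix.single j j (1 : ℂ) + Complex.I ^ (m : ℕ) • Matrix.single j k (1 : ℂ))) := by
      funext x
      conv_lhs => rw [single_eq_polarization j k]
      rw [Finset.smul_sum, Finset.sum_apply]
      exact Finset.sum_congr rfl fun m _ => smul_comm _ _ _
    rw [h4, h3]
    simp only [AddSubmonoidClass.coe_finsetSum]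
    rfl
  refine ⟨E, fun F hF => ?_⟩
  have hb : ∀ {F : nSpectrum n T → Matrix (Fin n) (Fin n) ℂ}, IsCcMat F → IsBddMat F := fun hF =>
    .of_compactSupport hF.1 hF.2
  have hre : ∀ p : Fin n × Fin n, Continuous (fun x => (F x p.1 p.2).re) ∧
      HasCompactSupport fun x => (F x p.1 p.2).re := fun p =>
    ⟨Complex.continuous_re.comp (hF.1.matrix_elem _ _),
      hF.2.comp_left (g := fun A : Matrix (Fin n) (Fin n) ℂ => (A p.1 p.2).re) rfl⟩
  have him : ∀ p : Fin n × Fin n, Continuous (fun x => (F x p.1 p.2).im) ∧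
      HasCompactSupport fun x => (F x p.1 p.2).im := fun p =>
    ⟨Complex.continuous_im.comp (hF.1.matrix_elem _ _),
      hF.2.comp_left (g := fun A : Matrix (Fin n) (Fin n) ℂ => (A p.1 p.2).im) rfl⟩
  -- The identity `h1` covers real φ only, so the entries of F are split into real and imaginary
  -- parts.
  let R : Fin n × Fin n → nSpectrum n T → Matrix (Fin n) (Fin n) ℂ := fun p x =>
    ((F x p.1 p.2).re : ℂ) • Matrix.single p.1 p.2 (1 : ℂ)
  let J : Fin n × Fin n → nSpectrum n T → Matrix (Fin n) (Fin n) ℂ := fun p x =>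
    ((F x p.1 p.2).im : ℂ) • Matrix.single p.1 p.2 (1 : ℂ)
  have hR : ∀ p, IsCcMat (R p) := fun p => .ofReal_smul (hre p).1 (hre p).2 _
  have hJ : ∀ p, IsCcMat (J p) := fun p => .ofReal_smul (him p).1 (him p).2 _
  have hFs : F = ∑ p, (R p + Complex.I • J p) := by
    funext x
    conv_lhs => rw [Matrix.matrix_eq_sum_single (F x)]
    rw [Finset.sum_apply, Fintype.sum_prod_type]
    refine Finset.sum_congr rfl fun j _ => Finset.sum_congr rfl fun k _ => ?_
    simp only [R, J, Pi.add_apply, Pi.smul_apply, smul_smul, ← add_smul]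
    rw [mul_comm Complex.I, Complex.re_add_im, Matrix.smul_single, smul_eq_mul, mul_one]
  refine ContinuousLinearMap.ext fun h => ext_inner_left ℂ fun w => ?_
  have hn := isNormalMatFunctional_nIntegral E h w
  rw [hFs, hn.map_sum _ fun p => (hb (hR p)).add ((hb (hJ p)).const_smul _),
    hT.averageLift_sum _ fun p => (hR p).add ((hJ p).smul _), AddSubmonoidClass.coe_finsetSum,
    sum_apply, inner_sum]
  refine Finset.sum_congr rfl fun p _ => ?_
  rw [hn.add _ _ (hb (hR p)) ((hb (hJ p)).const_smul _), hn.smul _ _ (hb (hJ p)),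
    hT.averageLift_add (hR p) ((hJ p).smul _), hT.averageLift_smul (hJ p)]
  simp only [R, J]
  rw [h1 _ _ _ (hre p).1 (hre p).2, h1 _ _ _ (him p).1 (him p).2, NonUnitalStarSubalgebra.coe_add,
    NonUnitalStarSubalgebra.coe_smul, add_apply, smul_apply, inner_add_right, inner_smul_right]

end IsNHomogeneousSystem

end CompactCalculus

/-! ### The spectral `n`-measure of a system -/

section SpectralMeasure

open scoped Matrix.Norms.L2Operator
open nSpectrum

variable {n : ℕ} {H : Type u} [NormedAddCommGroup H] [InnerProductSpace ℂ H] [CompleteSpace H]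
  {k : ℕ} {T : Fin k → H →L[ℂ] H}

theorem nSpectrum.isBddMat_rep (a : generatedCStar T) :
    IsBddMat fun x : nSpectrum n T => rep x a :=
  .of_continuous (continuous_rep_apply a) fun x => norm_rep_le x a

theorem nSpectrum.rep_mem_BorelCStar (a : generatedCStar T) :
    (fun x : nSpectrum n T => rep x a) ∈ BorelCStar n (nSpectrum n T) :=
  mem_BorelCStar_iff.2 ⟨isBddMat_rep a, fun U x => rep_smul U x a⟩

/-- The total variations are finite Borel measures on a locally compact, second countable metrizable
space, so regularity is automatic. -/
theorem isRegularNMeasure_nSpectrum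
    (E : Matrix (Fin n) (Fin n) (OperatorMeasure (nSpectrum n T) H)) : IsRegularNMeasure E :=
  fun j k h w => by
    have := OperatorMeasure.isFiniteMeasure_variation ((E j k).scalar h w)
    infer_instance

theorem nMeasure_ext {E E' : Matrix (Fin n) (Fin n) (OperatorMeasure (nSpectrum n T) H)}
    (h : ∀ F, IsCcMat F → nIntegral F E = nIntegral F E') : E = E' := by
  ext1 p q
  refine OperatorMeasure.ext_of_compactSupport fun φ h1 h2 => ?_
  rw [← nIntegral_smul_single, ← nIntegral_smul_single, h _ (.ofReal_smul h1 h2 _)]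

namespace IsNHomogeneousSystem

variable [NeZero n] (hT : IsNHomogeneousSystem n T)
  {E : Matrix (Fin n) (Fin n) (OperatorMeasure (nSpectrum n T) H)}
  (hE : ∀ F : nSpectrum n T → Matrix (Fin n) (Fin n) ℂ, IsCcMat F →
    nIntegral F E = (averageLift F : generatedCStar T).1)
  {F : nSpectrum n T → Matrix (Fin n) (Fin n) ℂ}

include hT hE

/-- `averageLift` does not see twists. Tested on φ(U⁻¹ ·) e_qp, this is the transformation law on
C_c, which extends to indicators. -/
theorem isNMeasure_of_eq_averageLift : IsNMeasure E := by
  intro U A hA p q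
  have hm : Measurable fun x : nSpectrum n T => U⁻¹ • x := (continuous_const_smul U⁻¹).measurable
  have hmem : ∀ x : nSpectrum n T, x ∈ (fun x => U • x) '' A ↔ U⁻¹ • x ∈ A := fun x =>
    Set.mem_smul_set_iff_inv_smul_mem (A := A) (a := U) (x := x)
  have hA' : MeasurableSet ((fun x => U • x) '' A) := by
    have : (fun x : nSpectrum n T => U • x) '' A = (fun x => U⁻¹ • x) ⁻¹' A := Set.ext hmem
    rw [this]
    exact hm hA
  have hind : (A.indicator fun _ => (1 : ℂ)) ∘ (fun x : nSpectrum n T => U⁻¹ • x) =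
      ((fun x => U • x) '' A).indicator fun _ => 1 := by
    funext x
    by_cases hx : U⁻¹ • x ∈ A
    · rw [Set.indicator_of_mem ((hmem x).2 hx), Function.comp_apply, Set.indicator_of_mem hx]
    · rw [Set.indicator_of_notMem (mt (hmem x).1 hx), Function.comp_apply,
        Set.indicator_of_notMem hx]
  refine ContinuousLinearMap.ext fun h => ext_inner_left ℂ fun w => ?_
  simp only [← OperatorMeasure.integral_indicator _ hA, ← OperatorMeasure.integral_indicator _ hA',
    ← hind, sum_apply, smul_apply, inner_sum, inner_smul_right]
  refine (((E p q).isNormalFunctional h w).comp hm).ext_compactSupport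
    (.sum _ fun j => .sum _ fun k => ((E j k).isNormalFunctional h w).const_mul _)
    (fun φ hφ hc => ?_) (.indicator_const hA 1)
  let φ' : nSpectrum n T → ℝ := fun x => φ (U⁻¹ • x)
  have hφ' : Continuous φ' := hφ.comp (continuous_const_smul U⁻¹)
  have hc' : HasCompactSupport φ' := hc.comp_homeomorph (Homeomorph.smul U⁻¹)
  have hcc := IsCcMat.ofReal_smul hφ' hc' (Matrix.single q p (1 : ℂ))
  let B := star (U : Matrix (Fin n) (Fin n) ℂ) * Matrix.single q p (1 : ℂ) *
    (U : Matrix (Fin n) (Fin n) ℂ)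
  have h1 : utwist U⁻¹ (fun x => (φ' x : ℂ) • Matrix.single q p (1 : ℂ)) =
      fun x => (φ x : ℂ) • B := by
    funext x
    have h2 : ((U⁻¹ : Matrix.unitaryGroup (Fin n) ℂ) : Matrix (Fin n) (Fin n) ℂ) =
      star (U : Matrix (Fin n) (Fin n) ℂ) := rfl
    simp only [utwist, φ', inv_inv, inv_smul_smul, h2, star_star, mul_smul_comm, smul_mul_assoc, B]
  have h3 : (E p q).integral (fun x => (φ' x : ℂ)) = ∑ j, ∑ k, B k j • (E j k).integral
      fun x => (φ x : ℂ) := by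
    rw [← nIntegral_smul_single, hE _ hcc, ← hT.averageLift_utwist hcc U⁻¹, h1,
      ← hE _ (.ofReal_smul hφ hc B), nIntegral_smul_const _ (.of_compactSupport hφ hc),
      Finset.sum_comm]
  change ⟪w, (E p q).integral (fun x => (φ' x : ℂ)) h⟫_ℂ = _
  rw [h3]
  simp only [sum_apply, smul_apply, inner_sum, inner_smul_right]
  refine Finset.sum_congr rfl fun j _ => Finset.sum_congr rfl fun k _ => ?_
  congr 1
  simp only [B, Matrix.mul_apply, Matrix.star_apply, Matrix.single_apply]
  rw [Finset.sum_eq_single p, Finset.sum_eq_single q]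
  · simp [mul_comm]
  · intro b _ hb
    simp [hb.symm]
  · simp
  · intro b _ hb
    simp [hb.symm]
  · simp

/-- `rep · a` vanishes at infinity but need not have compact support. The cutoff depends only on
‖rep x a‖, so the truncations stay equivariant and equal their own averages. -/
theorem nIntegral_rep (a : generatedCStar T) :
    nIntegral (fun x : nSpectrum n T => rep x a) E = a.1 := by
  let F : ℕ → nSpectrum n T → Matrix (Fin n) (Fin n) ℂ := fun m x =>
    (ramp ((m + 1 : ℕ) * ‖rep x a‖) : ℂ) • rep x a
  have hρ : ∀ m, Continuous fun x : nSpectrum n T => ramp ((m + 1 : ℕ) * ‖rep x a‖) := fun m =>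
    continuous_ramp.comp (continuous_const.mul (continuous_rep_apply a).norm)
  have hF : ∀ m, IsCcMat (F m) := fun m => by
    refine ⟨(Complex.continuous_ofReal.comp (hρ m)).smul (continuous_rep_apply a),
      .intro (nSpectrum.isCompact_le_norm (n := n) a (ε := 1 / (3 * (m + 1 : ℕ))) (by positivity))
        fun x hx => ?_⟩
    have h1 : ‖rep x a‖ < 1 / (3 * (m + 1 : ℕ)) := not_le.1 hx
    simp only [F]
    rw [ramp_of_le, Complex.ofReal_zero, zero_smul]
    rw [lt_div_iff₀ (by positivity)] at h1
    linarith
  have hFU : ∀ m (U : Matrix.unitaryGroup (Fin n) ℂ) (x : nSpectrum n T), F m (U • x) =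
      (U : Matrix (Fin n) (Fin n) ℂ) * F m x * star (U : Matrix (Fin n) (Fin n) ℂ) :=
    fun m U x => by
      simp only [F]
      rw [rep_smul, norm_conj_unitary U.2, mul_smul_comm, smul_mul_assoc]
  have hrep : ∀ m x, rep x (averageLift (F m)) = F m x := fun m x => by
    rw [hT.rep_averageLift (hF m), uaverage_of_equivariant (hFU m)]
  -- The cutoff differs from 1 only where (m + 1) ‖rep x a‖ < 2/3.
  have hle : ∀ m x, ‖F m x - rep x a‖ ≤ 1 / (m + 1 : ℕ) := fun m x => by
    have h1 : F m x - rep x a = ((ramp ((m + 1 : ℕ) * ‖rep x a‖) - 1 : ℝ) : ℂ) • rep x a := by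
      simp only [F]
      push_cast
      rw [sub_smul, one_smul]
    rw [h1, norm_smul, Complex.norm_real]
    have h2 := ramp_nonneg ((m + 1 : ℕ) * ‖rep x a‖)
    have h3 := ramp_le_one ((m + 1 : ℕ) * ‖rep x a‖)
    by_cases h4 : 2 / 3 ≤ (m + 1 : ℕ) * ‖rep x a‖
    · rw [ramp_of_ge h4, sub_self, norm_zero, zero_mul]
      positivity
    · have h5 : ‖rep x a‖ ≤ 1 / (m + 1 : ℕ) := by
        rw [le_div_iff₀ (by positivity)]
        linarith
      refine (mul_le_of_le_one_left (norm_nonneg _) ?_).trans h5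
      rw [Real.norm_eq_abs, abs_le]
      constructor <;> linarith
  have hlim0 : Tendsto (fun m : ℕ => (1 : ℝ) / (m + 1 : ℕ)) atTop (𝓝 0) := by
    simpa using tendsto_one_div_add_atTop_nhds_zero_nat (𝕜 := ℝ)
  have hlim : Tendsto (fun m => (averageLift (F m) : generatedCStar T)) atTop (𝓝 a) := by
    rw [tendsto_iff_norm_sub_tendsto_zero]
    refine squeeze_zero (fun _ => norm_nonneg _) (fun m => ?_) hlim0
    refine hT.norm_le _ (by positivity) fun x => ?_
    rw [map_sub, hrep]
    exact hle m x
  refine ContinuousLinearMap.ext fun h => ext_inner_left ℂ fun w => ?_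
  refine tendsto_nhds_unique ((isNormalMatFunctional_nIntegral E h w).tendsto F _ (‖a‖)
    (fun m => (hF m).1.measurable) (fun m x => ?_) fun x => ?_) ?_
  · simp only [F]
    rw [norm_smul, Complex.norm_real, Real.norm_of_nonneg (ramp_nonneg _)]
    exact (mul_le_of_le_one_left (norm_nonneg _) (ramp_le_one _)).trans (norm_rep_le x a)
  · rw [tendsto_iff_norm_sub_tendsto_zero]
    exact squeeze_zero (fun _ => norm_nonneg _) (fun m => hle m x) hlim0
  · simp only [hE _ (hF _)]
    have h1 : Continuous fun b : generatedCStar T => ⟪w, b.1 h⟫_ℂ :=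
      continuous_const.inner (continuous_subtype_val.clm_apply continuous_const)
    exact (h1.tendsto a).comp hlim

theorem adjoint_nIntegral (hF : IsBddMat F) :
    (nIntegral F E).adjoint = nIntegral (fun x => star (F x)) E := by
  refine ContinuousLinearMap.ext fun h => ext_inner_left ℂ fun w => ?_
  rw [ContinuousLinearMap.adjoint_inner_right]
  have h1 := (isNormalMatFunctional_nIntegral E w h).ext_compactSupport
    (isNormalMatFunctional_nIntegral E h w).conj (fun φ i j hφ hc => ?_) hF
  · rw [← inner_conj_symm, h1]
    exact star_star _
  · have hcc := IsCcMat.ofReal_smul hφ hc (Matrix.single i j (1 : ℂ))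
    rw [hE _ hcc, hE _ hcc.star, hT.averageLift_star hcc, StarMemClass.coe_star,
      ContinuousLinearMap.star_eq_adjoint, ContinuousLinearMap.adjoint_inner_right]
    exact (inner_conj_symm _ _).symm

theorem nIntegral_rep_mul (hF : IsBddMat F) (a : generatedCStar T) :
    nIntegral (fun x => rep x a * F x) E = a.1 * nIntegral F E := by
  refine ContinuousLinearMap.ext fun h => ext_inner_left ℂ fun w => ?_
  rw [mul_apply_eq_comp, ← ContinuousLinearMap.adjoint_inner_left a.1]
  refine ((isNormalMatFunctional_nIntegral E h w).mul_left (isBddMat_rep a)).ext_compactSupport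
    (isNormalMatFunctional_nIntegral E h (a.1.adjoint w)) (fun φ i j hφ hc => ?_) hF
  have hcc := IsCcMat.ofReal_smul hφ hc (Matrix.single i j (1 : ℂ))
  rw [hE _ hcc, hE _ (hcc.mul_left (continuous_rep_apply a)), hT.averageLift_rep_mul hcc,
    ContinuousLinearMap.adjoint_inner_left]
  rfl

/-- The left product rule, transported to the right by adjoints. -/
theorem nIntegral_mul_rep (hF : IsBddMat F) (a : generatedCStar T) :
    nIntegral (fun x => F x * rep x a) E = nIntegral F E * a.1 := by
  have h1 := hT.nIntegral_rep_mul hE hF.star (star a)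
  have h2 := hT.adjoint_nIntegral hE ((isBddMat_rep (star a)).mul hF.star)
  rw [h1] at h2
  simp only [star_mul, star_star, map_star] at h2
  rw [← h2, ← ContinuousLinearMap.star_eq_adjoint, star_mul,
    ← hT.adjoint_nIntegral hE hF, StarMemClass.coe_star, star_star,
    ← ContinuousLinearMap.star_eq_adjoint, star_star]

/-- For F in C_c, averaging replaces F by a function `rep · b` without changing the integrals, and
`nIntegral_mul_rep` applies. Normality in F does the rest; F itself need not be equivariant. -/
theorem nIntegral_mul {f : nSpectrum n T → Matrix (Fin n) (Fin n) ℂ}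
    (hf : f ∈ BorelCStar n (nSpectrum n T)) (hF : IsBddMat F) :
    nIntegral (fun x => f x * F x) E = nIntegral f E * nIntegral F E := by
  have hfb := (mem_BorelCStar_iff.1 hf).1
  refine ContinuousLinearMap.ext fun h => ext_inner_left ℂ fun w => ?_
  rw [mul_apply_eq_comp, ← ContinuousLinearMap.adjoint_inner_left (nIntegral f E)]
  refine ((isNormalMatFunctional_nIntegral E h w).mul_left hfb).ext_compactSupport
    (isNormalMatFunctional_nIntegral E h ((nIntegral f E).adjoint w)) (fun φ i j hφ hc => ?_) hF
  have hcc := IsCcMat.ofReal_smul hφ hc (Matrix.single i j (1 : ℂ))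
  have h1 := (hT.isNMeasure_of_eq_averageLift hE).nIntegral_mul_uaverage hf hcc.1 hcc.2
  simp only [← hT.rep_averageLift hcc] at h1
  rw [← h1, hT.nIntegral_mul_rep hE hfb, hE _ hcc, ContinuousLinearMap.adjoint_inner_left]
  rfl

theorem isSpectralNMeasureOf_of_eq_averageLift : IsSpectralNMeasureOf T E := by
  refine ⟨⟨hT.isNMeasure_of_eq_averageLift hE, isRegularNMeasure_nSpectrum E,
    fun f hf => hT.adjoint_nIntegral hE (mem_BorelCStar_iff.1 hf).1,
    fun f hf g hg => hT.nIntegral_mul hE hf (mem_BorelCStar_iff.1 hg).1⟩, fun j => ?_⟩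
  simp only [coe_apply]
  exact hT.nIntegral_rep hE _

/-- Integrals against the spectral measure commute with the commutant of the system. -/
theorem commute_nIntegral {S : H →L[ℂ] H} (hS : ∀ a : generatedCStar T, Commute S a.1)
    (hF : IsBddMat F) : Commute S (nIntegral F E) := by
  refine ContinuousLinearMap.ext fun h => ext_inner_left ℂ fun w => ?_
  rw [mul_apply_eq_comp, mul_apply_eq_comp, ← ContinuousLinearMap.adjoint_inner_left]
  refine (isNormalMatFunctional_nIntegral E h (S.adjoint w)).ext_compactSupport
    (isNormalMatFunctional_nIntegral E (S h) w) (fun φ i j hφ hc => ?_) hF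
  rw [hE _ (.ofReal_smul hφ hc _), ContinuousLinearMap.adjoint_inner_left]
  exact congrArg (fun R : H →L[ℂ] H => ⟪w, R h⟫_ℂ) (hS _).eq

/-- By the double commutant theorem it suffices to commute with M'. Elements of M' commute with
C*(T) because M' is closed under adjoints, hence with all integrals. -/
theorem nIntegral_mem (M : VonNeumannAlgebra H) (hTM : ∀ j, T j ∈ M) (hF : IsBddMat F) :
    nIntegral F E ∈ M := by
  rw [← M.commutant_commutant, VonNeumannAlgebra.mem_commutant_iff]
  intro S hS
  have hM : ∀ a : generatedCStar T, ∀ S ∈ M.commutant, Commute S a.1 := by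
    refine generatedCStar_induction ?_ (fun j S hS => ?_) (fun S _ => Commute.zero_right S)
      (fun a b ha hb S hS => (ha S hS).add_right (hb S hS))
      (fun a b ha hb S hS => (ha S hS).mul_right (hb S hS))
      (fun c a ha S hS => (ha S hS).smul_right c) (fun a ha S hS => ?_)
    · simp only [Set.ofPred_forall]
      exact isClosed_iInter fun S => isClosed_iInter fun _ => isClosed_eq
        (continuous_const.mul continuous_subtype_val) (continuous_subtype_val.mul continuous_const)
    · exact (VonNeumannAlgebra.mem_commutant_iff.1 hS _ (hTM j)).symm
    · simpa using (ha _ (star_mem hS)).star_star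
  exact (hT.commute_nIntegral hE (fun a => hM a S hS) hF).eq

/-- Bounded pointwise convergence implies strong convergence of the integrals. -/
theorem tendsto_nIntegral {F : ℕ → nSpectrum n T → Matrix (Fin n) (Fin n) ℂ}
    {f : nSpectrum n T → Matrix (Fin n) (Fin n) ℂ} {C : ℝ}
    (hF : ∀ m, F m ∈ BorelCStar n (nSpectrum n T)) (hf : f ∈ BorelCStar n (nSpectrum n T))
    (hlim : ∀ x, Tendsto (fun m => F m x) atTop (𝓝 (f x))) (hC : ∀ m x, ‖F m x‖ ≤ C) (h : H) :
    Tendsto (fun m => nIntegral (F m) E h) atTop (𝓝 (nIntegral f E h)) := by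
  obtain ⟨hfb, hfU⟩ := mem_BorelCStar_iff.1 hf
  have hFb : ∀ m, IsBddMat (F m) := fun m => (mem_BorelCStar_iff.1 (hF m)).1
  let g : ℕ → nSpectrum n T → Matrix (Fin n) (Fin n) ℂ := fun m => F m + (-1 : ℂ) • f
  have hgb : ∀ m, IsBddMat (g m) := fun m => (hFb m).add (hfb.const_smul _)
  have hg : ∀ m, (fun x => star (g m x)) ∈ BorelCStar n (nSpectrum n T) := fun m =>
    mem_BorelCStar_iff.2 ⟨(hgb m).star, fun U x => by
      simp only [g, Pi.add_apply, Pi.smul_apply, (mem_BorelCStar_iff.1 (hF m)).2 U x, hfU U x,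
        star_add, star_smul, star_mul, star_star, mul_add, add_mul, mul_smul_comm, smul_mul_assoc,
        mul_assoc]⟩
  have hgi : ∀ m, nIntegral (g m) E h = nIntegral (F m) E h - nIntegral f E h := fun m =>
    ext_inner_left ℂ fun w => by
      have hn := isNormalMatFunctional_nIntegral E h w
      rw [hn.add _ _ (hFb m) (hfb.const_smul _), hn.smul _ _ hfb, inner_sub_right]
      ring
  obtain ⟨D, hD⟩ := hfb.2
  have hgC : ∀ m x, ‖g m x‖ ≤ C + D := fun m x => by
    refine (norm_add_le _ _).trans (add_le_add (hC m x) ?_)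
    rw [Pi.smul_apply, norm_smul, norm_neg, norm_one, one_mul]
    exact hD x
  have hg0 : ∀ x, Tendsto (fun m => g m x) atTop (𝓝 0) := fun x => by
    have := (hlim x).add_const ((-1 : ℂ) • f x)
    simpa [g] using this
  -- The product and adjoint rules turn the norm into a scalar integral of g*g, where bounded
  -- pointwise convergence to 0 applies.
  have hsq : ∀ m, (‖nIntegral (g m) E h‖ : ℂ) ^ 2 =
      ⟪h, nIntegral (fun x => star (g m x) * g m x) E h⟫_ℂ := fun m => by
    rw [hT.nIntegral_mul hE (hg m) (hgb m), ← hT.adjoint_nIntegral hE (hgb m), mul_apply_eq_comp,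
      ContinuousLinearMap.adjoint_inner_right, inner_self_eq_norm_sq_to_K]
    rfl
  have h0 : Tendsto (fun m => ⟪h, nIntegral (fun x => star (g m x) * g m x) E h⟫_ℂ) atTop
      (𝓝 ⟪h, nIntegral (fun _ : nSpectrum n T => (0 : Matrix (Fin n) (Fin n) ℂ)) E h⟫_ℂ) :=
    (isNormalMatFunctional_nIntegral E h h).tendsto _ _ ((C + D) * (C + D))
      (fun m => ((hgb m).star.mul (hgb m)).1)
      (fun m x => (norm_mul_le _ _).trans (by
        rw [norm_star]
        exact mul_le_mul (hgC m x) (hgC m x) (norm_nonneg _) ((norm_nonneg _).trans (hgC m x))))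
      fun x => by simpa using (hg0 x).star.mul (hg0 x)
  have hz : ⟪h, nIntegral (fun _ : nSpectrum n T => (0 : Matrix (Fin n) (Fin n) ℂ)) E h⟫_ℂ = 0 := by
    have := (isNormalMatFunctional_nIntegral E h h).smul 0 0 (.const 0)
    simpa [Pi.zero_def] using this
  rw [hz] at h0
  simp only [← hsq] at h0
  rw [tendsto_iff_norm_sub_tendsto_zero]
  have h1 : Tendsto (fun m => ‖nIntegral (g m) E h‖ ^ 2) atTop (𝓝 0) := by
    have := h0.norm
    simpa using this
  have h2 := h1.sqrt
  simpa [Real.sqrt_sq, hgi] using h2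

omit hE in
/-- Every spectral `n`-measure of the system integrates `C_c`-functions in the same way. -/
theorem nIntegral_eq_averageLift (hE : IsSpectralNMeasureOf T E) (hF : IsCcMat F) :
    nIntegral F E = (averageLift F : generatedCStar T).1 := by
  obtain ⟨⟨hN, -, hadj, hmul⟩, hgen⟩ := hE
  -- The axioms make integration a *-homomorphism on C*(T), automatically continuous. It agrees with
  -- the inclusion on the generators, hence everywhere.
  have hrep : ∀ a : generatedCStar T, nIntegral (fun x : nSpectrum n T => rep x a) E = a.1 := by
    let σ : generatedCStar T →⋆ₙₐ[ℂ] (H →L[ℂ] H) :=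
      { toFun := fun a => nIntegral (fun x : nSpectrum n T => rep x a) E
        map_smul' := fun c a => ContinuousLinearMap.ext fun h => ext_inner_left ℂ fun w => by
          have := (isNormalMatFunctional_nIntegral E h w).smul c _ (isBddMat_rep a)
          simp only [map_smul]
          rw [MonoidHom.id_apply, smul_apply, inner_smul_right]
          exact this
        map_zero' := ContinuousLinearMap.ext fun h => ext_inner_left ℂ fun w => by
          have := (isNormalMatFunctional_nIntegral E h w).smul 0 0 (.const 0)
          simpa [Pi.zero_def] using this
        map_add' := fun a b => ContinuousLinearMap.ext fun h => ext_inner_left ℂ fun w => by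
          have := (isNormalMatFunctional_nIntegral E h w).add _ _ (isBddMat_rep a) (isBddMat_rep b)
          simp only [map_add]
          rw [add_apply, inner_add_right]
          exact this
        map_mul' := fun a b => by
          simp only [map_mul]
          exact hmul _ (rep_mem_BorelCStar a) _ (rep_mem_BorelCStar b)
        map_star' := fun a => by
          simp only [map_star]
          exact (hadj _ (rep_mem_BorelCStar a)).symm }
    have hσ : Continuous σ := AddMonoidHomClass.continuous_of_bound σ 1 fun a => by
      simpa using NonUnitalStarAlgHom.norm_apply_le σ a
    refine generatedCStar_induction (p := fun a => σ a = a.1)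
      (isClosed_eq hσ continuous_subtype_val) (fun j => ?_) (map_zero σ) (fun a b ha hb => ?_)
      (fun a b ha hb => ?_) (fun c a ha => ?_) (fun a ha => ?_)
    · refine Eq.trans ?_ (hgen j)
      simp only [coe_apply]
      rfl
    · rw [map_add, ha, hb]; rfl
    · rw [map_mul, ha, hb]; rfl
    · rw [map_smul, ha]; rfl
    · rw [map_star, ha]; rfl
  -- Equivariance of E replaces F by its average, which is represented by `averageLift F`.
  rw [← hN.nIntegral_uaverage hF.1 hF.2, ← hrep]
  congr 1
  funext x
  rw [hT.rep_averageLift hF]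

end IsNHomogeneousSystem

end SpectralMeasure

theorem mainTheorem12 {H : Type u} [NormedAddCommGroup H] [InnerProductSpace ℂ H]
    [CompleteSpace H] (M : VonNeumannAlgebra H) {n k : ℕ} (hn : 1 ≤ n)
    (T : Fin k → H →L[ℂ] H) (hT : IsNHomogeneousSystem n T) (hTM : ∀ j, T j ∈ M) :
    ∃ E : Matrix (Fin n) (Fin n) (OperatorMeasure (nSpectrum n T) H),
      (IsSpectralNMeasureOf T E ∧
        ∀ E' : Matrix (Fin n) (Fin n) (OperatorMeasure (nSpectrum n T) H),
          IsSpectralNMeasureOf T E' → E' = E) ∧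
      (∀ f ∈ BorelCStar n (nSpectrum n T), nIntegral f E ∈ M) ∧
      (∀ (F : ℕ → nSpectrum n T → Matrix (Fin n) (Fin n) ℂ)
        (f : nSpectrum n T → Matrix (Fin n) (Fin n) ℂ),
        (∀ m, F m ∈ BorelCStar n (nSpectrum n T)) →
        (∀ x, Tendsto (fun m => F m x) atTop (𝓝 (f x))) →
        (∃ C : ℝ, ∀ m x, matNorm (F m x) ≤ C) →
        f ∈ BorelCStar n (nSpectrum n T) ∧
          ∀ h : H, Tendsto (fun m => nIntegral (F m) E h) atTop (𝓝 (nIntegral f E h))) := by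
  have : NeZero n := ⟨Nat.one_le_iff_ne_zero.1 hn⟩
  obtain ⟨E, hE⟩ := hT.exists_matrixMeasure
  refine ⟨E, ⟨hT.isSpectralNMeasureOf_of_eq_averageLift hE, fun E' hE' => nMeasure_ext fun F hF => ?_⟩,
    fun f hf => hT.nIntegral_mem hE M hTM (mem_BorelCStar_iff.1 hf).1, ?_⟩
  · rw [hE F hF, hT.nIntegral_eq_averageLift hE' hF]
  · rintro F f hF hlim ⟨C, hC⟩
    have hf : f ∈ BorelCStar n (nSpectrum n T) := by
      -- `matNorm` unfolds to the L2 operator norm, so the bound applies as it stands; equivariance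
      -- passes to the pointwise limit.
      refine mem_BorelCStar_iff.2 ⟨isBddMat_of_tendsto (fun m => (hF m).1) hC hlim, fun U x => ?_⟩
      refine tendsto_nhds_unique (hlim (U • x)) ?_
      simp only [(mem_BorelCStar_iff.1 (hF _)).2 U x]
      exact ((hlim x).const_mul _).mul_const _
    exact ⟨hf, hT.tendsto_nIntegral hE hF hf hlim hC⟩
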